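/- Let $\sigma=1$ (focusing case) or $\sigma=-1$ (defocusing case), let $\mu>-\sigma\pi^2$ and $T>0$, and let $\phi_\mu$ be the nonlinear ground state, i.e. the positive solution in $H^3_{(0)}((0,1),\mathbb R)$ of $\phi_\mu''+\sigma\phi_\mu^3=\sigma\mu\phi_\mu$ on $(0,1)$, $\phi_\mu(0)=\phi_\mu(1)=0$. Here $$H^3_{(0)}(0,1)=\{\varphi\in H^3(0,1)\,;\ \varphi=\varphi''=0\text{ at }x=0,1\},\qquad \dot H^1_0((0,T),\mathbb R)=\Big\{u\in H^1_0((0,T),\mathbb R)\,;\ \int_0^T u(t)\,dt=0\Big\},$$ and functions on $(0,1)$ are complex valued unless said otherwise. For $u\in\dot H^1_0((0,T),\mathbb R)$, the Cauchy problem $$i\partial_t\psi=-\partial_x^2\psi-\sigma|\psi|^2\psi+iu(t)\,\partial_x[x\psi],\qquad \psi(t,0)=\psi(t,1)=0,\qquad \psi(0,\cdot)=\phi_\mu,$$ has a unique solution $\psi\in C^0([0,T],H^3\cap H^1_0(0,1))\cap C^1([0,T],H^1_0(0,1))$, and $\psi(T)$ belongs to $H^3_{(0)}(0,1)\cap\mathcal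 S$, where $\mathcal S$ is the sphere of $L^2((0,1),\mathbb C)$ with centre $0$ and radius $\|\phi_\mu\|_{L^2(0,1)}$. The end-point map $$\Theta_{T,\mu}:\dot H^1_0((0,T),\mathbb R)\to H^3_{(0)}(0,1)\cap\mathcal S,\qquad u\mapsto\psi(T),$$ is $C^1$ (over the reals, as a map into $H^3_{(0)}(0,1)$). Moreover, for all $u,U\in\dot H^1_0((0,T),\mathbb R)$, with $\psi$ the solution above for the control $u$, the linearized system $$i\partial_t\Psi=-\partial_x^2\Psi-\sigma\big[2|\psi|^2\Psi+\psi^2\overline\Psi\big]+iu(t)\,\partial_x[x\Psi]+iU(t)\,\partial_x[x\psi],\qquad \Psi(t,0)=\Psi(t,1)=0,\qquad \Psi(0,\cdot)=0,$$ has a unique solution $\Psi\in C^0([0,T],H^3\cap H^1_0(0,1))\cap C^1([0,T],H^1_0(0,1))$, and $d\Theta_{T,\mu}(u)\cdot U=\Psi(T)$. -/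

import Mathlib

open MeasureTheory Set

noncomputable section

namespace BoxControl

set_option linter.unusedSectionVars false

variable (E : Type*) [NormedAddCommGroup E] [NormedSpace ℝ E]

/-- Lebesgue measure on the open interval `(a, b)`. -/
abbrev vol (a b : ℝ) : Measure ℝ := volume.restrict (Ioo a b)

/-- `L²((a, b), E)`. -/
abbrev L2 (a b : ℝ) := Lp E 2 (vol a b)

/-- The Hilbert sum of `k + 1` copies of `L²((a, b), E)`; an element `f` of the Sobolev space `Hᵏ`
is recorded as the tuple `(f, f', …, f⁽ᵏ⁾)` of its weak derivatives. -/
abbrev Jet (k : ℕ) (a b : ℝ) := PiLp 2 (fun _ : Fin (k + 1) => L2 E a b)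

variable {E}

/-- `g` is the weak derivative of `f` on `(a, b)`: integration by parts holds against all smooth
functions with compact support in `(a, b)`. -/
def HasWeakDeriv {a b : ℝ} (f g : L2 E a b) : Prop :=
  ∀ η : ℝ → ℝ, ContDiff ℝ (⊤ : ℕ∞) η → HasCompactSupport η → tsupport η ⊆ Ioo a b →
    ∫ x in Ioo a b, deriv η x • f x = - ∫ x in Ioo a b, η x • g x

/-- `g` is a continuous representative on `[a, b]` of `f`, and it vanishes at `a` and at `b`. -/
def IsVanishingRep {a b : ℝ} (f : L2 E a b) (g : ℝ → E) : Prop :=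
  ContinuousOn g (Icc a b) ∧ f =ᵐ[vol a b] g ∧ g a = 0 ∧ g b = 0

/-- `f = 0` at the end points `a`, `b`. -/
def VanishesAtEnds {a b : ℝ} (f : L2 E a b) : Prop := ∃ g : ℝ → E, IsVanishingRep f g

theorem VanishesAtEnds.zero {a b : ℝ} : VanishesAtEnds (0 : L2 E a b) :=
  ⟨0, continuousOn_const, Lp.coeFn_zero _ _ _, rfl, rfl⟩

theorem VanishesAtEnds.add {a b : ℝ} {f₁ f₂ : L2 E a b} (h₁ : VanishesAtEnds f₁)
    (h₂ : VanishesAtEnds f₂) : VanishesAtEnds (f₁ + f₂) := by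
  obtain ⟨g₁, c₁, e₁, l₁, r₁⟩ := h₁
  obtain ⟨g₂, c₂, e₂, l₂, r₂⟩ := h₂
  exact ⟨g₁ + g₂, c₁.add c₂, (Lp.coeFn_add _ _).trans (e₁.add e₂), by simp [l₁, l₂],
    by simp [r₁, r₂]⟩

theorem VanishesAtEnds.smul {a b : ℝ} (c : ℝ) {f : L2 E a b} (h : VanishesAtEnds f) :
    VanishesAtEnds (c • f) := by
  obtain ⟨g, hc, e, l, r⟩ := h
  exact ⟨c • g, hc.const_smul c, (Lp.coeFn_smul _ _).trans (e.const_smul c), by simp [l],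
    by simp [r]⟩

theorem integrable_smul_L2 {a b : ℝ} (f : L2 E a b) {η : ℝ → ℝ} (h : Continuous η)
    (hs : HasCompactSupport η) : Integrable (fun x => η x • f x) (vol a b) := by
  have : IsFiniteMeasure (vol a b) := ⟨by simp⟩
  have hf : Integrable f (vol a b) := (Lp.memLp f).integrable (by norm_num)
  obtain ⟨C, hC⟩ := hs.exists_bound_of_continuous h
  exact hf.bdd_smul C h.aestronglyMeasurable (Filter.Eventually.of_forall hC)

theorem HasWeakDeriv.zero {a b : ℝ} : HasWeakDeriv (0 : L2 E a b) 0 := by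
  intro η _ _ _
  have h : ((0 : L2 E a b) : ℝ → E) =ᵐ[vol a b] 0 := Lp.coeFn_zero _ _ _
  have h₁ : ∫ x in Ioo a b, deriv η x • (0 : L2 E a b) x = 0 :=
    integral_eq_zero_of_ae (h.mono fun x hx => by simp only [hx, Pi.zero_apply, smul_zero])
  have h₂ : ∫ x in Ioo a b, η x • (0 : L2 E a b) x = 0 :=
    integral_eq_zero_of_ae (h.mono fun x hx => by simp only [hx, Pi.zero_apply, smul_zero])
  rw [h₁, h₂, neg_zero]

theorem HasWeakDeriv.add {a b : ℝ} {f₁ g₁ f₂ g₂ : L2 E a b} (h₁ : HasWeakDeriv f₁ g₁)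
    (h₂ : HasWeakDeriv f₂ g₂) : HasWeakDeriv (f₁ + f₂) (g₁ + g₂) := by
  intro η hη hs ht
  have hd : Continuous (deriv η) := hη.continuous_deriv (by simp)
  have e₁ : ∫ x in Ioo a b, deriv η x • (f₁ + f₂ : L2 E a b) x
      = (∫ x in Ioo a b, deriv η x • f₁ x) + ∫ x in Ioo a b, deriv η x • f₂ x := by
    rw [← integral_add (integrable_smul_L2 f₁ hd hs.deriv) (integrable_smul_L2 f₂ hd hs.deriv)]
    exact integral_congr_ae ((Lp.coeFn_add f₁ f₂).mono fun x hx => by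
      simp only [hx, Pi.add_apply, smul_add])
  have e₂ : ∫ x in Ioo a b, η x • (g₁ + g₂ : L2 E a b) x
      = (∫ x in Ioo a b, η x • g₁ x) + ∫ x in Ioo a b, η x • g₂ x := by
    rw [← integral_add (integrable_smul_L2 g₁ hη.continuous hs)
      (integrable_smul_L2 g₂ hη.continuous hs)]
    exact integral_congr_ae ((Lp.coeFn_add g₁ g₂).mono fun x hx => by
      simp only [hx, Pi.add_apply, smul_add])
  rw [e₁, e₂, h₁ η hη hs ht, h₂ η hη hs ht, neg_add]

theorem HasWeakDeriv.smul {a b : ℝ} (c : ℝ) {f g : L2 E a b} (h : HasWeakDeriv f g) :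
    HasWeakDeriv (c • f) (c • g) := by
  intro η hη hs ht
  have e₁ : ∫ x in Ioo a b, deriv η x • (c • f : L2 E a b) x
      = c • ∫ x in Ioo a b, deriv η x • f x := by
    rw [← integral_smul]
    exact integral_congr_ae ((Lp.coeFn_smul c f).mono fun x hx => by
      simp only [hx, Pi.smul_apply, smul_comm c])
  have e₂ : ∫ x in Ioo a b, η x • (c • g : L2 E a b) x
      = c • ∫ x in Ioo a b, η x • g x := by
    rw [← integral_smul]
    exact integral_congr_ae ((Lp.coeFn_smul c g).mono fun x hx => by
      simp only [hx, Pi.smul_apply, smul_comm c])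
  rw [e₁, e₂, h η hη hs ht, smul_neg]

variable (E)

/-- The Sobolev space `Hᵏ((a, b), E)`, with its standard norm
`(∑_{j ≤ k} ‖f⁽ʲ⁾‖²_{L²})^{1/2}`. -/
def SobolevH (k : ℕ) (a b : ℝ) : Submodule ℝ (Jet E k a b) where
  carrier := {F | ∀ j : Fin k, HasWeakDeriv (F j.castSucc) (F j.succ)}
  zero_mem' := fun _ => HasWeakDeriv.zero
  add_mem' := fun h₁ h₂ j => (h₁ j).add (h₂ j)
  smul_mem' := fun c _ h j => (h j).smul c

/-- `Hᵏ ∩ H¹₀ ((a, b), E)` (for `k ≥ 1`), with the `Hᵏ` norm. -/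
def HZero (k : ℕ) (a b : ℝ) : Submodule ℝ (Jet E k a b) where
  carrier := {F | F ∈ SobolevH E k a b ∧ VanishesAtEnds (F 0)}
  zero_mem' := ⟨Submodule.zero_mem _, VanishesAtEnds.zero⟩
  add_mem' := fun h₁ h₂ => ⟨Submodule.add_mem _ h₁.1 h₂.1, h₁.2.add h₂.2⟩
  smul_mem' := fun c _ h => ⟨Submodule.smul_mem _ c h.1, h.2.smul c⟩

/-- `H¹₀((a, b), E)`. -/
abbrev H10 (a b : ℝ) := HZero E 1 a b

/-- `H³₍₀₎((0, 1), E) = {f ∈ H³ ; f = f'' = 0 at 0, 1}`, with the `H³` norm. -/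
def H30 : Submodule ℝ (Jet E 3 0 1) where
  carrier := {F | F ∈ SobolevH E 3 0 1 ∧ VanishesAtEnds (F 0) ∧ VanishesAtEnds (F 2)}
  zero_mem' := ⟨Submodule.zero_mem _, VanishesAtEnds.zero, VanishesAtEnds.zero⟩
  add_mem' := fun h₁ h₂ =>
    ⟨Submodule.add_mem _ h₁.1 h₂.1, h₁.2.1.add h₂.2.1, h₁.2.2.add h₂.2.2⟩
  smul_mem' := fun c _ h => ⟨Submodule.smul_mem _ c h.1, h.2.1.smul c, h.2.2.smul c⟩

theorem H30_le_HZero : H30 E ≤ HZero E 3 0 1 := fun _ h => ⟨h.1, h.2.1⟩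

/-- The space `{u ∈ H¹₀((0, T), ℝ) ; ∫₀ᵀ u = 0}` of controls, with the `H¹` norm. -/
def Control (T : ℝ) : Submodule ℝ (Jet ℝ 1 0 T) where
  carrier := {F | F ∈ H10 ℝ 0 T ∧ ∫ t in Ioo 0 T, F 0 t = 0}
  zero_mem' := by
    refine ⟨Submodule.zero_mem _, ?_⟩
    exact integral_eq_zero_of_ae (Lp.coeFn_zero ℝ 2 (vol 0 T))
  add_mem' := by
    rintro F G ⟨hF, iF⟩ ⟨hG, iG⟩
    refine ⟨Submodule.add_mem _ hF hG, ?_⟩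
    have : IsFiniteMeasure (vol 0 T) := ⟨by simp⟩
    have e : ∫ t in Ioo 0 T, (F 0 + G 0 : L2 ℝ 0 T) t
        = (∫ t in Ioo 0 T, F 0 t) + ∫ t in Ioo 0 T, G 0 t := by
      rw [← integral_add ((Lp.memLp (F 0)).integrable (by norm_num))
        ((Lp.memLp (G 0)).integrable (by norm_num))]
      exact integral_congr_ae (Lp.coeFn_add (F 0) (G 0))
    change ∫ t in Ioo 0 T, (F 0 + G 0 : L2 ℝ 0 T) t = 0
    rw [e, iF, iG, add_zero]
  smul_mem' := by
    rintro c F ⟨hF, iF⟩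
    refine ⟨Submodule.smul_mem _ c hF, ?_⟩
    have e : ∫ t in Ioo 0 T, (c • F 0 : L2 ℝ 0 T) t = c • ∫ t in Ioo 0 T, F 0 t := by
      rw [← integral_smul]
      exact integral_congr_ae (Lp.coeFn_smul c (F 0))
    change ∫ t in Ioo 0 T, (c • F 0 : L2 ℝ 0 T) t = 0
    rw [e, iF, smul_zero]

variable {E}

/-- The continuous representative on `[a, b]` of a function vanishing at the end points. -/
def VanishesAtEnds.rep {a b : ℝ} {f : L2 E a b} (h : VanishesAtEnds f) : ℝ → E :=
  Classical.choose h

theorem VanishesAtEnds.isVanishingRep_rep {a b : ℝ} {f : L2 E a b} (h : VanishesAtEnds f) :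
    IsVanishingRep f h.rep := Classical.choose_spec h

/-- The pointwise values `u(t)`, `t ∈ [0, T]`, of a control. -/
def ctrl {T : ℝ} (u : Control T) : ℝ → ℝ := u.2.1.2.rep

/-- The inclusion `H³ ∩ H¹₀ ⊆ H¹₀`. -/
def toH10 {a b : ℝ} (F : HZero E 3 a b) : H10 E a b :=
  ⟨WithLp.toLp 2 ![F.1 0, F.1 1], by
    refine ⟨?_, F.2.2⟩
    intro j
    fin_cases j
    exact F.2.1 0⟩

/-- The state space `H³ ∩ H¹₀((0, 1), ℂ)`. -/
abbrev State := HZero ℂ 3 0 1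

/-- `ψ`, with time derivative `ψ'`, is in `C⁰([0, T], H³ ∩ H¹₀) ∩ C¹([0, T], H¹₀)`. -/
structure IsRegular (T : ℝ) (ψ : ℝ → State) (ψ' : ℝ → H10 ℂ 0 1) : Prop where
  continuousOn : ContinuousOn ψ (Icc 0 T)
  hasDeriv : ∀ t ∈ Icc 0 T, HasDerivWithinAt (fun s => toH10 (ψ s)) (ψ' t) (Icc 0 T) t
  deriv_continuousOn : ContinuousOn ψ' (Icc 0 T)

/-- `∂ₓ[x f] = f + x ∂ₓ f`. -/
def dxMulX (f : State) (x : ℝ) : ℂ := f.1 0 x + (x : ℂ) * f.1 1 x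

/-- `ψ` is a (classical) solution on `[0, T]` of
`i ∂ₜψ = - ∂ₓ²ψ - σ |ψ|² ψ + i u(t) ∂ₓ[x ψ]`, `ψ(t, 0) = ψ(t, 1) = 0`, `ψ(0) = φ`. -/
def IsSolution (σ T : ℝ) (φ : H30 ℝ) (u : Control T) (ψ : ℝ → State) : Prop :=
  (∃ ψ' : ℝ → H10 ℂ 0 1, IsRegular T ψ ψ' ∧
    ∀ t ∈ Icc 0 T, ∀ᵐ x ∂(vol 0 1),
      Complex.I * (ψ' t).1 0 x
        = - (ψ t).1 2 x - (σ : ℂ) * ((‖(ψ t).1 0 x‖ ^ 2 : ℝ) : ℂ) * (ψ t).1 0 x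
          + Complex.I * (ctrl u t : ℂ) * dxMulX (ψ t) x) ∧
  (ψ 0).1 0 =ᵐ[vol 0 1] fun x => (φ.1 0 x : ℂ)

/-- `Ψ` is a (classical) solution on `[0, T]` of the linearization around `(ψ, u)`,
`i ∂ₜΨ = - ∂ₓ²Ψ - σ [2 |ψ|² Ψ + ψ² Ψ̄] + i u(t) ∂ₓ[x Ψ] + i U(t) ∂ₓ[x ψ]`,
`Ψ(t, 0) = Ψ(t, 1) = 0`, `Ψ(0) = 0`. -/
def IsLinearizedSolution (σ T : ℝ) (u : Control T) (ψ : ℝ → State) (U : Control T)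
    (Ψ : ℝ → State) : Prop :=
  (∃ Ψ' : ℝ → H10 ℂ 0 1, IsRegular T Ψ Ψ' ∧
    ∀ t ∈ Icc 0 T, ∀ᵐ x ∂(vol 0 1),
      Complex.I * (Ψ' t).1 0 x
        = - (Ψ t).1 2 x
          - (σ : ℂ) * (2 * ((‖(ψ t).1 0 x‖ ^ 2 : ℝ) : ℂ) * (Ψ t).1 0 x
              + (ψ t).1 0 x ^ 2 * (starRingEnd ℂ) ((Ψ t).1 0 x))
          + Complex.I * (ctrl u t : ℂ) * dxMulX (Ψ t) x
          + Complex.I * (ctrl U t : ℂ) * dxMulX (ψ t) x) ∧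
  Ψ 0 = 0

/-- `φ ∈ H³₍₀₎((0, 1), ℝ)` is a positive solution of `φ'' + σ φ³ = σ μ φ`,
`φ(0) = φ(1) = 0`. -/
def IsGroundState (σ μ : ℝ) (φ : H30 ℝ) : Prop :=
  (∀ x ∈ Ioo (0 : ℝ) 1, 0 < φ.2.2.1.rep x) ∧
  ∀ᵐ x ∂(vol 0 1), φ.1 2 x + σ * φ.1 0 x ^ 3 = σ * μ * φ.1 0 x

/-- `Θ` is the end-point map `u ↦ ψ(T)`: for every control `u` the Cauchy problem has a unique
solution `ψ` on `[0, T]`, and `Θ u = ψ(T)`. -/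
def IsEndPointMap (σ T : ℝ) (φ : H30 ℝ) (Θ : Control T → H30 ℂ) : Prop :=
  ∀ u : Control T, ∃ ψ : ℝ → State, IsSolution σ T φ u ψ ∧
    (∀ ψ₂ : ℝ → State, IsSolution σ T φ u ψ₂ → EqOn ψ₂ ψ (Icc 0 T)) ∧
    (Θ u).1 = (ψ T).1

end BoxControl

end

open BoxControl

/-! Write `ψ = exp(i u x² / 4) χ`. The gauge factor cancels the first-order term `u x ∂ₓψ`, and the
profile `χ` satisfies `∂ₜχ = i χ'' + i σ |χ|² χ + (u/2) χ + i v x² χ` with `v = (u² - u')/4`. Since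
`u` vanishes at `0` and `T`, the gauge is trivial at both times, so `ψ(0) = χ(0)` and `ψ(T) = χ(T)`.
It therefore suffices to solve for `χ` in `H³₍₀₎`, with `C¹` dependence on the control. In between,
`ψ` itself is only in `H³ ∩ H¹₀`.

Two difficulties remain: `v` is merely square integrable in time, and `x² χ` leaves `H³₍₀₎`, its
second derivative at `x = 1` being `4 χ'(1)`. Both are settled by a smoothing effect of the Duhamel
integral. The space `H³₍₀₎` is parametrized by the sequence in `ℓ²` of cosine coefficients of the
third derivative (`S`, `S_coeffs`), and the Schrödinger group becomes multiplication by unimodular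
factors `osc k`. The `k`-th coordinate of a forcing in `H³ ∩ H¹₀` is a cosine coefficient plus
boundary values of the second derivative (`lam`). The boundary values are not square summable in `k`
at a fixed time. After integration against `osc k` they are Fourier coefficients in time, because
the frequencies `(k+1)² π²` have a common period, and Bessel's inequality makes them square summable
(`sum_norm_duhamel_sq_le`).

The profile equation thus becomes an integral equation for continuous paths in `ℓ²`, linear in a
triple of `L²` time weights and cubic in the path. Its linearizations are of Volterra type, hence
`1` minus them is invertible (`IsVolterra.isUnit_one_sub`), and the implicit function theorem gives
local solvability and `C¹` dependence on the weights. Global solvability comes from continuation: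
the parameters are `u'` together with a coupling constant `κ` in place of `σ`, everything is trivial
at `u' = 0`, `κ = 0`, and the set of solvable parameters is open and, given an a priori bound,
closed (`Semilinear.exists_contDiff_solves`).

The a priori bound is obtained in three steps. The mass obeys a linear differential equation. The
energy `‖χ'‖² - (κ/2) ∫ |χ|⁴` controls `‖χ'‖` for either sign of `κ`, because in dimension one the
quartic term is subordinate to the kinetic one at bounded mass. Finally the estimate
`norm_N3_self_le` of the cubic term is linear in the `H³` norm once `‖χ'‖` is bounded, so Grönwall's
inequality closes (`exists_bound_solves`).

It remains to undo the gauge, for the solution (`evolves_wave`) and for its derivative in the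
control (`evolves_waveD`), to prove uniqueness by an `L²` energy estimate (`eqOn_of_rates`), and to
read the conservation of the norm at time `T` off `d/dt ‖χ‖² = u ‖χ‖²` and `∫ u = 0` (`mass_eq`). -/

noncomputable section

namespace BoxControl

set_option linter.unusedSectionVars false
set_option linter.unusedSimpArgs false
set_option linter.unusedVariables false

/-! ### Primitives of integrable functions, and Grönwall's inequality. -/

section Primitives

variable {E : Type*} [NormedAddCommGroup E] [NormedSpace ℝ E] {a b : ℝ}

/-- On `[a, b]` the function `F` is a primitive of the integrable function `f`. -/
structure IsPrim (a b : ℝ) (F f : ℝ → E) : Prop where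
  integrable : IntervalIntegrable f volume a b
  eq : ∀ x ∈ Icc a b, F x = F a + ∫ t in a..x, f t

theorem absolutelyContinuousOnInterval_of_dist_le {X Y : Type*} [PseudoMetricSpace X]
    [PseudoMetricSpace Y] {F : ℝ → X} {G : ℝ → Y}
    (hG : AbsolutelyContinuousOnInterval G a b)
    (h : ∀ x ∈ uIcc a b, ∀ y ∈ uIcc a b, dist (F x) (F y) ≤ dist (G x) (G y)) :
    AbsolutelyContinuousOnInterval F a b := by
  rw [absolutelyContinuousOnInterval_iff] at hG ⊢
  intro ε hε
  obtain ⟨δ, hδ, H⟩ := hG ε hε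
  refine ⟨δ, hδ, fun I hI hs => (Finset.sum_le_sum fun i hi => ?_).trans_lt (H I hI hs)⟩
  have := hI.1 i hi
  exact h _ this.1 _ this.2

theorem IsPrim.intervalIntegrable_of_mem {F f : ℝ → E} (h : IsPrim a b F f) {x y : ℝ}
    (hx : x ∈ Icc a b) (hy : y ∈ Icc a b) : IntervalIntegrable f volume x y := by
  refine h.integrable.mono_set ?_
  rw [uIcc_of_le (hx.1.trans hx.2)]
  exact (uIcc_subset_Icc hx hy)

theorem IsPrim.sub_eq {F f : ℝ → E} (h : IsPrim a b F f) {x y : ℝ}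
    (hx : x ∈ Icc a b) (hy : y ∈ Icc a b) : F y - F x = ∫ t in x..y, f t := by
  have ha : a ∈ Icc a b := ⟨le_rfl, hx.1.trans hx.2⟩
  rw [h.eq x hx, h.eq y hy, add_sub_add_left_eq_sub,
    intervalIntegral.integral_interval_sub_left (h.intervalIntegrable_of_mem ha hy)
      (h.intervalIntegrable_of_mem ha hx)]

theorem IsPrim.absolutelyContinuous {F f : ℝ → E} (hab : a ≤ b) (h : IsPrim a b F f) :
    AbsolutelyContinuousOnInterval F a b := by
  have hn := h.integrable.norm
  have := hn.absolutelyContinuousOnInterval_intervalIntegral (c := a) (by simp)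
  refine absolutelyContinuousOnInterval_of_dist_le this fun x hx y hy => ?_
  rw [uIcc_of_le hab] at hx hy
  have ha : a ∈ Icc a b := ⟨le_rfl, hab⟩
  have hi := fun (z) (hz : z ∈ Icc a b) => (h.intervalIntegrable_of_mem ha hz).norm
  rw [dist_comm, dist_comm (∫ t in a..x, _), dist_eq_norm, dist_eq_norm, h.sub_eq hx hy,
    intervalIntegral.integral_interval_sub_left (hi y hy) (hi x hx)]
  exact intervalIntegral.norm_integral_le_abs_integral_norm

theorem IsPrim.continuousOn {F f : ℝ → E} (hab : a ≤ b) (h : IsPrim a b F f) :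
    ContinuousOn F (Icc a b) := by
  have := (h.absolutelyContinuous hab).continuousOn
  rwa [uIcc_of_le hab] at this

theorem ae_ne_ends (a b : ℝ) : ∀ᵐ x : ℝ, x ≠ a ∧ x ≠ b := by
  have h : ∀ c : ℝ, ∀ᵐ x : ℝ, x ≠ c := fun c => by
    simp [ae_iff]
  filter_upwards [h a, h b] with x h1 h2 using ⟨h1, h2⟩

theorem IsPrim.ae_hasDerivAt [CompleteSpace E] {F f : ℝ → E} (hab : a ≤ b) (h : IsPrim a b F f) :
    ∀ᵐ x, x ∈ uIcc a b → HasDerivAt F (f x) x := by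
  filter_upwards [h.integrable.ae_hasDerivAt_integral, ae_ne_ends a b] with x hx hne hm
  have := (hx hm a (by simp)).const_add (F a)
  refine this.congr_of_eventuallyEq ?_
  rw [uIcc_of_le hab] at hm
  filter_upwards [Icc_mem_nhds (lt_of_le_of_ne hm.1 hne.1.symm) (lt_of_le_of_ne hm.2 hne.2)]
    with y hy using h.eq y hy

/-- The difference of `F` and the integral of `f` is absolutely continuous with derivative zero
almost everywhere, hence constant. The product and chain rules for primitives rest on this
criterion. -/
theorem IsPrim.of_absolutelyContinuous [CompleteSpace E] {F f : ℝ → E} (hab : a ≤ b)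
    (hF : AbsolutelyContinuousOnInterval F a b) (hf : IntervalIntegrable f volume a b)
    (hd : ∀ᵐ x, x ∈ uIcc a b → HasDerivAt F (f x) x) : IsPrim a b F f := by
  have h0 : IsPrim a b (fun x => ∫ t in a..x, f t) f := ⟨hf, by simp⟩
  have hg := hF.sub (h0.absolutelyContinuous hab)
  obtain ⟨C, hC⟩ := hg.const_of_ae_hasDerivAt_zero (by
    filter_upwards [hd, h0.ae_hasDerivAt hab] with x h1 h2 hx
    simpa using (h1 hx).sub (h2 hx))
  refine ⟨hf, fun x hx => ?_⟩
  have h1 := hC x (by rwa [uIcc_of_le hab])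
  have h2 := hC a (by simp)
  simp only [Pi.sub_apply, intervalIntegral.integral_same, sub_zero] at h1 h2
  rw [h2, ← h1]; abel

theorem IsPrim.congr_ae {F f g : ℝ → E} (hab : a ≤ b) (h : IsPrim a b F f)
    (hfg : ∀ᵐ x, x ∈ Ioo a b → f x = g x) : IsPrim a b F g := by
  have e : ∀ᵐ x, x ∈ Icc a b → f x = g x := by
    filter_upwards [hfg, ae_ne_ends a b] with x h1 h2 h3
    exact h1 ⟨lt_of_le_of_ne h3.1 h2.1.symm, lt_of_le_of_ne h3.2 h2.2⟩
  refine ⟨?_, fun x hx => ?_⟩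
  · refine h.integrable.congr_ae ?_
    rw [Filter.EventuallyEq, ae_restrict_iff' measurableSet_uIoc]
    filter_upwards [e] with x hx h2
    rw [uIoc_of_le hab] at h2
    exact hx (Ioc_subset_Icc_self h2)
  · rw [h.eq x hx]
    congr 1
    refine intervalIntegral.integral_congr_ae ?_
    filter_upwards [e] with y hy h2
    rw [uIoc_of_le hx.1] at h2
    exact hy ⟨h2.1.le, h2.2.trans hx.2⟩

theorem IsPrim.congr {F G f : ℝ → E} (h : IsPrim a b F f)
    (hFG : ∀ x ∈ Icc a b, F x = G x) : IsPrim a b G f :=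
  ⟨h.integrable, fun x hx => by
    rw [← hFG x hx, ← hFG a ⟨le_rfl, hx.1.trans hx.2⟩]; exact h.eq x hx⟩

theorem IsPrim.add {F G f g : ℝ → E} (hF : IsPrim a b F f) (hG : IsPrim a b G g) :
    IsPrim a b (fun x => F x + G x) (fun x => f x + g x) := by
  refine ⟨hF.integrable.add hG.integrable, fun x hx => ?_⟩
  have ha : a ∈ Icc a b := ⟨le_rfl, hx.1.trans hx.2⟩
  rw [intervalIntegral.integral_add (hF.intervalIntegrable_of_mem ha hx)
    (hG.intervalIntegrable_of_mem ha hx), hF.eq x hx, hG.eq x hx]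
  abel

theorem IsPrim.clm_comp [CompleteSpace E] {E' : Type*} [NormedAddCommGroup E'] [NormedSpace ℝ E']
    [CompleteSpace E'] {F f : ℝ → E} (h : IsPrim a b F f) (A : E →L[ℝ] E') :
    IsPrim a b (fun x => A (F x)) (fun x => A (f x)) := by
  refine ⟨⟨A.integrable_comp h.integrable.1, A.integrable_comp h.integrable.2⟩, fun x hx => ?_⟩
  have ha : a ∈ Icc a b := ⟨le_rfl, hx.1.trans hx.2⟩
  rw [A.intervalIntegral_comp_comm (h.intervalIntegrable_of_mem ha hx), h.eq x hx, map_add]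

theorem IsPrim.of_hasDerivAt [CompleteSpace E] {F f : ℝ → E}
    (hF : ∀ x, HasDerivAt F (f x) x) (hf : Continuous f) : IsPrim a b F f :=
  ⟨hf.intervalIntegrable _ _, fun x _ => by
    rw [intervalIntegral.integral_eq_sub_of_hasDerivAt (fun y _ => hF y)
      (hf.intervalIntegrable _ _)]; abel⟩

theorem IsPrim.smul [CompleteSpace E] {𝕜 : Type*} [RCLike 𝕜] [NormedSpace 𝕜 E]
    {F f : ℝ → 𝕜} {G g : ℝ → E} (hab : a ≤ b)
    (hF : IsPrim a b F f) (hG : IsPrim a b G g) :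
    IsPrim a b (fun x => F x • G x) (fun x => F x • g x + f x • G x) := by
  have cF : ContinuousOn F (uIcc a b) := by rw [uIcc_of_le hab]; exact hF.continuousOn hab
  have cG : ContinuousOn G (uIcc a b) := by rw [uIcc_of_le hab]; exact hG.continuousOn hab
  refine .of_absolutelyContinuous hab
    ((hF.absolutelyContinuous hab).smul (hG.absolutelyContinuous hab)) ?_ ?_
  · exact (hG.integrable.continuousOn_smul cF).add (hF.integrable.smul_continuousOn cG)
  · filter_upwards [hF.ae_hasDerivAt hab, hG.ae_hasDerivAt hab] with x h1 h2 hx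
    exact (h1 hx).smul (h2 hx)

theorem IsPrim.comp [CompleteSpace E] {F f : ℝ → ℝ} {g g' : ℝ → E} (hab : a ≤ b)
    (hF : IsPrim a b F f) (hg : ∀ x, HasDerivAt g (g' x) x) (hg' : Continuous g') :
    IsPrim a b (fun x => g (F x)) (fun x => f x • g' (F x)) := by
  have cF : ContinuousOn F (uIcc a b) := by rw [uIcc_of_le hab]; exact hF.continuousOn hab
  obtain ⟨C, hC⟩ := isCompact_uIcc.exists_bound_of_continuousOn cF
  -- `M` is a Lipschitz constant of `g` on an interval containing the values of `F`; absolute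
  -- continuity of `F` then passes to `g ∘ F`.
  obtain ⟨M, hM⟩ := (isCompact_Icc (a := -C) (b := C)).exists_bound_of_continuousOn
    hg'.continuousOn
  refine .of_absolutelyContinuous hab ?_ ?_ ?_
  · have h1 := (hF.absolutelyContinuous hab).const_mul M
    refine absolutelyContinuousOnInterval_of_dist_le h1 fun x hx y hy => ?_
    have hm : ∀ z ∈ uIcc a b, F z ∈ Icc (-C) C := fun z hz => abs_le.mp (hC z hz)
    have := (convex_Icc (-C) C).norm_image_sub_le_of_norm_hasDerivWithin_le
      (fun z _ => (hg z).hasDerivWithinAt) hM (hm y hy) (hm x hx)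
    rw [dist_eq_norm]
    refine this.trans ?_
    rw [Real.dist_eq, ← mul_sub, abs_mul, Real.norm_eq_abs]
    gcongr
    exact le_abs_self M
  · exact hF.integrable.smul_continuousOn (hg'.comp_continuousOn cF)
  · filter_upwards [hF.ae_hasDerivAt hab] with x h1 hx
    exact (hg (F x)).scomp x (h1 hx)

theorem IsPrim.hasDerivWithinAt [CompleteSpace E] {F f : ℝ → E} (hab : a ≤ b)
    (hF : IsPrim a b F f) (hf : ContinuousOn f (Icc a b)) {x : ℝ} (hx : x ∈ Icc a b) :
    HasDerivWithinAt F (f x) (Icc a b) x := by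
  -- The continuous extension of `f` to the line gives a two-sided derivative at the end points as
  -- well.
  set g : ℝ → E := IccExtend hab ((Icc a b).domRestrict f) with hg
  have cg : Continuous g := (continuousOn_iff_continuous_domRestrict.mp hf).Icc_extend'
  have eg : ∀ y ∈ Icc a b, g y = f y := fun y hy => IccExtend_of_mem hab _ hy
  have h1 : HasDerivAt (fun y => F a + ∫ t in a..y, g t) (g x) x :=
    (intervalIntegral.integral_hasDerivAt_right (cg.intervalIntegrable _ _)
      (cg.stronglyMeasurableAtFilter _ _) cg.continuousAt).const_add _
  rw [eg x hx] at h1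
  have e : ∀ y ∈ Icc a b, F y = F a + ∫ t in a..y, g t := fun y hy => by
    rw [hF.eq y hy]
    congr 1
    refine intervalIntegral.integral_congr fun t ht => ?_
    rw [uIcc_of_le hy.1] at ht
    exact (eg t ⟨ht.1, ht.2.trans hy.2⟩).symm
  exact h1.hasDerivWithinAt.congr e (e x hx)

/-- An exponential weight turns integration against `k` into a contraction. -/
theorem integral_mul_exp_primitive_le {k : ℝ → ℝ} (hab : a ≤ b)
    (hk : IntervalIntegrable k volume a b) {c : ℝ} (hc : 0 < c) {x : ℝ} (hx : x ∈ Icc a b) :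
    ∫ t in a..x, k t * Real.exp (c * ∫ s in a..t, k s)
      ≤ c⁻¹ * Real.exp (c * ∫ s in a..x, k s) := by
  have hw : IsPrim a b (fun x => ∫ t in a..x, k t) k := ⟨hk, by simp⟩
  -- The integrand is the derivative of `c⁻¹ exp (c ∫ k)`; the value at `a` is dropped, being
  -- subtracted.
  have := (hw.comp hab (g := fun r => c⁻¹ * Real.exp (c * r)) (g' := fun r => Real.exp (c * r))
    (fun r => ?_) (by fun_prop)).eq x hx
  · simp only [smul_eq_mul, intervalIntegral.integral_same, mul_zero, Real.exp_zero] at this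
    rw [this]
    have : 0 < c⁻¹ := by positivity
    linarith
  · have := (((hasDerivAt_id r).const_mul c).exp).const_mul c⁻¹
    convert! this using 1
    simp; field_simp

/-- Grönwall's inequality with an integrable weight. -/
theorem gronwall_of_integral_le {f k : ℝ → ℝ} {C : ℝ} (hab : a ≤ b)
    (hk : IntervalIntegrable k volume a b) (hk0 : ∀ t, 0 ≤ k t)
    (hf : ContinuousOn f (Icc a b))
    (h : ∀ x ∈ Icc a b, f x ≤ C + ∫ t in a..x, k t * f t) :
    ∀ x ∈ Icc a b, f x ≤ 2 * |C| * Real.exp (2 * ∫ t in a..b, k t) := by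
  set w : ℝ → ℝ := fun x => ∫ t in a..x, k t with hw
  have hwp : IsPrim a b w k := ⟨hk, by simp [hw]⟩
  have cw : ContinuousOn w (Icc a b) := hwp.continuousOn hab
  have cg : ContinuousOn (fun x => Real.exp (-(2 * w x)) * f x) (Icc a b) := by fun_prop
  -- Maximizing `f` against the weight `exp (-2 ∫ k)` replaces iteration of the inequality.
  obtain ⟨x₀, hx₀, hmax⟩ := isCompact_Icc.exists_isMaxOn (nonempty_Icc.mpr hab) cg
  set M := Real.exp (-(2 * w x₀)) * f x₀ with hM
  have hfM : ∀ x ∈ Icc a b, f x ≤ M * Real.exp (2 * w x) := fun x hx => by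
    have h1 : Real.exp (-(2 * w x)) * f x ≤ M := hmax hx
    calc f x = (Real.exp (-(2 * w x)) * f x) * Real.exp (2 * w x) := by
          rw [mul_right_comm, ← Real.exp_add]; simp
      _ ≤ _ := by gcongr
  -- At the maximum point the hypothesis reads `M e ≤ C + M e / 2` with `e = exp (2 w x₀) ≥ 1`, and
  -- half of the left side is absorbed.
  have key : M ≤ 2 * |C| := by
    rcases lt_or_ge M 0 with hneg | hpos
    · have := abs_nonneg C; linarith
    have h1 := h x₀ hx₀
    have ha : a ∈ Icc a b := ⟨le_rfl, hab⟩
    have ik : IntervalIntegrable k volume a x₀ := hwp.intervalIntegrable_of_mem ha hx₀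
    have sub : uIcc a x₀ ⊆ Icc a b := uIcc_subset_Icc ha hx₀
    have h2 : ∫ t in a..x₀, k t * f t ≤ ∫ t in a..x₀, M * (k t * Real.exp (2 * w t)) := by
      refine intervalIntegral.integral_mono_on hx₀.1 (ik.mul_continuousOn (hf.mono sub))
        ((ik.mul_continuousOn (by have := cw.mono sub; fun_prop)).const_mul M) fun t ht => ?_
      have := hfM t ⟨ht.1, ht.2.trans hx₀.2⟩
      calc k t * f t ≤ k t * (M * Real.exp (2 * w t)) := by gcongr; exact hk0 t
        _ = _ := by ring
    rw [intervalIntegral.integral_const_mul] at h2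
    have h3 := mul_le_mul_of_nonneg_left
      (integral_mul_exp_primitive_le hab hk (two_pos) hx₀) hpos
    have h4 : f x₀ = M * Real.exp (2 * w x₀) := by
      rw [hM, mul_right_comm, ← Real.exp_add]; simp
    have h5 : 1 ≤ Real.exp (2 * w x₀) := by
      rw [← Real.exp_zero]
      refine Real.exp_le_exp.mpr (mul_nonneg two_pos.le ?_)
      exact intervalIntegral.integral_nonneg hx₀.1 fun t _ => hk0 t
    have := le_abs_self C
    change _ ≤ M * (2⁻¹ * Real.exp (2 * w x₀)) at h3
    nlinarith
  intro x hx
  refine (hfM x hx).trans ?_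
  have : w x ≤ ∫ t in a..b, k t := by
    refine intervalIntegral.integral_mono_interval le_rfl hx.1 hx.2 ?_ hk
    exact Filter.Eventually.of_forall hk0
  gcongr

end Primitives

/-! ### `L²` and continuous functions on an interval: inclusion, multiplication, primitive. -/

section Spaces

variable {a b : ℝ} {E : Type*} [NormedAddCommGroup E] [NormedSpace ℝ E]

theorem intervalIntegrable_L2 [Fact (a ≤ b)] (g : L2 E a b) : IntervalIntegrable g volume a b := by
  rw [intervalIntegrable_iff_integrableOn_Ioo_of_le Fact.out]
  exact (Lp.memLp g).integrable (by norm_num)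

theorem intervalIntegrable_norm_sq_L2 [Fact (a ≤ b)] (g : L2 E a b) :
    IntervalIntegrable (fun x => ‖g x‖ ^ 2) volume a b := by
  rw [intervalIntegrable_iff_integrableOn_Ioo_of_le Fact.out]
  exact (Lp.memLp g).integrable_norm_pow (by norm_num)

theorem norm_sq_L2 [Fact (a ≤ b)] (g : L2 E a b) : ‖g‖ ^ 2 = ∫ x in a..b, ‖g x‖ ^ 2 := by
  rw [intervalIntegral.integral_of_le Fact.out, integral_Ioc_eq_integral_Ioo, Lp.norm_def,
    (Lp.memLp g).eLpNorm_eq_integral_rpow_norm (by norm_num) (by norm_num)]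
  have h0 : 0 ≤ ∫ x in Ioo a b, ‖g x‖ ^ 2 := integral_nonneg fun _ => by positivity
  rw [ENNReal.toReal_ofReal (by positivity)]
  simp only [ENNReal.toReal_ofNat, Real.rpow_ofNat]
  rw [← Real.rpow_natCast, ← Real.rpow_mul h0]
  norm_num

/-- Cauchy-Schwarz on an interval. -/
theorem sq_integral_le_mul_integral_sq {f : ℝ → ℝ} {x y : ℝ} (hxy : x ≤ y)
    (hf : IntervalIntegrable f volume x y) (hf2 : IntervalIntegrable (fun t => f t ^ 2) volume x y) :
    (∫ t in x..y, f t) ^ 2 ≤ (y - x) * ∫ t in x..y, f t ^ 2 := by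
  rcases hxy.eq_or_lt with rfl | h
  · simp
  -- `c` is the mean of `f`, and the inequality says that the variance is nonnegative.
  set c := (∫ t in x..y, f t) / (y - x)
  have hpos : 0 < y - x := sub_pos.mpr h
  have h0 : 0 ≤ ∫ t in x..y, (f t - c) ^ 2 :=
    intervalIntegral.integral_nonneg hxy fun _ _ => sq_nonneg _
  have e : ∫ t in x..y, (f t - c) ^ 2
      = (∫ t in x..y, f t ^ 2) - 2 * c * (∫ t in x..y, f t) + c ^ 2 * (y - x) := by
    have : ∀ t, (f t - c) ^ 2 = f t ^ 2 - 2 * c * f t + c ^ 2 := fun t => by ring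
    simp_rw [this]
    rw [intervalIntegral.integral_add (hf2.sub (hf.const_mul _)) (by simp),
      intervalIntegral.integral_sub hf2 (hf.const_mul _), intervalIntegral.integral_const_mul]
    simp; ring
  have hc : ∫ t in x..y, f t = c * (y - x) := by simp only [c]; field_simp
  rw [e, hc] at h0
  rw [hc]
  nlinarith

/-- Continuous extension of a function on `[a, b]` to the line. -/
def ext [Fact (a ≤ b)] {X : Type*} [TopologicalSpace X] (f : C(Icc a b, X)) : ℝ → X :=
  IccExtend Fact.out f

@[fun_prop]
theorem continuous_ext [Fact (a ≤ b)] {X : Type*} [TopologicalSpace X] (f : C(Icc a b, X)) :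
    Continuous (ext f) := f.continuous.Icc_extend'

theorem ext_apply [Fact (a ≤ b)] {X : Type*} [TopologicalSpace X] (f : C(Icc a b, X)) {x : ℝ}
    (hx : x ∈ Icc a b) : ext f x = f ⟨x, hx⟩ := IccExtend_of_mem _ _ hx

theorem norm_ext_le [Fact (a ≤ b)] (f : C(Icc a b, E)) (x : ℝ) : ‖ext f x‖ ≤ ‖f‖ :=
  f.norm_coe_le_norm _

theorem eq_of_ext_eq [Fact (a ≤ b)] {X : Type*} [TopologicalSpace X] {f g : C(Icc a b, X)}
    (h : ∀ x ∈ Icc a b, ext f x = ext g x) : f = g := by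
  ext ⟨x, hx⟩
  rw [← ext_apply f hx, ← ext_apply g hx, h x hx]

variable {𝕜 : Type*} [RCLike 𝕜] [hab : Fact (a ≤ b)]

theorem memLp_ext {f : C(Icc a b, E)} : MemLp (ext f) 2 (vol a b) :=
  .of_bound (continuous_ext f).aestronglyMeasurable ‖f‖ (.of_forall (norm_ext_le f))

/-- The inclusion of continuous functions in `L²`. -/
def incl : C(Icc a b, 𝕜) →L[𝕜] L2 𝕜 a b :=
  LinearMap.mkContinuous
    { toFun := fun f => (memLp_ext (f := f)).toLp
      map_add' := fun f g => by
        rw [← MemLp.toLp_add]; rfl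
      map_smul' := fun c f => by
        rw [RingHom.id_apply, ← MemLp.toLp_const_smul]; rfl }
    (measureUnivNNReal (vol a b) ^ (2 : ENNReal).toReal⁻¹) fun f => by
      refine Lp.norm_le_of_ae_bound (norm_nonneg _) ?_
      filter_upwards [(memLp_ext (f := f)).coeFn_toLp] with x hx
      simp only [LinearMap.coe_mk, AddHom.coe_mk, hx]
      exact norm_ext_le f x

theorem incl_ae (f : C(Icc a b, 𝕜)) : incl f =ᵐ[vol a b] ext f := memLp_ext.coeFn_toLp

theorem memLp_ext_mul (f : C(Icc a b, 𝕜)) (g : L2 𝕜 a b) :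
    MemLp (fun x => ext f x * g x) 2 (vol a b) := by
  refine (Lp.memLp g).of_le_mul (c := ‖f‖)
    ((continuous_ext f).aestronglyMeasurable.mul (Lp.aestronglyMeasurable g)) (.of_forall fun x => ?_)
  rw [norm_mul]
  gcongr
  exact norm_ext_le f x

/-- Multiplication of `L²` functions by continuous functions. -/
def mulL : C(Icc a b, 𝕜) →L[𝕜] L2 𝕜 a b →L[𝕜] L2 𝕜 a b :=
  LinearMap.mkContinuous₂
    (LinearMap.mk₂ 𝕜 (fun f g => (memLp_ext_mul f g).toLp)
      (fun f f' g => by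
        rw [← MemLp.toLp_add]
        exact MemLp.toLp_congr _ _ (.of_forall fun x => add_mul _ _ _))
      (fun c f g => by
        rw [← MemLp.toLp_const_smul]
        exact MemLp.toLp_congr _ _ (.of_forall fun x => mul_assoc _ _ _))
      (fun f g g' => by
        rw [← MemLp.toLp_add]
        refine MemLp.toLp_congr _ _ ?_
        filter_upwards [Lp.coeFn_add g g'] with x hx
        exact (congrArg _ hx).trans (mul_add _ _ _))
      (fun c f g => by
        rw [← MemLp.toLp_const_smul]
        refine MemLp.toLp_congr _ _ ?_
        filter_upwards [Lp.coeFn_smul c g] with x hx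
        exact (congrArg _ hx).trans (mul_left_comm _ _ _)))
    1 fun f g => by
      rw [one_mul]
      refine Lp.norm_le_mul_norm_of_ae_le_mul ?_
      filter_upwards [(memLp_ext_mul f g).coeFn_toLp] with x hx
      simp only [LinearMap.mk₂_apply, hx, norm_mul]
      gcongr
      exact norm_ext_le f x

theorem mulL_ae (f : C(Icc a b, 𝕜)) (g : L2 𝕜 a b) :
    mulL f g =ᵐ[vol a b] fun x => ext f x * g x := (memLp_ext_mul f g).coeFn_toLp

theorem norm_mulL_le (f : C(Icc a b, 𝕜)) (g : L2 𝕜 a b) : ‖mulL f g‖ ≤ ‖f‖ * ‖g‖ := by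
  refine Lp.norm_le_mul_norm_of_ae_le_mul ?_
  filter_upwards [mulL_ae f g] with x hx
  simp only [hx, norm_mul]
  gcongr
  exact norm_ext_le f x

theorem isPrim_integral (g : L2 E a b) : IsPrim a b (fun x => ∫ t in a..x, g t) g :=
  ⟨intervalIntegrable_L2 g, by simp⟩

theorem norm_integral_L2_le (g : L2 E a b) {x : ℝ} (hx : x ∈ Icc a b) :
    ‖∫ t in a..x, g t‖ ≤ √(b - a) * ‖g‖ := by
  have h1 := intervalIntegrable_L2 g
  have h2 := intervalIntegrable_norm_sq_L2 g
  have ha : a ∈ Icc a b := ⟨le_rfl, hab.out⟩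
  have h3 := sq_integral_le_mul_integral_sq hab.out h1.norm h2
  rw [← norm_sq_L2] at h3
  have h4 : ‖∫ t in a..x, g t‖ ≤ ∫ t in a..b, ‖g t‖ :=
    (intervalIntegral.norm_integral_le_integral_norm hx.1).trans
      (intervalIntegral.integral_mono_interval le_rfl hx.1 hx.2
        (.of_forall fun _ => norm_nonneg _) h1.norm)
  refine h4.trans (Real.le_sqrt_of_sq_le h3 |>.trans_eq ?_)
  rw [Real.sqrt_mul (sub_nonneg.mpr hab.out), Real.sqrt_sq (norm_nonneg _)]

theorem continuous_integral_L2 (g : L2 E a b) : Continuous fun x : Icc a b => ∫ t in a..x, g t :=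
  continuousOn_iff_continuous_domRestrict.mp ((isPrim_integral g).continuousOn hab.out)

/-- The primitive vanishing at `a` of an `L²` function. -/
def prim : L2 𝕜 a b →L[𝕜] C(Icc a b, 𝕜) :=
  LinearMap.mkContinuous
    { toFun := fun g => ⟨fun x => ∫ t in a..x, g t, continuous_integral_L2 g⟩
      map_add' := fun g g' => by
        ext ⟨x, hx⟩
        have ha : a ∈ Icc a b := ⟨le_rfl, hab.out⟩
        change (∫ t in a..x, (g + g') t) = (∫ t in a..x, g t) + ∫ t in a..x, g' t
        rw [← intervalIntegral.integral_add ((isPrim_integral g).intervalIntegrable_of_mem ha hx)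
          ((isPrim_integral g').intervalIntegrable_of_mem ha hx)]
        refine ((isPrim_integral (g + g')).congr_ae (g := fun x => g x + g' x) hab.out ?_).eq x hx
          |>.trans (by simp)
        exact (ae_restrict_iff' measurableSet_Ioo).mp (Lp.coeFn_add g g')
      map_smul' := fun c g => by
        ext ⟨x, hx⟩
        change (∫ t in a..x, (c • g) t) = c • ∫ t in a..x, g t
        rw [← intervalIntegral.integral_smul]
        refine ((isPrim_integral (c • g)).congr_ae (g := fun x => c • g x) hab.out ?_).eq x hx
          |>.trans (by simp)
        exact (ae_restrict_iff' measurableSet_Ioo).mp (Lp.coeFn_smul c g) }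
    (√(b - a)) fun g => by
      refine (ContinuousMap.norm_le _ (by positivity)).mpr fun x => ?_
      exact norm_integral_L2_le g x.2

theorem norm_prim_le (g : L2 𝕜 a b) : ‖prim g‖ ≤ √(b - a) * ‖g‖ :=
  LinearMap.mkContinuous_norm_le _ (by positivity) _ |> (prim (𝕜 := 𝕜)).le_of_opNorm_le <| g

theorem ext_prim (g : L2 𝕜 a b) {x : ℝ} (hx : x ∈ Icc a b) :
    ext (prim g) x = ∫ t in a..x, g t := by rw [ext_apply _ hx]; rfl

theorem isPrim_prim (g : L2 𝕜 a b) : IsPrim a b (ext (prim g)) g :=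
  (isPrim_integral g).congr fun _ hx => (ext_prim g hx).symm

theorem IsPrim.congr_L2 {F f : ℝ → E} {g : L2 E a b} (h : IsPrim a b F g) (e : g =ᵐ[vol a b] f) :
    IsPrim a b F f :=
  h.congr_ae hab.out ((ae_restrict_iff' measurableSet_Ioo).mp e)

theorem IsPrim.congr_L2_symm {F f : ℝ → E} {g : L2 E a b} (h : IsPrim a b F f)
    (e : g =ᵐ[vol a b] f) : IsPrim a b F g :=
  h.congr_ae hab.out ((ae_restrict_iff' measurableSet_Ioo).mp e.symm)

theorem L2_eq_of_isPrim [CompleteSpace E] {F : ℝ → E} {g g' : L2 E a b} (h : IsPrim a b F g)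
    (h' : IsPrim a b F g') : g = g' := by
  refine Lp.ext ((ae_restrict_iff' measurableSet_Ioo).mpr ?_)
  filter_upwards [h.ae_hasDerivAt hab.out, h'.ae_hasDerivAt hab.out] with x h1 h2 hx
  have hx' : x ∈ uIcc a b := by rw [uIcc_of_le hab.out]; exact Ioo_subset_Icc_self hx
  exact (h1 hx').unique (h2 hx')

theorem prim_injective : Function.Injective (prim : L2 𝕜 a b → C(Icc a b, 𝕜)) := fun g g' h =>
  L2_eq_of_isPrim (isPrim_prim g) (h ▸ isPrim_prim g')

theorem eq_const_add_prim {f : C(Icc a b, 𝕜)} {g : L2 𝕜 a b} (h : IsPrim a b (ext f) g) :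
    f = ContinuousMap.const _ (ext f a) + prim g := by
  refine eq_of_ext_eq fun x hx => ?_
  rw [h.eq x hx, ← ext_prim g hx]; rfl

end Spaces

/-! ### Weak derivatives and continuous representatives. -/

section WeakDerivatives

variable {a b : ℝ} {E : Type*} [NormedAddCommGroup E] [NormedSpace ℝ E] [hab : Fact (a ≤ b)]

theorem exists_Icc_of_isCompact_subset_Ioo (h : a < b) {K : Set ℝ} (hK : IsCompact K)
    (hs : K ⊆ Ioo a b) : ∃ c d, a < c ∧ d < b ∧ K ⊆ Icc c d := by
  rcases K.eq_empty_or_nonempty with rfl | hne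
  · obtain ⟨c, hc⟩ := exists_between h
    exact ⟨c, c, hc.1, hc.2, empty_subset _⟩
  · obtain ⟨c, hc⟩ := hK.exists_isLeast hne
    obtain ⟨d, hd⟩ := hK.exists_isGreatest hne
    exact ⟨c, d, (hs hc.1).1, (hs hd.1).2, fun x hx => ⟨hc.2 hx, hd.2 hx⟩⟩

theorem hasWeakDeriv_of_isPrim [CompleteSpace E] {f g : L2 E a b} {F : ℝ → E}
    (hF : IsPrim a b F g) (hf : f =ᵐ[vol a b] F) : HasWeakDeriv f g := by
  intro η hη hs ht
  have hz : ∀ x, x ∉ Ioo a b → η x = 0 := fun x hx => image_eq_zero_of_notMem_tsupport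
    fun h => hx (ht h)
  have hd : Continuous (deriv η) := hη.continuous_deriv (by simp)
  have hp := IsPrim.smul hab.out (IsPrim.of_hasDerivAt (a := a) (b := b)
    (fun x => (hη.differentiable (by simp) x).hasDerivAt) hd) hF
  have h1 := hp.eq b ⟨hab.out, le_rfl⟩
  have e : ∫ x in Ioo a b, deriv η x • f x = ∫ x in Ioo a b, deriv η x • F x :=
    integral_congr_ae (hf.mono fun x hx => by simp only [hx])
  have i1 : IntegrableOn (fun x => η x • g x) (Ioo a b) := integrable_smul_L2 g hη.continuous hs
  have i2 : IntegrableOn (fun x => deriv η x • F x) (Ioo a b) :=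
    (integrable_smul_L2 f hd hs.deriv).congr (hf.mono fun x hx => by simp only [hx])
  rw [hz b (by simp), hz a (by simp), intervalIntegral.integral_of_le hab.out,
    integral_Ioc_eq_integral_Ioo, integral_add i1 i2, zero_smul, zero_smul, zero_add] at h1
  rw [e, eq_neg_iff_add_eq_zero, add_comm]
  exact h1.symm

/-- A smooth function with compact support and zero mean is the derivative of such a function. -/
theorem exists_primitive_of_integral_eq_zero (h : a < b) {w : ℝ → ℝ} (hw : ContDiff ℝ (⊤ : ℕ∞) w)
    (hs : HasCompactSupport w) (ht : tsupport w ⊆ Ioo a b) (h0 : ∫ x in a..b, w x = 0) :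
    ∃ η : ℝ → ℝ, ContDiff ℝ (⊤ : ℕ∞) η ∧ HasCompactSupport η ∧ tsupport η ⊆ Ioo a b ∧
      deriv η = w := by
  obtain ⟨c, d, hc, hd, hK⟩ := exists_Icc_of_isCompact_subset_Ioo h hs ht
  have hz : ∀ x, x ∉ Icc c d → w x = 0 := fun x hx => image_eq_zero_of_notMem_tsupport
    fun h => hx (hK h)
  have hder : ∀ x, HasDerivAt (fun x => ∫ t in a..x, w t) (w x) x := fun x =>
    intervalIntegral.integral_hasDerivAt_right (hw.continuous.intervalIntegrable _ _)
      (hw.continuous.stronglyMeasurableAtFilter _ _) hw.continuous.continuousAt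
  have hde : deriv (fun x => ∫ t in a..x, w t) = w := funext fun x => (hder x).deriv
  -- The primitive vanishes to the left of `c` because `w` does, and to the right of `d` because the
  -- total integral of `w` is zero.
  have hsupp : tsupport (fun x => ∫ t in a..x, w t) ⊆ Icc c d := by
    refine closure_minimal (fun x hx => ?_) isClosed_Icc
    by_contra hxn
    refine hx ?_
    rw [mem_Icc, not_and_or, not_le, not_le] at hxn
    rcases hxn with hxn | hxn
    · refine (intervalIntegral.integral_congr (g := fun _ => 0) fun t ht => hz t fun htm => ?_).trans
        (by simp)
      rw [mem_uIcc] at ht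
      rcases ht with ht | ht <;> linarith [htm.1]
    · change ∫ t in a..x, w t = 0
      rw [← intervalIntegral.integral_add_adjacent_intervals (b := b)
        (hw.continuous.intervalIntegrable _ _) (hw.continuous.intervalIntegrable _ _), h0, zero_add]
      refine (intervalIntegral.integral_congr (g := fun _ => 0) fun t ht => hz t fun htm => ?_).trans
        (by simp)
      rw [mem_uIcc] at ht
      rcases ht with ht | ht <;> linarith [htm.2]
  refine ⟨fun x => ∫ t in a..x, w t, ?_, ?_, ?_, hde⟩
  · rw [contDiff_infty_iff_deriv, hde]
    exact ⟨fun x => (hder x).differentiableAt, hw⟩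
  · exact isCompact_Icc.of_isClosed_subset isClosed_closure hsupp
  · exact hsupp.trans fun x hx => ⟨hc.trans_le hx.1, hx.2.trans_lt hd⟩

/-- The lemma of du Bois-Reymond. -/
theorem ae_eq_const_of_integral_deriv_smul_eq_zero [CompleteSpace E] (h : a < b) {f : ℝ → E}
    (hf : IntegrableOn f (Ioo a b))
    (H : ∀ η : ℝ → ℝ, ContDiff ℝ (⊤ : ℕ∞) η → HasCompactSupport η → tsupport η ⊆ Ioo a b →
      ∫ x in Ioo a b, deriv η x • f x = 0) :
    ∃ c : E, f =ᵐ[vol a b] fun _ => c := by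
  obtain ⟨m, hm⟩ := exists_between h
  set r := min (m - a) (b - m) / 2
  have hm0 : 0 < min (m - a) (b - m) := lt_min (sub_pos.mpr hm.1) (sub_pos.mpr hm.2)
  have hr : 0 < r := half_pos hm0
  have hr1 : r < m - a := (half_lt_self hm0).trans_le (min_le_left _ _)
  have hr2 : r < b - m := (half_lt_self hm0).trans_le (min_le_right _ _)
  -- A bump of integral one inside `(a, b)`; the constant is the average of `f` against it.
  let B : ContDiffBump m := ⟨r / 2, r, half_pos hr, half_lt_self hr⟩
  set w₀ : ℝ → ℝ := B.normed volume
  have w₀s : ContDiff ℝ (⊤ : ℕ∞) w₀ := B.contDiff_normed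
  have w₀c : HasCompactSupport w₀ := B.hasCompactSupport_normed
  have w₀t : tsupport w₀ ⊆ Ioo a b := by
    rw [B.tsupport_normed_eq, Real.closedBall_eq_Icc]
    exact fun x hx => ⟨by linarith [hx.1, show B.rOut = r from rfl],
      by linarith [hx.2, show B.rOut = r from rfl]⟩
  have int_eq : ∀ w : ℝ → ℝ, tsupport w ⊆ Ioo a b → ∫ x in a..b, w x = ∫ x, w x := fun w hw => by
    rw [intervalIntegral.integral_of_le h.le, integral_Ioc_eq_integral_Ioo]
    exact setIntegral_eq_integral_of_forall_compl_eq_zero fun x hx =>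
      image_eq_zero_of_notMem_tsupport fun h => hx (hw h)
  have w₀i : ∫ x in a..b, w₀ x = 1 := by rw [int_eq w₀ w₀t]; exact B.integral_normed
  refine ⟨∫ x in Ioo a b, w₀ x • f x, ?_⟩
  set c := ∫ x in Ioo a b, w₀ x • f x
  have ism : ∀ w : ℝ → ℝ, Continuous w → HasCompactSupport w →
      IntegrableOn (fun x => w x • f x) (Ioo a b) := fun w hw hs => by
    obtain ⟨C, hC⟩ := hs.exists_bound_of_continuous hw
    exact hf.bdd_smul C hw.aestronglyMeasurable (Filter.Eventually.of_forall hC)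
  have isc : IntegrableOn (fun _ => c) (Ioo a b) := integrableOn_const (by simp)
  have key := isOpen_Ioo.ae_eq_zero_of_integral_contDiff_smul_eq_zero (μ := volume) (U := Ioo a b)
    (f := fun x => f x - c) ((hf.sub isc).locallyIntegrableOn) (fun w hw hs ht => by
      -- Subtracting `I w₀` from a test function `w` leaves zero mean, hence the derivative of an
      -- admissible test function, against which `f` integrates to zero.
      set I := ∫ x in a..b, w x
      have hu : tsupport (fun x => w x - I * w₀ x) ⊆ Ioo a b :=
        (tsupport_sub w (fun x => I * w₀ x)).trans
          (union_subset ht ((tsupport_mul_subset_right).trans w₀t))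
      obtain ⟨η, e1, e2, e3, e4⟩ := exists_primitive_of_integral_eq_zero h
        (w := fun x => w x - I * w₀ x) (by fun_prop) (hs.sub w₀c.mul_left) hu (by
          rw [intervalIntegral.integral_sub (hw.continuous.intervalIntegrable _ _)
            ((w₀s.continuous.intervalIntegrable _ _).const_mul _),
            intervalIntegral.integral_const_mul, w₀i, mul_one, sub_self])
      have h1 := H η e1 e2 e3
      rw [e4] at h1
      have h2 : ∫ x in Ioo a b, (w x - I * w₀ x) • f x = (∫ x in Ioo a b, w x • f x) - I • c := by
        simp_rw [sub_smul, mul_smul]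
        have i2 : IntegrableOn (fun x => I • w₀ x • f x) (Ioo a b) :=
          (ism w₀ w₀s.continuous w₀c).smul I
        rw [integral_sub (ism w hw.continuous hs) i2, integral_smul]
      have h3 : ∫ x, w x • (f x - c) = ∫ x in Ioo a b, w x • (f x - c) := by
        refine (setIntegral_eq_integral_of_forall_compl_eq_zero fun x hx => ?_).symm
        rw [image_eq_zero_of_notMem_tsupport fun h => hx (ht h), zero_smul]
      have h4 : ∫ x in Ioo a b, w x • c = I • c := by
        rw [integral_smul_const, ← integral_Ioc_eq_integral_Ioo,
          ← intervalIntegral.integral_of_le h.le]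
      rw [h3]
      simp_rw [smul_sub]
      rw [integral_sub (ism w hw.continuous hs), h4, ← h2, h1]
      exact (hw.continuous.integrable_of_hasCompactSupport hs).integrableOn.smul_const c)
  rw [Filter.EventuallyEq, ae_restrict_iff' measurableSet_Ioo]
  filter_upwards [key] with x hx hxm using sub_eq_zero.mp (hx hxm)

variable {𝕜 : Type*} [RCLike 𝕜]

/-- The difference of `f` and the primitive of `g` has zero weak derivative, so it is constant by
the lemma of du Bois-Reymond. Weak derivatives are thereby traded for primitives in all that
follows. -/
theorem HasWeakDeriv.exists_isPrim (h : a < b) {f g : L2 𝕜 a b} (hfg : HasWeakDeriv f g) :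
    ∃ F : C(Icc a b, 𝕜), f =ᵐ[vol a b] ext F ∧ IsPrim a b (ext F) g := by
  have hp : HasWeakDeriv (incl (prim g)) g := hasWeakDeriv_of_isPrim (isPrim_prim g) (incl_ae _)
  obtain ⟨c, hc⟩ := ae_eq_const_of_integral_deriv_smul_eq_zero h
    (f := fun x => f x - ext (prim g) x)
    (((Lp.memLp f).sub memLp_ext).integrable (by norm_num)) fun η h1 h2 h3 => by
      have hd : Continuous (deriv η) := h1.continuous_deriv (by simp)
      have e1 := hfg η h1 h2 h3
      have e2 := hp η h1 h2 h3
      have e3 : ∫ x in Ioo a b, deriv η x • incl (prim g) x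
          = ∫ x in Ioo a b, deriv η x • ext (prim g) x :=
        integral_congr_ae ((incl_ae (prim g)).mono fun x hx => by simp only [hx])
      simp_rw [smul_sub]
      rw [integral_sub (integrable_smul_L2 f hd h2.deriv), e1, ← e3, e2, sub_self]
      exact (integrable_smul_L2 (incl (prim g)) hd h2.deriv).congr
        ((incl_ae (prim g)).mono fun x hx => by simp only [hx])
  refine ⟨ContinuousMap.const _ c + prim g, ?_, ?_⟩
  · filter_upwards [hc] with x hx
    rw [sub_eq_iff_eq_add] at hx
    rw [hx]; rfl
  · refine ⟨intervalIntegrable_L2 g, fun x hx => ?_⟩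
    have e : ∀ y, ext (ContinuousMap.const (Icc a b) c + prim g) y = c + ext (prim g) y :=
      fun y => rfl
    rw [e, e, (isPrim_prim g).eq x hx, add_assoc]

theorem eqOn_Icc_of_ae_eq (h : a < b) {f g : ℝ → E} (hf : ContinuousOn f (Icc a b))
    (hg : ContinuousOn g (Icc a b)) (e : f =ᵐ[vol a b] g) : EqOn f g (Icc a b) := by
  refine Measure.eqOn_Icc_of_ae_eq volume h.ne ?_ hf hg
  rwa [← restrict_Ioo_eq_restrict_Icc]

theorem IsVanishingRep.isPrim (h : a < b) {f g : L2 𝕜 a b} {r : ℝ → 𝕜} (hr : IsVanishingRep f r)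
    (hfg : HasWeakDeriv f g) : IsPrim a b r g := by
  obtain ⟨F, h1, h2⟩ := hfg.exists_isPrim h
  exact h2.congr (eqOn_Icc_of_ae_eq h (continuous_ext F).continuousOn hr.1 (h1.symm.trans hr.2.1))

theorem incl_injective (h : a < b) : Function.Injective (incl : C(Icc a b, 𝕜) → L2 𝕜 a b) :=
  fun f g e => eq_of_ext_eq <| eqOn_Icc_of_ae_eq h (continuous_ext f).continuousOn
    (continuous_ext g).continuousOn ((incl_ae f).symm.trans (e ▸ incl_ae g))

end WeakDerivatives

/-! ### Completeness of the cosine family in `L²(0, 1)`. -/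

section CosineBasis

/-- Complex valued continuous functions on `[0, 1]`. -/
abbrev K := C(Icc (0 : ℝ) 1, ℂ)
/-- `L²((0, 1), ℂ)`. -/
abbrev L := L2 ℂ 0 1
/-- Square summable sequences. -/
abbrev H := lp (fun _ : ℕ => ℂ) 2

instance fact_zero_le_one_real : Fact ((0 : ℝ) ≤ 1) := ⟨zero_le_one⟩

theorem inner_incl (f : K) (g : L) :
    inner ℂ (incl f) g = ∫ x in (0 : ℝ)..1, starRingEnd ℂ (ext f x) * g x := by
  rw [intervalIntegral.integral_of_le zero_le_one, integral_Ioc_eq_integral_Ioo, L2.inner_def]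
  refine integral_congr_ae ((incl_ae f).mono fun x hx => ?_)
  simp only [hx, RCLike.inner_apply, mul_comm]

/-- The function `cos (c x)` on `[0, 1]`. -/
def cosK (c : ℝ) : K := ⟨fun x => (Real.cos (c * x) : ℂ), by fun_prop⟩

theorem ext_cosK (c : ℝ) {x : ℝ} (hx : x ∈ Icc (0 : ℝ) 1) : ext (cosK c) x = Real.cos (c * x) := by
  rw [ext_apply _ hx]; rfl

/-- The frequency `(k + 1) π`. -/
def freq (k : ℕ) : ℝ := (k + 1) * Real.pi

theorem freq_pos (k : ℕ) : 0 < freq k := by unfold freq; positivity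

theorem sin_freq (k : ℕ) : Real.sin (freq k) = 0 := by
  have := Real.sin_nat_mul_pi (k + 1)
  push_cast at this; exact this

theorem integral_cos_mul {c : ℝ} (hc : c ≠ 0) : ∫ x in (0 : ℝ)..1, Real.cos (c * x) = Real.sin c / c := by
  rw [intervalIntegral.integral_comp_mul_left (fun x => Real.cos x) hc]
  simp; field_simp

theorem integral_cos_int_mul_pi {n : ℤ} (hn : n ≠ 0) :
    ∫ x in (0 : ℝ)..1, Real.cos (n * Real.pi * x) = 0 := by
  rw [integral_cos_mul (by positivity), Real.sin_int_mul_pi, zero_div]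

/-- The orthonormal family `√2 cos ((k + 1) π x)`. -/
def cosL (k : ℕ) : L := incl ((√2 : ℂ) • cosK (freq k))

theorem inner_cosL (k : ℕ) (g : L) :
    inner ℂ (cosL k) g = √2 * ∫ x in (0 : ℝ)..1, (Real.cos (freq k * x) : ℂ) * g x := by
  rw [cosL, inner_incl, ← intervalIntegral.integral_const_mul]
  refine intervalIntegral.integral_congr fun x hx => ?_
  rw [uIcc_of_le zero_le_one] at hx
  have : ext ((√2 : ℂ) • cosK (freq k)) x = √2 * ext (cosK (freq k)) x := rfl
  simp only [this, ext_cosK _ hx, map_mul, Complex.conj_ofReal, mul_assoc]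

theorem integral_incl_mul (f : ℝ → ℂ) (g : K) :
    ∫ x in (0 : ℝ)..1, f x * incl g x = ∫ x in (0 : ℝ)..1, f x * ext g x := by
  rw [intervalIntegral.integral_of_le zero_le_one, intervalIntegral.integral_of_le zero_le_one,
    integral_Ioc_eq_integral_Ioo, integral_Ioc_eq_integral_Ioo]
  exact integral_congr_ae ((incl_ae g).mono fun x hx => by simp only [hx])

theorem orthonormal_cosL : Orthonormal ℂ cosL := by
  rw [orthonormal_iff_ite]
  intro j k
  have e1 : ∀ x : ℝ, x ∈ uIcc (0:ℝ) 1 →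
      (Real.cos (freq j * x) : ℂ) * ext ((√2 : ℂ) • cosK (freq k)) x
      = ((√2 / 2 * (Real.cos ((((j : ℤ) - k : ℤ) : ℝ) * Real.pi * x)
        + Real.cos ((((j : ℤ) + k + 2 : ℤ) : ℝ) * Real.pi * x)) : ℝ) : ℂ) := fun x hx => by
    rw [uIcc_of_le zero_le_one] at hx
    have : ext ((√2 : ℂ) • cosK (freq k)) x = √2 * ext (cosK (freq k)) x := rfl
    rw [this, ext_cosK _ hx]
    have h1 : (((j : ℤ) - k : ℤ) : ℝ) * Real.pi * x = freq j * x - freq k * x := by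
      unfold freq; push_cast; ring
    have h2 : (((j : ℤ) + k + 2 : ℤ) : ℝ) * Real.pi * x = freq j * x + freq k * x := by
      unfold freq; push_cast; ring
    rw [h1, h2, Real.cos_sub, Real.cos_add]
    push_cast; ring
  rw [inner_cosL, cosL, integral_incl_mul, intervalIntegral.integral_congr e1,
    intervalIntegral.integral_ofReal, intervalIntegral.integral_const_mul,
    intervalIntegral.integral_add (by apply Continuous.intervalIntegrable; fun_prop)
      (by apply Continuous.intervalIntegrable; fun_prop),
    integral_cos_int_mul_pi (n := (j : ℤ) + k + 2) (by positivity), add_zero]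
  have h2 : (√2 * √2 : ℝ) = 2 := Real.mul_self_sqrt (by norm_num)
  split_ifs with hjk
  · subst hjk
    simp only [sub_self, Int.cast_zero, zero_mul, Real.cos_zero]
    rw [← Complex.ofReal_mul, ← mul_assoc, ← mul_div_assoc, h2]
    simp
  · rw [integral_cos_int_mul_pi (sub_ne_zero.mpr (by exact_mod_cast hjk))]
    simp

theorem inner_cosL_one (k : ℕ) : inner ℂ (cosL k) (incl (1 : K)) = 0 := by
  rw [inner_cosL, integral_incl_mul]
  have : ∫ x in (0 : ℝ)..1, (Real.cos (freq k * x) : ℂ) * ext (1 : K) x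
      = ((∫ x in (0 : ℝ)..1, Real.cos (freq k * x) : ℝ) : ℂ) := by
    rw [← intervalIntegral.integral_ofReal]
    exact intervalIntegral.integral_congr fun x _ => mul_one _
  rw [this, integral_cos_mul (freq_pos k).ne', sin_freq]
  simp

/-- `cos (π x)` as a real function. -/
def cosPi : C(Icc (0 : ℝ) 1, ℝ) := ⟨fun x => Real.cos (Real.pi * x), by fun_prop⟩

/-- The Stone-Weierstrass theorem: `cos` is injective on `[0, π]`, so `cos (π x)` alone separates
the points of `[0, 1]`. -/
theorem adjoin_cosPi_closure : (Algebra.adjoin ℝ {cosPi}).topologicalClosure = ⊤ := by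
  refine ContinuousMap.subalgebra_topologicalClosure_eq_top_of_separatesPoints _ fun x y hxy => ?_
  refine ⟨cosPi, ⟨cosPi, Algebra.self_mem_adjoin_singleton _ _, rfl⟩, fun h => hxy ?_⟩
  have hm : ∀ z : Icc (0 : ℝ) 1, Real.pi * z ∈ Icc 0 Real.pi := fun z =>
    ⟨mul_nonneg Real.pi_pos.le z.2.1, mul_le_of_le_one_right Real.pi_pos.le z.2.2⟩
  have := Real.injOn_cos (hm x) (hm y) h
  exact Subtype.ext (mul_left_cancel₀ Real.pi_ne_zero this)

/-- A real function on `[0, 1]` as a complex one. -/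
def ofRealK : C(Icc (0 : ℝ) 1, ℝ) →L[ℝ] K := Complex.ofRealCLM.compLeftContinuous ℝ _

theorem eq_zero_of_integral_continuous_mul {f : L}
    (h : ∀ g : C(Icc (0 : ℝ) 1, ℝ), inner ℂ (incl (ofRealK g)) f = 0) : f = 0 := by
  refine Lp.ext ?_
  have hf : IntegrableOn f (Ioo (0 : ℝ) 1) := (Lp.memLp f).integrable (by norm_num)
  have key := isOpen_Ioo.ae_eq_zero_of_integral_contDiff_smul_eq_zero (μ := volume)
    hf.locallyIntegrableOn (fun w hw hs ht => by
      have h1 := h ⟨fun x => w x, hw.continuous.comp continuous_subtype_val⟩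
      rw [inner_incl, intervalIntegral.integral_of_le zero_le_one, integral_Ioc_eq_integral_Ioo] at h1
      rw [← setIntegral_eq_integral_of_forall_compl_eq_zero (s := Ioo (0 : ℝ) 1), ← h1]
      · refine setIntegral_congr_fun measurableSet_Ioo fun x hx => ?_
        simp only [ext_apply _ (Ioo_subset_Icc_self hx)]
        change _ = starRingEnd ℂ ((w x : ℝ) : ℂ) * f x
        rw [Complex.conj_ofReal, Complex.real_smul]
      · intro x hx
        rw [image_eq_zero_of_notMem_tsupport fun h => hx (ht h), zero_smul])
  have e : f =ᵐ[vol 0 1] (0 : ℝ → ℂ) := (ae_restrict_iff' measurableSet_Ioo).mpr key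
  exact e.trans (Lp.coeFn_zero _ _ _).symm

/-- Polynomials in `cos (π x)` lie in the span of the functions `cos (n π x)` and are dense among
the real continuous functions. A function orthogonal to all cosines is therefore orthogonal to every
real continuous function. -/
theorem eq_zero_of_inner_cosL {f : L} (h0 : inner ℂ (incl (1 : K)) f = 0)
    (h : ∀ k, inner ℂ (cosL k) f = 0) : f = 0 := by
  have hcos : ∀ n : ℤ, inner ℂ (incl (cosK (n * Real.pi))) f = 0 := by
    have pos : ∀ n : ℕ, inner ℂ (incl (cosK (n * Real.pi))) f = 0 := by
      rintro (_ | k)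
      · convert h0 using 3
        ext x; simp [cosK]
      · have h1 := h k
        rw [cosL, map_smul, inner_smul_left] at h1
        have : (starRingEnd ℂ) (√2 : ℂ) ≠ 0 := by simp
        have h2 := (mul_eq_zero.mp h1).resolve_left this
        have e : ((k + 1 : ℕ) : ℝ) * Real.pi = freq k := by unfold freq; push_cast; rfl
        rw [e]; exact h2
    intro n
    obtain ⟨m, rfl | rfl⟩ := n.eq_nat_or_neg
    · exact_mod_cast pos m
    · convert pos m using 3
      ext x; simp [cosK]
  let A : C(Icc (0 : ℝ) 1, ℝ) →ₗ[ℝ] ℂ :=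
    { toFun := fun g => inner ℂ (incl (ofRealK g)) f
      map_add' := fun g g' => by rw [map_add, map_add, inner_add_left]
      map_smul' := fun c g => by
        have : (incl (ofRealK (c • g)) : L) = (c : ℂ) • incl (ofRealK g) := by
          rw [← map_smul]; congr 1
          ext x
          exact Complex.ofReal_mul c (g x)
        rw [this, inner_smul_left, Complex.conj_ofReal, RingHom.id_apply, Complex.real_smul] }
  have hA : Continuous A := by
    change Continuous fun g => inner ℂ (incl (ofRealK g)) f
    fun_prop
  let M : Submodule ℝ C(Icc (0 : ℝ) 1, ℝ) := Submodule.span ℝ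
    (range fun n : ℤ => (⟨fun x => Real.cos (n * Real.pi * x), by fun_prop⟩ : C(Icc (0 : ℝ) 1, ℝ)))
  have hM : ∀ g ∈ M, A g = 0 := by
    have : M ≤ LinearMap.ker A := Submodule.span_le.mpr (by
      rintro _ ⟨n, rfl⟩
      exact LinearMap.mem_ker.mpr (hcos n))
    exact fun g hg => this hg
  -- The product formula shifts the frequency by `±1`. Allowing frequencies of both signs makes the
  -- shift to `n - 1` harmless at `n = 0`.
  have hmul : ∀ g ∈ M, cosPi * g ∈ M := by
    intro g hg
    have : M ≤ M.comap (LinearMap.mulLeft ℝ cosPi) := Submodule.span_le.mpr (by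
      rintro _ ⟨n, rfl⟩
      have e : cosPi * (⟨fun x => Real.cos (n * Real.pi * x), by fun_prop⟩ : C(Icc (0 : ℝ) 1, ℝ))
          = (1 / 2 : ℝ) • ((⟨fun x => Real.cos ((n + 1 : ℤ) * Real.pi * x), by fun_prop⟩ :
              C(Icc (0 : ℝ) 1, ℝ))
            + ⟨fun x => Real.cos ((n - 1 : ℤ) * Real.pi * x), by fun_prop⟩) := by
        ext x
        simp only [cosPi, ContinuousMap.mul_apply, ContinuousMap.coe_mk, ContinuousMap.smul_apply,
          ContinuousMap.add_apply, smul_eq_mul]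
        have h1 : ((n + 1 : ℤ) : ℝ) * Real.pi * x = n * Real.pi * x + Real.pi * x := by
          push_cast; ring
        have h2 : ((n - 1 : ℤ) : ℝ) * Real.pi * x = n * Real.pi * x - Real.pi * x := by
          push_cast; ring
        rw [h1, h2, Real.cos_add, Real.cos_sub]; ring
      change cosPi * _ ∈ M
      rw [e]
      exact M.smul_mem _ (M.add_mem (Submodule.subset_span ⟨_, rfl⟩) (Submodule.subset_span ⟨_, rfl⟩)))
    exact this hg
  have hone : (1 : C(Icc (0 : ℝ) 1, ℝ)) ∈ M := Submodule.subset_span ⟨0, by ext x; simp⟩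
  have hpoly : ∀ g ∈ Algebra.adjoin ℝ {cosPi}, g ∈ M := by
    intro g hg
    rw [Algebra.adjoin_singleton_eq_range_aeval] at hg
    obtain ⟨p, rfl⟩ := hg
    change Polynomial.aeval cosPi p ∈ M
    induction p using Polynomial.induction_on' with
    | add p q hp hq => rw [map_add]; exact M.add_mem hp hq
    | monomial n c =>
      rw [Polynomial.aeval_monomial, ← Algebra.smul_def]
      refine M.smul_mem _ ?_
      induction n with
      | zero => simpa using hone
      | succ n ih => rw [pow_succ']; exact hmul _ ih
  refine eq_zero_of_integral_continuous_mul fun g => ?_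
  have hg : g ∈ closure ((Algebra.adjoin ℝ {cosPi} : Subalgebra ℝ _) : Set C(Icc (0 : ℝ) 1, ℝ)) := by
    rw [← Subalgebra.topologicalClosure_coe, adjoin_cosPi_closure]; trivial
  exact closure_minimal (fun g hg => hM g (hpoly g hg)) (isClosed_eq hA continuous_const) hg

/-- The isometry `(a_k) ↦ ∑ a_k √2 cos ((k + 1) π x)`. -/
def D3 : H →ₗᵢ[ℂ] L := orthonormal_cosL.orthogonalFamily.linearIsometry

/-- The sequence of coefficients of a function in the family `√2 cos ((k + 1) π x)`. -/
def coeffs : L →L[ℂ] H := ContinuousLinearMap.adjoint D3.toContinuousLinearMap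

theorem D3_single (k : ℕ) : D3 (lp.single 2 k 1) = cosL k := by
  rw [D3, OrthogonalFamily.linearIsometry_apply_single]
  simp

theorem coeffs_apply (f : L) (k : ℕ) : coeffs f k = inner ℂ (cosL k) f := by
  have := ContinuousLinearMap.adjoint_inner_right D3.toContinuousLinearMap (lp.single 2 k 1) f
  rw [lp.inner_single_left] at this
  rw [← D3_single]
  simpa [coeffs] using this

theorem coeffs_D3 (a : H) : coeffs (D3 a) = a := by
  refine ext_inner_left ℂ fun b => ?_
  rw [coeffs, ContinuousLinearMap.adjoint_inner_right]
  exact D3.inner_map_map b a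

theorem norm_coeffs_le (f : L) : ‖coeffs f‖ ≤ ‖f‖ := by
  refine (coeffs.le_opNorm f).trans (mul_le_of_le_one_left (norm_nonneg _) ?_)
  rw [coeffs, LinearIsometryEquiv.norm_map]
  exact D3.norm_toContinuousLinearMap_le

theorem inner_one_D3 (a : H) : inner ℂ (incl (1 : K)) (D3 a) = 0 := by
  have h : coeffs (incl (1 : K)) = 0 := by
    ext k; rw [coeffs_apply, inner_cosL_one]; rfl
  have := ContinuousLinearMap.adjoint_inner_left D3.toContinuousLinearMap a (incl (1 : K))
  rw [← coeffs, h, inner_zero_left] at this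
  exact this.symm

theorem inner_one_eq_integral (f : L) : inner ℂ (incl (1 : K)) f = ∫ x in (0 : ℝ)..1, f x := by
  rw [inner_incl]
  exact intervalIntegral.integral_congr fun x _ => by
    change starRingEnd ℂ 1 * f x = f x
    simp

/-- Constants are the only direction missing from the family, so zero mean is exactly what is needed
to recover a function from its coefficients. -/
theorem D3_coeffs {f : L} (h : ∫ x in (0 : ℝ)..1, f x = 0) : D3 (coeffs f) = f := by
  rw [← sub_eq_zero]
  refine eq_zero_of_inner_cosL ?_ fun k => ?_
  · rw [inner_sub_right, inner_one_D3, inner_one_eq_integral, h, sub_zero]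
  · rw [← coeffs_apply, map_sub, coeffs_D3, sub_self]; rfl

theorem integral_D3 (a : H) : ∫ x in (0 : ℝ)..1, D3 a x = 0 := by
  rw [← inner_one_eq_integral, inner_one_D3]

end CosineBasis

/-! ### Jets of `H³` functions and the coordinates of `H³₍₀₎`. -/

section Jets

/-- Triples of continuous functions and an `L²` function, to be thought of as the successive
derivatives of an `H³` function. -/
abbrev Z := K × K × K × L

/-- The components of `z` are the successive derivatives of its first component. -/
structure IsJet (z : Z) : Prop where
  one : IsPrim 0 1 (ext z.1) (ext z.2.1)
  two : IsPrim 0 1 (ext z.2.1) (ext z.2.2.1)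
  three : IsPrim 0 1 (ext z.2.2.1) z.2.2.2

/-- Evaluation at `x`. -/
def evK (x : ℝ) : K →L[ℂ] ℂ := ContinuousMap.evalCLM ℂ (projIcc 0 1 zero_le_one x)

theorem ext_add (f g : K) (x : ℝ) : ext (f + g) x = ext f x + ext g x := rfl
theorem ext_sub (f g : K) (x : ℝ) : ext (f - g) x = ext f x - ext g x := rfl
theorem ext_zero (x : ℝ) : ext (0 : K) x = 0 := rfl
theorem ext_one (x : ℝ) : ext (1 : K) x = 1 := rfl
theorem ext_mul (f g : K) (x : ℝ) : ext (f * g) x = ext f x * ext g x := rfl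
theorem ext_smul (c : ℂ) (f : K) (x : ℝ) : ext (c • f) x = c * ext f x := rfl
theorem ext_rsmul (c : ℝ) (f : K) (x : ℝ) : ext (c • f) x = c * ext f x := Complex.real_smul

theorem isPrim_prim_incl (f : K) : IsPrim 0 1 (ext (prim (incl f))) (ext f) :=
  (isPrim_prim (incl f)).congr_L2 (incl_ae f)

theorem ext_prim_zero (g : L) : ext (prim g) 0 = 0 := by
  rw [ext_prim g ⟨le_rfl, zero_le_one⟩, intervalIntegral.integral_same]

/-- The second derivative of the element of `H³₍₀₎` with third derivative `D3 a`. -/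
def D2 : H →L[ℂ] K := prim ∘L D3.toContinuousLinearMap
/-- The mean value. -/
def meanK : K →L[ℂ] ℂ := evK 1 ∘L prim ∘L incl
/-- Constant functions. -/
def constK : ℂ →L[ℂ] K := ContinuousLinearMap.toSpanSingleton ℂ (1 : K)
/-- The first derivative of the element of `H³₍₀₎` with third derivative `D3 a`. -/
def D1 : H →L[ℂ] K :=
  prim ∘L incl ∘L D2 - constK ∘L meanK ∘L prim ∘L incl ∘L D2
/-- The element of `H³₍₀₎` with third derivative `D3 a`. -/
def D0 : H →L[ℂ] K := prim ∘L incl ∘L D1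
/-- The parametrization of `H³₍₀₎` by the cosine coefficients of the third derivative. -/
def S : H →L[ℂ] Z := D0.prod (D1.prod (D2.prod D3.toContinuousLinearMap))

theorem S_apply (a : H) : S a = (D0 a, D1 a, D2 a, D3 a) := rfl

theorem ext_constK (c : ℂ) (x : ℝ) : ext (constK c) x = c := by
  change c * 1 = c; rw [mul_one]

theorem isJet_S (a : H) : IsJet (S a) where
  one := isPrim_prim_incl (D1 a)
  two := by
    have h := isPrim_prim_incl (D2 a)
    refine ⟨h.integrable, fun x hx => ?_⟩
    have e : ∀ y, ext (D1 a) y = ext (prim (incl (D2 a))) y - meanK (prim (incl (D2 a))) :=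
      fun y => (congrArg (_ - ·) (ext_constK _ y))
    simp only [S_apply]
    rw [e, e, h.eq x hx]; ring
  three := isPrim_prim (D3 a)

theorem D0_zero (a : H) : ext (D0 a) 0 = 0 := ext_prim_zero _

/-- `D1` is the primitive of `D2` minus its own mean, so its integral over `[0, 1]` vanishes. -/
theorem D0_one (a : H) : ext (D0 a) 1 = 0 := by
  change meanK (D1 a) = 0
  have : meanK (D1 a) = meanK (prim (incl (D2 a))) - meanK (constK (meanK (prim (incl (D2 a))))) :=
    map_sub meanK _ _
  have h2 : ∀ c, meanK (constK c) = c := fun c => by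
    change ext (prim (incl (constK c))) 1 = c
    rw [(isPrim_prim_incl _).eq 1 ⟨zero_le_one, le_rfl⟩, ext_prim_zero]
    simp [ext_constK]
  rw [this, h2, sub_self]

theorem D2_zero (a : H) : ext (D2 a) 0 = 0 := ext_prim_zero _

theorem D2_one (a : H) : ext (D2 a) 1 = 0 :=
  (ext_prim (D3 a) ⟨zero_le_one, le_rfl⟩).trans (integral_D3 a)

theorem eq_of_isPrim_of_ext_zero_eq {f g : K} {h : ℝ → ℂ} (hf : IsPrim 0 1 (ext f) h)
    (hg : IsPrim 0 1 (ext g) h) (e : ext f 0 = ext g 0) : f = g :=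
  eq_of_ext_eq fun x hx => by rw [hf.eq x hx, hg.eq x hx, e]

/-- An `H³` function with vanishing boundary values of order `0` and `2` is in the range of the
parametrization. -/
theorem S_coeffs {z : Z} (hz : IsJet z) (h00 : ext z.1 0 = 0) (h01 : ext z.1 1 = 0)
    (h20 : ext z.2.2.1 0 = 0) (h21 : ext z.2.2.1 1 = 0) : S (coeffs z.2.2.2) = z := by
  have h1 : (1 : ℝ) ∈ Icc (0 : ℝ) 1 := ⟨zero_le_one, le_rfl⟩
  -- The second derivative vanishes at both ends, so the third has zero mean and is recovered by its
  -- coefficients.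
  have e3 : D3 (coeffs z.2.2.2) = z.2.2.2 := D3_coeffs (by
    have := hz.three.eq 1 h1
    rw [h20, h21, zero_add] at this
    exact this.symm)
  have e2 : D2 (coeffs z.2.2.2) = z.2.2.1 := by
    refine eq_of_isPrim_of_ext_zero_eq (h := z.2.2.2) ?_ hz.three (by rw [D2_zero, h20])
    have := (isJet_S (coeffs z.2.2.2)).three
    simp only [S_apply] at this
    rwa [e3] at this
  have p1 := (isJet_S (coeffs z.2.2.2)).two
  simp only [S_apply, e2] at p1
  have e1 : D1 (coeffs z.2.2.2) = z.2.1 := by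
    refine eq_of_isPrim_of_ext_zero_eq p1 hz.two ?_
    -- The two first derivatives differ by a constant. Both integrate to zero, since the functions
    -- themselves vanish at both ends, so the constant is zero.
    set c := ext (D1 (coeffs z.2.2.2)) 0 - ext z.2.1 0 with hc
    have hd : ∀ x ∈ Icc (0 : ℝ) 1, ext (D1 (coeffs z.2.2.2)) x - ext z.2.1 x = c := fun x hx => by
      rw [p1.eq x hx, hz.two.eq x hx]; ring
    have i1 := (isJet_S (coeffs z.2.2.2)).one.eq 1 h1
    have i2 := hz.one.eq 1 h1
    simp only [S_apply] at i1
    rw [D0_zero, D0_one, zero_add] at i1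
    rw [h00, h01, zero_add] at i2
    have i3 : ∫ x in (0 : ℝ)..1, (ext (D1 (coeffs z.2.2.2)) x - ext z.2.1 x) = c := by
      rw [intervalIntegral.integral_congr (g := fun _ => c)]
      · simp
      · intro x hx
        rw [uIcc_of_le zero_le_one] at hx
        exact hd x hx
    rw [intervalIntegral.integral_sub ((continuous_ext _).intervalIntegrable _ _)
      ((continuous_ext _).intervalIntegrable _ _), ← i1, ← i2, sub_zero] at i3
    exact sub_eq_zero.mp i3.symm
  have p0 := (isJet_S (coeffs z.2.2.2)).one
  simp only [S_apply, e1] at p0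
  have e0 : D0 (coeffs z.2.2.2) = z.1 :=
    eq_of_isPrim_of_ext_zero_eq p0 hz.one (by rw [D0_zero, h00])
  rw [S_apply, e0, e1, e2, e3]

theorem norm_incl_le (f : K) : ‖incl f‖ ≤ ‖f‖ := by
  have h1 := norm_sq_L2 (incl f)
  have h2 : ∫ x in (0 : ℝ)..1, ‖incl f x‖ ^ 2 ≤ ∫ x in (0 : ℝ)..1, ‖f‖ ^ 2 := by
    refine intervalIntegral.integral_mono_ae_restrict zero_le_one
      (intervalIntegrable_norm_sq_L2 _) (by simp) ?_
    rw [← restrict_Ioo_eq_restrict_Icc]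
    filter_upwards [incl_ae f] with x hx
    rw [hx]
    gcongr
    exact norm_ext_le f x
  rw [← h1] at h2
  simp only [intervalIntegral.integral_const, sub_zero, one_smul] at h2
  exact le_of_sq_le_sq h2 (norm_nonneg _)

/-- The Leibniz rule. -/
def mulZFun (z w : Z) : Z :=
  (z.1 * w.1, z.2.1 * w.1 + z.1 * w.2.1,
    z.2.2.1 * w.1 + (2 : ℂ) • (z.2.1 * w.2.1) + z.1 * w.2.2.1,
    mulL w.1 z.2.2.2 + (3 : ℂ) • incl (z.2.2.1 * w.2.1 + z.2.1 * w.2.2.1) + mulL z.1 w.2.2.2)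

/-! ### The Leibniz rule as a bounded bilinear map. -/

section Leibniz

variable {A M W B B' : Type*} [NormedCommRing A] [NormedAlgebra ℂ A] [NormedAddCommGroup M]
  [NormedSpace ℂ M] [NormedAddCommGroup W] [NormedSpace ℂ W] [NormedAddCommGroup B]
  [NormedSpace ℂ B] [NormedAddCommGroup B'] [NormedSpace ℂ B']

/-- Pairing of bilinear maps. -/
def pairB (f : W →L[ℂ] W →L[ℂ] B) (g : W →L[ℂ] W →L[ℂ] B') : W →L[ℂ] W →L[ℂ] B × B' :=
  (ContinuousLinearMap.prodₗᵢ (𝕜 := ℂ) ℂ).toContinuousLinearEquiv.toContinuousLinearMap ∘L (f.prod g)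

/-- The product of two linear maps, as a bilinear map. -/
def compMul (f g : W →L[ℂ] A) : W →L[ℂ] W →L[ℂ] A := (ContinuousLinearMap.mul ℂ A).bilinearComp f g

/-- The Leibniz rule for formal jets. -/
def leibniz (ι : A →L[ℂ] M) (m : A →L[ℂ] M →L[ℂ] M) :
    A × A × A × M →L[ℂ] A × A × A × M →L[ℂ] A × A × A × M :=
  let p0 : A × A × A × M →L[ℂ] A := .fst ℂ A _
  let p1 : A × A × A × M →L[ℂ] A := .fst ℂ A _ ∘L .snd ℂ A _
  let p2 : A × A × A × M →L[ℂ] A := .fst ℂ A _ ∘L .snd ℂ A _ ∘L .snd ℂ A _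
  let p3 : A × A × A × M →L[ℂ] M := .snd ℂ A _ ∘L .snd ℂ A _ ∘L .snd ℂ A _
  pairB (compMul p0 p0) <| pairB (compMul p1 p0 + compMul p0 p1) <|
    pairB (compMul p2 p0 + (2 : ℂ) • compMul p1 p1 + compMul p0 p2)
      (m.flip.bilinearComp p3 p0
        + (3 : ℂ) • (ContinuousLinearMap.compL ℂ _ A M ι ∘L (compMul p2 p1 + compMul p1 p2))
        + m.bilinearComp p0 p3)

theorem leibniz_apply (ι : A →L[ℂ] M) (m : A →L[ℂ] M →L[ℂ] M) (z w : A × A × A × M) :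
    leibniz ι m z w = (z.1 * w.1, z.2.1 * w.1 + z.1 * w.2.1,
      z.2.2.1 * w.1 + (2 : ℂ) • (z.2.1 * w.2.1) + z.1 * w.2.2.1,
      m w.1 z.2.2.2 + (3 : ℂ) • ι (z.2.2.1 * w.2.1 + z.2.1 * w.2.2.1) + m z.1 w.2.2.2) := rfl

end Leibniz

/-- Multiplication of jets. -/
def mulZ : Z →L[ℂ] Z →L[ℂ] Z := leibniz incl mulL

theorem mulZ_apply (z w : Z) : mulZ z w = mulZFun z w := leibniz_apply incl mulL z w

theorem IsPrim.mulK {f g : K} {f' g' : ℝ → ℂ} (hf : IsPrim 0 1 (ext f) f')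
    (hg : IsPrim 0 1 (ext g) g') :
    IsPrim 0 1 (ext (f * g)) (fun x => ext f x * g' x + f' x * ext g x) :=
  hf.smul zero_le_one hg

theorem IsJet.mul {z w : Z} (hz : IsJet z) (hw : IsJet w) : IsJet (mulZ z w) where
  one := (hz.one.mulK hw.one).congr_ae zero_le_one <| .of_forall fun x _ => by
    simp only [mulZ_apply, mulZFun, ext_add, ext_mul]; ring
  two := ((hz.two.mulK hw.one).add (hz.one.mulK hw.two)).congr_ae zero_le_one <|
    .of_forall fun x _ => by
      simp only [mulZ_apply, mulZFun, ext_add, ext_mul, ext_smul]; ring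
  three := by
    have h := ((hz.three.mulK hw.one).add (((hz.two.mulK hw.two).clm_comp
      (2 • ContinuousLinearMap.id ℝ ℂ)))).add (hz.one.mulK hw.three)
    have h' : IsPrim 0 1 (ext (mulZ z w).2.2.1) _ := h.congr fun x _ => by
      simp [mulZ_apply, mulZFun, ext_add, ext_mul, ext_smul]
    refine h'.congr_L2_symm ?_
    simp only [mulZ_apply, mulZFun]
    filter_upwards [Lp.coeFn_add (mulL w.1 z.2.2.2 +
        (3 : ℂ) • incl (z.2.2.1 * w.2.1 + z.2.1 * w.2.2.1)) (mulL z.1 w.2.2.2),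
      Lp.coeFn_add (mulL w.1 z.2.2.2) ((3 : ℂ) • incl (z.2.2.1 * w.2.1 + z.2.1 * w.2.2.1)),
      Lp.coeFn_smul (3 : ℂ) (incl (z.2.2.1 * w.2.1 + z.2.1 * w.2.2.1)),
      incl_ae (z.2.2.1 * w.2.1 + z.2.1 * w.2.2.1), mulL_ae w.1 z.2.2.2, mulL_ae z.1 w.2.2.2]
      with x h1 h2 h3 h4 h5 h6
    rw [h1, Pi.add_apply, h2, Pi.add_apply, h3, Pi.smul_apply, h4, h5, h6]
    simp [ext_add, ext_mul]
    ring

/-- Complex conjugation on continuous functions. -/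
def conjK : K →L[ℝ] K := Complex.conjCLE.toContinuousLinearMap.compLeftContinuous ℝ _
/-- Complex conjugation on `L²`. -/
def conjL : L →L[ℝ] L := Complex.conjCLE.toContinuousLinearMap.compLpL 2 (vol 0 1)

theorem ext_conjK (f : K) (x : ℝ) : ext (conjK f) x = starRingEnd ℂ (ext f x) := rfl

theorem conjL_ae (f : L) : conjL f =ᵐ[vol 0 1] fun x => starRingEnd ℂ (f x) :=
  ContinuousLinearMap.coeFn_compLpL _ f

theorem norm_conjK (f : K) : ‖conjK f‖ = ‖f‖ := by
  have h : ∀ g : K, ‖conjK g‖ ≤ ‖g‖ := fun g =>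
    (ContinuousMap.norm_le _ (norm_nonneg _)).mpr fun x => by
      change ‖starRingEnd ℂ (g x)‖ ≤ _
      rw [RCLike.norm_conj]; exact g.norm_coe_le_norm x
  refine le_antisymm (h f) ?_
  have e : conjK (conjK f) = f := by ext x; exact Complex.conj_conj (f x)
  calc ‖f‖ = ‖conjK (conjK f)‖ := by rw [e]
    _ ≤ _ := h _

theorem norm_conjL (f : L) : ‖conjL f‖ = ‖f‖ := by
  rw [Lp.norm_def, Lp.norm_def]
  congr 1
  refine eLpNorm_congr_norm_ae ?_
  filter_upwards [conjL_ae f] with x hx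
  rw [hx, RCLike.norm_conj]

/-- Complex conjugation of jets. -/
def conjZ : Z →L[ℝ] Z := conjK.prodMap (conjK.prodMap (conjK.prodMap conjL))

theorem conjZ_apply (z : Z) : conjZ z = (conjK z.1, conjK z.2.1, conjK z.2.2.1, conjL z.2.2.2) := rfl

theorem IsJet.conj {z : Z} (hz : IsJet z) : IsJet (conjZ z) where
  one := hz.one.clm_comp Complex.conjCLE.toContinuousLinearMap
  two := hz.two.clm_comp Complex.conjCLE.toContinuousLinearMap
  three := (hz.three.clm_comp Complex.conjCLE.toContinuousLinearMap).congr_L2_symm (conjL_ae _)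

/-- The jet of `z z̄ w`. -/
def cub (x y z : Z) : Z := mulZ (mulZ x (conjZ y)) z

/-- The cubic nonlinearity in coordinates. -/
def N3 (a b c : H) : H := coeffs (cub (S a) (S b) (S c)).2.2.2

/-- The cubic term preserves `H³₍₀₎`: in each term of its second derivative at most two of the three
factors are differentiated, so an undifferentiated factor, zero at the ends, remains. Only the
potential term needs the smoothing effect. -/
theorem S_N3 (a b c : H) : S (N3 a b c) = cub (S a) (S b) (S c) := by
  refine S_coeffs (((isJet_S a).mul (isJet_S b).conj).mul (isJet_S c)) ?_ ?_ ?_ ?_ <;>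
  simp [cub, mulZ_apply, mulZFun, conjZ_apply, S_apply, ext_mul, ext_add, ext_smul, ext_conjK, D0_zero,
    D0_one, D2_zero, D2_one]

/-- The jet of `x²`. -/
def sqZ : Z := (⟨fun x => ((x : ℝ) : ℂ) ^ 2, by fun_prop⟩, ⟨fun x => 2 * ((x : ℝ) : ℂ), by fun_prop⟩,
  constK 2, 0)

theorem hasDerivAt_ofReal (x : ℝ) : HasDerivAt (fun x : ℝ => (x : ℂ)) 1 x := Complex.ofRealCLM.hasDerivAt

theorem isJet_sqZ : IsJet sqZ where
  one := by
    refine ((IsPrim.of_hasDerivAt (a := 0) (b := 1) (F := fun x : ℝ => (x : ℂ) ^ 2)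
      (f := fun x : ℝ => 2 * (x : ℂ)) (fun x => ?_) (by fun_prop)).congr
        fun x hx => by rw [ext_apply _ hx]; rfl).congr_ae zero_le_one <|
      .of_forall fun x hx => by rw [ext_apply _ (Ioo_subset_Icc_self hx)]; rfl
    convert! (hasDerivAt_ofReal x).pow 2 using 1
    simp
  two := by
    refine ((IsPrim.of_hasDerivAt (a := 0) (b := 1) (F := fun x : ℝ => 2 * (x : ℂ))
      (f := fun x : ℝ => 2) (fun x => ?_) (by fun_prop)).congr
        fun x hx => by rw [ext_apply _ hx]; rfl).congr_ae zero_le_one <|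
      .of_forall fun x hx => (ext_constK _ _).symm
    simpa using (hasDerivAt_ofReal x).const_mul 2
  three := by
    refine ((IsPrim.of_hasDerivAt (a := 0) (b := 1) (F := fun x : ℝ => (2 : ℂ))
      (f := fun x : ℝ => 0) (fun x => ?_) (by fun_prop)).congr
        fun x hx => (ext_constK _ _).symm).congr_L2_symm (Lp.coeFn_zero _ _ _)
    exact hasDerivAt_const _ _

/-- The function `exp (i θ x²)`. -/
def gauge (θ : ℝ) : K := ⟨fun x => Complex.exp (Complex.I * θ * ((x : ℝ) : ℂ) ^ 2), by fun_prop⟩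

/-- Polynomials in `x`, as continuous functions on `[0, 1]`. -/
def XK : K := ⟨fun x => ((x : ℝ) : ℂ), by fun_prop⟩

theorem ext_XK {x : ℝ} (hx : x ∈ Icc (0 : ℝ) 1) : ext XK x = x := ext_apply _ hx
theorem ext_gauge (θ : ℝ) {x : ℝ} (hx : x ∈ Icc (0 : ℝ) 1) :
    ext (gauge θ) x = Complex.exp (Complex.I * θ * (x : ℂ) ^ 2) := ext_apply _ hx

/-- The jet of `exp (i θ x²)`. -/
def gaugeZ (θ : ℝ) : Z :=
  (gauge θ, (2 * Complex.I * θ) • (XK * gauge θ),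
    (2 * Complex.I * θ) • gauge θ - (4 * (θ : ℂ) ^ 2) • (XK ^ 2 * gauge θ),
    incl (-(12 * (θ : ℂ) ^ 2) • (XK * gauge θ)
      - (8 * Complex.I * (θ : ℂ) ^ 3) • (XK ^ 3 * gauge θ)))

theorem continuous_gauge : Continuous gauge :=
  ContinuousMap.continuous_of_continuous_uncurry _ (by
    change Continuous fun p : ℝ × Icc (0 : ℝ) 1 =>
      Complex.exp (Complex.I * p.1 * ((p.2 : ℝ) : ℂ) ^ 2)
    fun_prop)

theorem continuous_gaugeZ : Continuous gaugeZ := by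
  have := continuous_gauge
  unfold gaugeZ
  fun_prop

theorem hasDerivAt_exp_sq (θ x : ℝ) : HasDerivAt (fun x : ℝ => Complex.exp (Complex.I * θ * (x : ℂ) ^ 2))
    (2 * Complex.I * θ * x * Complex.exp (Complex.I * θ * (x : ℂ) ^ 2)) x := by
  convert! (((hasDerivAt_ofReal x).pow 2).const_mul (Complex.I * θ)).cexp using 1
  simp; ring

theorem isJet_gaugeZ (θ : ℝ) : IsJet (gaugeZ θ) where
  one := by
    refine ((IsPrim.of_hasDerivAt (a := 0) (b := 1) (hasDerivAt_exp_sq θ) (by fun_prop)).congr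
        fun x hx => by rw [ext_apply _ hx]; rfl).congr_ae zero_le_one <|
      .of_forall fun x hx => ?_
    have hx' := Ioo_subset_Icc_self hx
    simp only [gaugeZ, ext_smul, ext_mul, ext_XK hx', ext_gauge θ hx']; ring
  two := by
    refine ((IsPrim.of_hasDerivAt (a := 0) (b := 1)
      (fun x => ((hasDerivAt_ofReal x).mul (hasDerivAt_exp_sq θ x)).const_mul (2 * Complex.I * θ))
      (by fun_prop)).congr fun x hx => ?_).congr_ae zero_le_one <| .of_forall fun x hx => ?_
    · simp only [gaugeZ, ext_smul, ext_mul, ext_XK hx, ext_gauge θ hx]; rfl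
    · have hx' := Ioo_subset_Icc_self hx
      simp only [gaugeZ, ext_smul, ext_sub, ext_mul, ext_XK hx', ext_gauge θ hx', pow_two]
      linear_combination (4 * θ ^ 2 * x ^ 2 * Complex.exp (Complex.I * θ * (x * x))) * Complex.I_sq
  three := by
    refine ((IsPrim.of_hasDerivAt (a := 0) (b := 1)
      (fun x => ((hasDerivAt_exp_sq θ x).const_mul (2 * Complex.I * θ)).sub
        ((((hasDerivAt_ofReal x).pow 2).mul (hasDerivAt_exp_sq θ x)).const_mul (4 * (θ : ℂ) ^ 2)))
      (by fun_prop)).congr fun x hx => ?_).congr_L2_symm ?_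
    · simp only [gaugeZ, ext_smul, ext_sub, ext_mul, ext_XK hx, ext_gauge θ hx, pow_two]; rfl
    · filter_upwards [incl_ae (-(12 * (θ : ℂ) ^ 2) • (XK * gauge θ)
        - (8 * Complex.I * (θ : ℂ) ^ 3) • (XK ^ 3 * gauge θ)),
        ae_restrict_mem measurableSet_Ioo] with x h1 h2
      have hx' := Ioo_subset_Icc_self h2
      simp only [gaugeZ]
      rw [h1]
      simp only [ext_smul, ext_sub, ext_mul, ext_XK hx', ext_gauge θ hx', pow_succ, pow_zero, one_mul,
        Nat.cast_ofNat, Pi.mul_apply]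
      linear_combination (-(12 : ℂ) * θ ^ 2 * x * Complex.exp (Complex.I * θ * (x * x))
        + 8 * θ ^ 2 * x * Complex.exp (Complex.I * θ * (x * x))) * Complex.I_sq

end Jets

/-! ### Sine coefficients of a jet by repeated integration by parts. -/

section SineCoefficients

theorem integral_sin_mul_of_isPrim {c : ℝ} (f : K) {f' : ℝ → ℂ} (hf : IsPrim 0 1 (ext f) f') :
    (c : ℂ) * ∫ x in (0 : ℝ)..1, (Real.sin (c * x) : ℂ) * ext f x
      = (∫ x in (0 : ℝ)..1, (Real.cos (c * x) : ℂ) * f' x)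
        - (Real.cos c * ext f 1 - ext f 0) := by
  have h1 : (1 : ℝ) ∈ Icc (0 : ℝ) 1 := ⟨zero_le_one, le_rfl⟩
  have hc : IsPrim 0 1 (fun x => (Real.cos (c * x) : ℂ)) (fun x => -(c : ℂ) * Real.sin (c * x)) := by
    refine IsPrim.of_hasDerivAt (fun x => ?_) (by fun_prop)
    convert! ((((hasDerivAt_id x).const_mul c).cos).ofReal_comp) using 1
    simp; ring
  have h := (hc.smul zero_le_one hf).eq 1 h1
  have i1 : IntervalIntegrable (fun x => (Real.cos (c * x) : ℂ) * f' x) volume 0 1 :=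
    hf.integrable.continuousOn_mul (by fun_prop)
  have i2 : IntervalIntegrable (fun x => (c : ℂ) * (Real.sin (c * x) * ext f x)) volume 0 1 :=
    (Continuous.intervalIntegrable (by fun_prop) _ _)
  have e : ∫ x in (0 : ℝ)..1, ((Real.cos (c * x) : ℂ) • f' x + (-(c : ℂ) * Real.sin (c * x)) • ext f x)
      = (∫ x in (0 : ℝ)..1, (Real.cos (c * x) : ℂ) * f' x)
        - ∫ x in (0 : ℝ)..1, (c : ℂ) * (Real.sin (c * x) * ext f x) := by
    rw [← intervalIntegral.integral_sub i1 i2]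
    refine intervalIntegral.integral_congr fun x _ => ?_
    simp only [smul_eq_mul]; ring
  rw [e, intervalIntegral.integral_const_mul] at h
  simp only [mul_one, mul_zero, Real.cos_zero, smul_eq_mul, Complex.ofReal_one, one_mul] at h
  linear_combination h

theorem integral_cos_mul_of_isPrim {c : ℝ} (hs : Real.sin c = 0) (f : K) {f' : ℝ → ℂ}
    (hf : IsPrim 0 1 (ext f) f') :
    (c : ℂ) * ∫ x in (0 : ℝ)..1, (Real.cos (c * x) : ℂ) * ext f x
      = -∫ x in (0 : ℝ)..1, (Real.sin (c * x) : ℂ) * f' x := by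
  have h1 : (1 : ℝ) ∈ Icc (0 : ℝ) 1 := ⟨zero_le_one, le_rfl⟩
  have hc : IsPrim 0 1 (fun x => (Real.sin (c * x) : ℂ)) (fun x => (c : ℂ) * Real.cos (c * x)) := by
    refine IsPrim.of_hasDerivAt (fun x => ?_) (by fun_prop)
    convert! ((((hasDerivAt_id x).const_mul c).sin).ofReal_comp) using 1
    simp; ring
  have h := (hc.smul zero_le_one hf).eq 1 h1
  have i1 : IntervalIntegrable (fun x => (Real.sin (c * x) : ℂ) * f' x) volume 0 1 :=
    hf.integrable.continuousOn_mul (by fun_prop)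
  have i2 : IntervalIntegrable (fun x => (c : ℂ) * (Real.cos (c * x) * ext f x)) volume 0 1 :=
    (Continuous.intervalIntegrable (by fun_prop) _ _)
  have e : ∫ x in (0 : ℝ)..1, ((Real.sin (c * x) : ℂ) • f' x + ((c : ℂ) * Real.cos (c * x)) • ext f x)
      = (∫ x in (0 : ℝ)..1, (Real.sin (c * x) : ℂ) * f' x)
        + ∫ x in (0 : ℝ)..1, (c : ℂ) * (Real.cos (c * x) * ext f x) := by
    rw [← intervalIntegral.integral_add i1 i2]
    refine intervalIntegral.integral_congr fun x _ => ?_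
    simp only [smul_eq_mul]; ring
  rw [e, intervalIntegral.integral_const_mul] at h
  simp only [mul_one, mul_zero, Real.sin_zero, smul_eq_mul, hs, Complex.ofReal_zero, zero_mul,
    zero_add] at h
  linear_combination -h

/-- The function `sin (c x)` on `[0, 1]`. -/
def sinK (c : ℝ) : K := ⟨fun x => (Real.sin (c * x) : ℂ), by fun_prop⟩

theorem ext_sinK (c : ℝ) {x : ℝ} (hx : x ∈ Icc (0 : ℝ) 1) : ext (sinK c) x = Real.sin (c * x) := by
  rw [ext_apply _ hx]; rfl

/-- The sine coefficients of a continuous function. -/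
def sinC (k : ℕ) : K →L[ℂ] ℂ :=
  (innerSL ℂ (incl ((√2 : ℂ) • sinK (freq k)))) ∘L incl

theorem sinC_apply (k : ℕ) (f : K) :
    sinC k f = √2 * ∫ x in (0 : ℝ)..1, (Real.sin (freq k * x) : ℂ) * ext f x := by
  change inner ℂ (incl _) (incl f) = _
  rw [inner_incl, integral_incl_mul, ← intervalIntegral.integral_const_mul]
  refine intervalIntegral.integral_congr fun x hx => ?_
  rw [uIcc_of_le zero_le_one] at hx
  simp only [ext_smul, ext_sinK _ hx, map_mul, Complex.conj_ofReal, mul_assoc]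

/-- The third order sine coefficients of a jet, in terms of its third derivative and of the
boundary values of its second derivative. -/
def lam (k : ℕ) (z : Z) : ℂ :=
  coeffs z.2.2.2 k - √2 * (Real.cos (freq k) * ext z.2.2.1 1 - ext z.2.2.1 0)

theorem coeffs_incl (k : ℕ) (f : K) :
    coeffs (incl f) k = √2 * ∫ x in (0 : ℝ)..1, (Real.cos (freq k * x) : ℂ) * ext f x := by
  rw [coeffs_apply, inner_cosL, integral_incl_mul]

theorem freq_sq_mul_sinC (k : ℕ) {z : Z} (hz : IsJet z) (h0 : ext z.1 0 = 0) (h1 : ext z.1 1 = 0) :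
    (freq k : ℂ) ^ 2 * sinC k z.1 = -sinC k z.2.2.1 := by
  have e1 := integral_sin_mul_of_isPrim (c := freq k) z.1 hz.one
  have e2 := integral_cos_mul_of_isPrim (sin_freq k) z.2.1 hz.two
  rw [h0, h1] at e1
  rw [sinC_apply, sinC_apply]
  linear_combination √2 * freq k * e1 + √2 * e2

theorem freq_mul_sinC_two (k : ℕ) {z : Z} (hz : IsJet z) :
    (freq k : ℂ) * sinC k z.2.2.1 = lam k z := by
  have e := integral_sin_mul_of_isPrim (c := freq k) z.2.2.1 hz.three
  rw [sinC_apply, lam, coeffs_apply, inner_cosL]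
  linear_combination √2 * e

/-- Three integrations by parts. The first boundary terms vanish with `z`, the second with `sin
(freq k)`, and the third, which involve the second derivative at the ends, survive inside `lam`. -/
theorem freq_cube_mul_sinC (k : ℕ) {z : Z} (hz : IsJet z) (h0 : ext z.1 0 = 0)
    (h1 : ext z.1 1 = 0) : (freq k : ℂ) ^ 3 * sinC k z.1 = -lam k z := by
  rw [← freq_mul_sinC_two k hz]
  linear_combination (freq k : ℂ) * freq_sq_mul_sinC k hz h0 h1

theorem lam_S (k : ℕ) (a : H) : lam k (S a) = a k := by
  simp [lam, S_apply, D2_zero, D2_one, coeffs_D3]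

/-- Completeness of the sines follows from that of the cosines: one integration by parts shows that
the primitive of `f` has no cosine coefficient, so it is constant; it vanishes at `0`, hence
everywhere. -/
theorem eq_zero_of_sinC {f : K} (h : ∀ k, sinC k f = 0) : f = 0 := by
  set F : K := prim (incl f)
  have hF := isPrim_prim_incl f
  set m : ℂ := ∫ x in (0 : ℝ)..1, ext F x
  have hc : ∀ k, coeffs (incl F) k = 0 := fun k => by
    have e := integral_cos_mul_of_isPrim (sin_freq k) F hF
    have h2 := h k
    rw [sinC_apply] at h2
    have h3 : (freq k : ℂ) * coeffs (incl F) k = 0 := by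
      rw [coeffs_incl]; linear_combination √2 * e - h2
    exact (mul_eq_zero.mp h3).resolve_left (by exact_mod_cast (freq_pos k).ne')
  have hFm : incl (F - constK m) = 0 := by
    refine eq_zero_of_inner_cosL ?_ fun k => ?_
    · rw [inner_one_eq_integral]
      have := integral_incl_mul (fun _ => 1) (F - constK m)
      simp only [one_mul] at this
      rw [this]
      simp only [ext_sub, ext_constK]
      rw [intervalIntegral.integral_sub ((continuous_ext _).intervalIntegrable _ _) (by simp)]
      simp [m]
    · have e : constK m = m • (1 : K) := rfl
      rw [map_sub, inner_sub_right, e, map_smul, inner_smul_right, inner_cosL_one, mul_zero, sub_zero,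
        ← coeffs_apply, hc]
  have hF2 : F - constK m = 0 := incl_injective zero_lt_one (by rw [hFm, map_zero])
  have hm : m = 0 := by
    have := congrArg (fun g => ext g 0) hF2
    simp only [ext_sub, ext_constK, ext_zero] at this
    rw [ext_prim_zero] at this
    simpa using this
  have hF3 : F = 0 := by
    rw [sub_eq_zero.mp hF2, hm, map_zero]
  have := prim_injective (hF3.trans (map_zero _).symm)
  exact incl_injective zero_lt_one (this.trans (map_zero _).symm)

theorem ext_sqZ_one {x : ℝ} (hx : x ∈ Icc (0 : ℝ) 1) : ext sqZ.2.1 x = 2 * (x : ℂ) := by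
  rw [ext_apply _ hx]; rfl
theorem ext_sqZ_two (x : ℝ) : ext sqZ.2.2.1 x = 2 := ext_constK _ _

end SineCoefficients

/-! ### Interpolation inequalities and the tame estimate of the cubic term. -/

section Interpolation

theorem integral_norm_mul_norm_le (f g : L) :
    ∫ x in (0 : ℝ)..1, ‖f x‖ * ‖g x‖ ≤ ‖f‖ * ‖g‖ := by
  have hf : MemLp f (ENNReal.ofReal 2) (vol 0 1) := by simpa using Lp.memLp f
  have hg : MemLp g (ENNReal.ofReal 2) (vol 0 1) := by simpa using Lp.memLp g
  have h := integral_mul_norm_le_Lp_mul_Lq Real.HolderConjugate.two_two hf hg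
  have e : ∀ f : L, (∫ x in Ioo (0 : ℝ) 1, ‖f x‖ ^ (2 : ℝ)) ^ (1 / 2 : ℝ) = ‖f‖ := fun f => by
    have h2 := norm_sq_L2 f
    rw [intervalIntegral.integral_of_le zero_le_one, integral_Ioc_eq_integral_Ioo] at h2
    simp_rw [Real.rpow_two]
    rw [← h2, ← Real.sqrt_eq_rpow, Real.sqrt_sq (norm_nonneg _)]
  rw [e, e] at h
  rwa [intervalIntegral.integral_of_le zero_le_one, integral_Ioc_eq_integral_Ioo]

theorem integral_incl_congr {E : Type*} [NormedAddCommGroup E] [NormedSpace ℝ E] (f : K)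
    (Φ : ℝ → ℂ → E) :
    ∫ x in (0 : ℝ)..1, Φ x (incl f x) = ∫ x in (0 : ℝ)..1, Φ x (ext f x) := by
  rw [intervalIntegral.integral_of_le zero_le_one, intervalIntegral.integral_of_le zero_le_one,
    integral_Ioc_eq_integral_Ioo, integral_Ioc_eq_integral_Ioo]
  exact integral_congr_ae ((incl_ae f).mono fun x hx => by simp only [hx])

theorem norm_incl_sq (f : K) : ‖incl f‖ ^ 2 = ∫ x in (0 : ℝ)..1, ‖ext f x‖ ^ 2 := by
  rw [norm_sq_L2]
  exact integral_incl_congr f fun _ y => ‖y‖ ^ 2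

/-- The interpolation inequality between `L²` and `H¹`. -/
theorem norm_ext_sq_le {f : K} {g : L} (h : IsPrim 0 1 (ext f) g) :
    ‖f‖ ^ 2 ≤ ‖incl f‖ ^ 2 + 2 * ‖incl f‖ * ‖g‖ := by
  have hn : IsPrim 0 1 (fun x => ext f x * starRingEnd ℂ (ext f x))
      (fun x => ext f x * starRingEnd ℂ (g x) + g x * starRingEnd ℂ (ext f x)) :=
    h.smul zero_le_one (h.clm_comp Complex.conjCLE.toContinuousLinearMap)
  have hc : Continuous fun x => ‖ext f x‖ ^ 2 := by fun_prop
  -- A point where `|f|²` does not exceed its mean; from there `|f|²` is recovered by integrating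
  -- its derivative.
  obtain ⟨y, hy, hy2⟩ : ∃ y ∈ Icc (0 : ℝ) 1, ‖ext f y‖ ^ 2 ≤ ‖incl f‖ ^ 2 := by
    by_contra! hcon
    have := intervalIntegral.integral_lt_integral_of_continuousOn_of_le_of_exists_lt (a := 0) (b := 1)
      (f := fun _ => ‖incl f‖ ^ 2) (g := fun x => ‖ext f x‖ ^ 2) zero_lt_one continuousOn_const
      hc.continuousOn (fun x hx => (hcon x (Ioc_subset_Icc_self hx)).le)
      ⟨0, ⟨le_rfl, zero_le_one⟩, hcon 0 ⟨le_rfl, zero_le_one⟩⟩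
    rw [← norm_incl_sq] at this
    simp at this
  have ifg : IntervalIntegrable (fun x => ‖ext f x‖ * ‖g x‖) volume 0 1 :=
    (intervalIntegrable_L2 g).norm.continuousOn_mul (by fun_prop)
  have hb : ∫ x in (0 : ℝ)..1, ‖ext f x‖ * ‖g x‖ ≤ ‖incl f‖ * ‖g‖ := by
    rw [← integral_incl_congr f fun x y => ‖y‖ * ‖g x‖]
    exact integral_norm_mul_norm_le (incl f) g
  have hsq : ∀ x : Icc (0 : ℝ) 1, ‖f x‖ ^ 2 ≤ ‖incl f‖ ^ 2 + 2 * ‖incl f‖ * ‖g‖ := by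
    rintro ⟨x, hx⟩
    rw [← ext_apply f hx]
    have h1 := hn.sub_eq hy hx
    have h2 : ‖(ext f x * starRingEnd ℂ (ext f x)) - ext f y * starRingEnd ℂ (ext f y)‖
        ≤ |∫ t in y..x, 2 * (‖ext f t‖ * ‖g t‖)| := by
      rw [h1]
      refine intervalIntegral.norm_integral_le_abs_of_norm_le (.of_forall fun t => ?_) ?_
      · refine (norm_add_le _ _).trans_eq ?_
        simp only [norm_mul, RCLike.norm_conj]; ring
      · refine (ifg.const_mul 2).mono_set ?_
        rw [uIcc_of_le zero_le_one]
        exact uIcc_subset_Icc hy hx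
    have h3' : |∫ t in y..x, 2 * (‖ext f t‖ * ‖g t‖)| ≤ ∫ t in (0:ℝ)..1, 2 * (‖ext f t‖ * ‖g t‖) := by
      refine (intervalIntegral.abs_integral_mono_interval (c := 0) (d := 1) ?_ ?_
        (ifg.const_mul 2)).trans_eq ?_
      · rw [uIoc_of_le zero_le_one]
        rintro t ⟨ht1, ht2⟩
        exact ⟨(le_min hy.1 hx.1).trans_lt ht1, ht2.trans (max_le hy.2 hx.2)⟩
      · exact .of_forall fun t => by positivity
      · exact abs_of_nonneg (intervalIntegral.integral_nonneg zero_le_one fun t _ => by positivity)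
    have h3 := h3'.trans_eq (intervalIntegral.integral_const_mul _ _)
    simp only [Complex.mul_conj, ← Complex.ofReal_sub] at h2
    rw [Complex.norm_real, Real.norm_eq_abs, Complex.normSq_eq_norm_sq,
      Complex.normSq_eq_norm_sq] at h2
    have := le_abs_self (‖ext f x‖ ^ 2 - ‖ext f y‖ ^ 2)
    linarith
  have h0 : 0 ≤ ‖incl f‖ ^ 2 + 2 * ‖incl f‖ * ‖g‖ := by positivity
  have : ‖f‖ ≤ √(‖incl f‖ ^ 2 + 2 * ‖incl f‖ * ‖g‖) :=
    (ContinuousMap.norm_le _ (Real.sqrt_nonneg _)).mpr fun x => Real.le_sqrt_of_sq_le (hsq x)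
  calc ‖f‖ ^ 2 ≤ √(‖incl f‖ ^ 2 + 2 * ‖incl f‖ * ‖g‖) ^ 2 := by gcongr
    _ = _ := Real.sq_sqrt h0

theorem norm_prim_L_le (g : L) : ‖prim g‖ ≤ ‖g‖ := by
  have := norm_prim_le g
  simpa using this

theorem norm_D2_le (a : H) : ‖D2 a‖ ≤ ‖a‖ := (norm_prim_L_le _).trans_eq (D3.norm_map a)

theorem norm_D1_le (a : H) : ‖D1 a‖ ≤ 2 * ‖a‖ := by
  have h1 : ‖prim (incl (D2 a))‖ ≤ ‖a‖ :=
    (norm_prim_L_le _).trans ((norm_incl_le _).trans (norm_D2_le a))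
  have h2 : ‖constK (meanK (prim (incl (D2 a))))‖ ≤ ‖a‖ := by
    refine (ContinuousMap.norm_le _ (norm_nonneg _)).mpr fun x => ?_
    change ‖meanK (prim (incl (D2 a))) * 1‖ ≤ _
    rw [mul_one]
    refine (norm_ext_le _ _).trans ((norm_prim_L_le _).trans ((norm_incl_le _).trans h1))
  refine (norm_sub_le _ _).trans ?_
  change ‖prim (incl (D2 a))‖ + ‖constK (meanK (prim (incl (D2 a))))‖ ≤ _
  linarith

theorem norm_D0_le (a : H) : ‖D0 a‖ ≤ ‖incl (D1 a)‖ := norm_prim_L_le _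

/-- Interpolation of the sup norm of the first derivative between its `L²` norm and the `H³` norm.
This is what keeps the cubic estimate linear in `‖a‖`. -/
theorem norm_D1_sq_le (a : H) : ‖D1 a‖ ^ 2 ≤ 4 * ‖incl (D1 a)‖ * ‖a‖ := by
  have h : IsPrim 0 1 (ext (D1 a)) (incl (D2 a)) := (isJet_S a).two.congr_L2_symm (incl_ae _)
  have h1 := norm_ext_sq_le h
  have h2 : ‖incl (D2 a)‖ ≤ ‖a‖ := (norm_incl_le _).trans (norm_D2_le a)
  have h3 : ‖incl (D1 a)‖ ≤ 2 * ‖a‖ := (norm_incl_le _).trans (norm_D1_le a)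
  have h0 := norm_nonneg (incl (D1 a))
  nlinarith

theorem incl_mul (f g : K) : incl (f * g) = mulL f (incl g) := by
  refine Lp.ext ?_
  filter_upwards [incl_ae (f * g), mulL_ae f (incl g), incl_ae g] with x h1 h2 h3
  rw [h1, h2, h3, ext_mul]

theorem norm_incl_mul_le (f g : K) : ‖incl (f * g)‖ ≤ ‖f‖ * ‖incl g‖ := by
  rw [incl_mul]; exact norm_mulL_le _ _

theorem norm_incl_conjK (f : K) : ‖incl (conjK f)‖ = ‖incl f‖ := by
  have h : (‖incl (conjK f)‖) ^ 2 = ‖incl f‖ ^ 2 := by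
    rw [norm_incl_sq, norm_incl_sq]
    simp [ext_conjK]
  exact (sq_eq_sq₀ (norm_nonneg _) (norm_nonneg _)).mp h

/-- The tame estimate of the cubic nonlinearity. -/
theorem norm_N3_self_le (a : H) : ‖N3 a a a‖ ≤ 45 * ‖incl (D1 a)‖ ^ 2 * ‖a‖ := by
  refine (norm_coeffs_le _).trans ?_
  set m := ‖incl (D1 a)‖
  have hm : 0 ≤ m := norm_nonneg _
  have ha : 0 ≤ ‖a‖ := norm_nonneg _
  have d0 : ‖D0 a‖ ≤ m := norm_D0_le a
  have d1 := norm_D1_sq_le a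
  have d2 := norm_D2_le a
  have d3 : ‖D3 a‖ = ‖a‖ := D3.norm_map a
  have c0 : ‖conjK (D0 a)‖ ≤ m := (norm_conjK _).trans_le d0
  have c2 : ‖conjK (D2 a)‖ ≤ ‖a‖ := (norm_conjK _).trans_le d2
  have c3 : ‖conjL (D3 a)‖ = ‖a‖ := (norm_conjL _).trans d3
  have c1 : ‖incl (conjK (D1 a))‖ = m := norm_incl_conjK _
  simp only [cub, mulZ_apply, mulZFun, conjZ_apply, S_apply]
  have w3 : ‖mulL (conjK (D0 a)) (D3 a)
      + (3 : ℂ) • incl (D2 a * conjK (D1 a) + D1 a * conjK (D2 a)) + mulL (D0 a) (conjL (D3 a))‖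
      ≤ 8 * m * ‖a‖ := by
    have t1 : ‖mulL (conjK (D0 a)) (D3 a)‖ ≤ m * ‖a‖ := (norm_mulL_le _ _).trans (by
      rw [d3]; gcongr)
    have t2 : ‖mulL (D0 a) (conjL (D3 a))‖ ≤ m * ‖a‖ := (norm_mulL_le _ _).trans (by
      rw [c3]; gcongr)
    have t3 : ‖incl (D2 a * conjK (D1 a))‖ ≤ ‖a‖ * m := (norm_incl_mul_le _ _).trans (by
      rw [c1]; gcongr)
    have t4 : ‖incl (D1 a * conjK (D2 a))‖ ≤ ‖a‖ * m := by
      rw [mul_comm]; exact (norm_incl_mul_le _ _).trans (by gcongr)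
    refine norm_add₃_le.trans ?_
    rw [norm_smul, map_add]
    have := norm_add_le (incl (D2 a * conjK (D1 a))) (incl (D1 a * conjK (D2 a)))
    simp only [Complex.norm_ofNat]
    linarith
  have w2 : ‖D2 a * conjK (D0 a) + (2 : ℂ) • (D1 a * conjK (D1 a)) + D0 a * conjK (D2 a)‖
      ≤ 10 * m * ‖a‖ := by
    have t1 : ‖D2 a * conjK (D0 a)‖ ≤ ‖a‖ * m := (norm_mul_le _ _).trans (by gcongr)
    have t2 : ‖D0 a * conjK (D2 a)‖ ≤ m * ‖a‖ := (norm_mul_le _ _).trans (by gcongr)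
    -- The one term without an undifferentiated factor; by `d1` it is at most `4 m ‖a‖`, which gives
    -- `1 + 2 * 4 + 1 = 10` in total.
    have t3 : ‖D1 a * conjK (D1 a)‖ ≤ ‖D1 a‖ ^ 2 := (norm_mul_le _ _).trans_eq (by
      rw [norm_conjK, pow_two])
    refine norm_add₃_le.trans ?_
    rw [norm_smul]
    simp only [Complex.norm_ofNat]
    linarith
  have w1 : ‖incl (D1 a * conjK (D0 a) + D0 a * conjK (D1 a))‖ ≤ 2 * m ^ 2 := by
    have t1 : ‖incl (D1 a * conjK (D0 a))‖ ≤ m * m := by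
      rw [mul_comm]; exact (norm_incl_mul_le _ _).trans (by gcongr)
    have t2 : ‖incl (D0 a * conjK (D1 a))‖ ≤ m * m := (norm_incl_mul_le _ _).trans (by
      rw [c1]; gcongr)
    rw [map_add]
    refine (norm_add_le _ _).trans ?_
    linarith
  have w0 : ‖D0 a * conjK (D0 a)‖ ≤ m * m := (norm_mul_le _ _).trans (by gcongr)
  generalize D2 a * conjK (D0 a) + (2 : ℂ) • (D1 a * conjK (D1 a)) + D0 a * conjK (D2 a) = W2 at *
  generalize D1 a * conjK (D0 a) + D0 a * conjK (D1 a) = W1 at *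
  generalize mulL (conjK (D0 a)) (D3 a)
      + (3 : ℂ) • incl (D2 a * conjK (D1 a) + D1 a * conjK (D2 a)) + mulL (D0 a) (conjL (D3 a))
      = W3 at *
  have u1 : ‖mulL (D0 a) W3‖ ≤ m * (8 * m * ‖a‖) := (norm_mulL_le _ _).trans (by gcongr)
  have u2 : ‖incl (W2 * D1 a)‖ ≤ 10 * m * ‖a‖ * m := (norm_incl_mul_le _ _).trans (by gcongr)
  have u3 : ‖incl (W1 * D2 a)‖ ≤ ‖a‖ * (2 * m ^ 2) := by
    rw [mul_comm]; exact (norm_incl_mul_le _ _).trans (by gcongr)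
  have u4 : ‖mulL (D0 a * conjK (D0 a)) (D3 a)‖ ≤ m * m * ‖a‖ := (norm_mulL_le _ _).trans (by
    rw [d3]; gcongr)
  -- The constant is `8 + 3 * (10 + 2) + 1 = 45`.
  refine norm_add₃_le.trans ?_
  rw [norm_smul, map_add]
  have := norm_add_le (incl (W2 * D1 a)) (incl (W1 * D2 a))
  simp only [Complex.norm_ofNat]
  linarith

end Interpolation

/-! ### The free Schrödinger group in coordinates. -/

section Phase

/-- The unimodular factor `exp (-i λ_k s)`. -/
def osc (k : ℕ) (s : ℝ) : ℂ := Complex.exp (-(Complex.I * (freq k) ^ 2 * s))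

@[fun_prop]
theorem continuous_osc (k : ℕ) : Continuous (osc k) := by unfold osc; fun_prop

theorem norm_osc (k : ℕ) (s : ℝ) : ‖osc k s‖ = 1 := by
  have : osc k s = Complex.exp (((-(freq k ^ 2 * s) : ℝ) : ℂ) * Complex.I) := by
    unfold osc; congr 1; push_cast; ring
  rw [this, Complex.norm_exp_ofReal_mul_I]

theorem osc_add (k : ℕ) (s t : ℝ) : osc k (s + t) = osc k s * osc k t := by
  unfold osc; rw [← Complex.exp_add]; congr 1; push_cast; ring

theorem osc_zero (k : ℕ) : osc k 0 = 1 := by simp [osc]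

theorem osc_neg_mul (k : ℕ) (s : ℝ) : osc k (-s) * osc k s = 1 := by
  rw [← osc_add, neg_add_cancel, osc_zero]

theorem conj_osc (k : ℕ) (s : ℝ) : starRingEnd ℂ (osc k s) = osc k (-s) := by
  unfold osc
  rw [← Complex.exp_conj]
  simp

theorem hasDerivAt_osc (k : ℕ) (s : ℝ) :
    HasDerivAt (osc k) (-(Complex.I * (freq k) ^ 2) * osc k s) s := by
  have := (((hasDerivAt_ofReal s).const_mul (Complex.I * (freq k : ℂ) ^ 2)).neg).cexp
  unfold osc
  convert! this using 1
  simp only [Pi.neg_apply]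
  ring

theorem memℓp_osc (s : ℝ) (a : H) : Memℓp (fun k => osc k s * a k) 2 := by
  refine (lp.memℓp a).mono' fun k => ?_
  rw [norm_mul, norm_osc, one_mul]

theorem norm_sq_H (a : H) : ‖a‖ ^ 2 = ∑' k, ‖a k‖ ^ 2 := by
  have := lp.norm_rpow_eq_tsum (p := 2) (by norm_num) a
  simpa using this

theorem summable_sq_H (a : H) : Summable fun k => ‖a k‖ ^ 2 := by
  have := (lp.memℓp a).summable (by norm_num)
  simpa using this

/-- The free Schrödinger group in coordinates. -/
def phase (s : ℝ) : H →L[ℂ] H :=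
  LinearMap.mkContinuous
    { toFun := fun a => ⟨fun k => osc k s * a k, memℓp_osc s a⟩
      map_add' := fun a b => by ext k; exact mul_add _ _ _
      map_smul' := fun c a => by ext k; exact mul_left_comm _ _ _ } 1 fun a => by
    refine le_of_eq ?_
    rw [one_mul, ← sq_eq_sq₀ (norm_nonneg _) (norm_nonneg _), norm_sq_H, norm_sq_H]
    refine tsum_congr fun k => ?_
    change ‖osc k s * a k‖ ^ 2 = _
    rw [norm_mul, norm_osc, one_mul]

theorem phase_apply (s : ℝ) (a : H) (k : ℕ) : phase s a k = osc k s * a k := rfl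

theorem norm_phase (s : ℝ) (a : H) : ‖phase s a‖ = ‖a‖ := by
  rw [← sq_eq_sq₀ (norm_nonneg _) (norm_nonneg _), norm_sq_H, norm_sq_H]
  exact tsum_congr fun k => by rw [phase_apply, norm_mul, norm_osc, one_mul]

theorem phase_zero (a : H) : phase 0 a = a := by
  ext k; rw [phase_apply, osc_zero, one_mul]

theorem continuous_phase_apply (a : H) : Continuous fun s => phase s a := by
  rw [continuous_iff_continuousAt]
  intro s₀
  have hc : Continuous fun s => ‖phase s a - phase s₀ a‖ ^ 2 := by
    have e : ∀ s, ‖phase s a - phase s₀ a‖ ^ 2 = ∑' k, ‖osc k s * a k - osc k s₀ * a k‖ ^ 2 :=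
      fun s => norm_sq_H _
    simp_rw [e]
    refine continuous_tsum (u := fun k => 4 * ‖a k‖ ^ 2) (fun k => by fun_prop)
      ((summable_sq_H a).mul_left 4) fun k s => ?_
    rw [Real.norm_of_nonneg (by positivity)]
    have h : ‖osc k s * a k - osc k s₀ * a k‖ ≤ 2 * ‖a k‖ := by
      refine (norm_sub_le _ _).trans_eq ?_
      simp only [norm_mul, norm_osc]; ring
    calc _ ≤ (2 * ‖a k‖) ^ 2 := by gcongr
      _ = _ := by ring
  have h0 := hc.tendsto s₀
  simp only [sub_self, norm_zero, ne_eq, OfNat.ofNat_ne_zero, not_false_eq_true, zero_pow] at h0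
  have h1 := h0.sqrt
  simp only [Real.sqrt_sq (norm_nonneg _), Real.sqrt_zero] at h1
  exact tendsto_iff_norm_sub_tendsto_zero.mpr h1

/-- The group is only strongly continuous; since each `phase s` is an isometry, this suffices for
joint continuity. -/
theorem continuous_phase {X : Type*} [TopologicalSpace X] {s : X → ℝ} {a : X → H}
    (hs : Continuous s) (ha : Continuous a) : Continuous fun x => phase (s x) (a x) := by
  rw [continuous_iff_continuousAt]
  intro x₀
  rw [ContinuousAt, tendsto_iff_norm_sub_tendsto_zero]
  have h1 : Filter.Tendsto (fun x => ‖a x - a x₀‖ + ‖phase (s x) (a x₀) - phase (s x₀) (a x₀)‖)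
      (nhds x₀) (nhds 0) := by
    have c : Continuous fun x => ‖a x - a x₀‖ + ‖phase (s x) (a x₀) - phase (s x₀) (a x₀)‖ := by
      have := (continuous_phase_apply (a x₀)).comp hs
      simp only [Function.comp_def] at this
      fun_prop
    have := c.tendsto x₀
    simpa using this
  refine squeeze_zero (fun _ => norm_nonneg _) (fun x => ?_) h1
  calc ‖phase (s x) (a x) - phase (s x₀) (a x₀)‖
      = ‖phase (s x) (a x - a x₀) + (phase (s x) (a x₀) - phase (s x₀) (a x₀))‖ := by
        rw [map_sub]; congr 1; abel
    _ ≤ _ := (norm_add_le _ _).trans_eq (by rw [norm_phase])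

end Phase

/-! ### Bessel's inequality in time for the oscillating factors. -/

section Bessel

variable {a b : ℝ} [Fact (a ≤ b)]

theorem inner_incl_L2 (f : C(Icc a b, ℂ)) (g : L2 ℂ a b) :
    inner ℂ (incl f) g = ∫ x in a..b, starRingEnd ℂ (ext f x) * g x := by
  rw [intervalIntegral.integral_of_le Fact.out, integral_Ioc_eq_integral_Ioo, L2.inner_def]
  refine integral_congr_ae ((incl_ae f).mono fun x hx => ?_)
  simp only [hx, RCLike.inner_apply, mul_comm]

/-- A common period of all `osc k` that exceeds `T`. -/
def period (T : ℝ) : ℝ := (⌈T * (Real.pi / 2)⌉₊ + 1 : ℕ) * (2 / Real.pi)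

theorem period_pos (T : ℝ) : 0 < period T := by unfold period; positivity

theorem le_period (T : ℝ) : T ≤ period T := by
  have h := Nat.le_ceil (T * (Real.pi / 2))
  have hp := Real.pi_pos
  unfold period
  rw [mul_div_assoc', le_div_iff₀ hp]
  push_cast
  linarith

/-- The frequencies `freq k ^ 2` are distinct integer multiples of `π ^ 2`, so `2 / π`, and with it
`period T`, is a common period; over it every nontrivial exponential integrates to zero. -/
theorem integral_osc_mul_osc (T : ℝ) (j k : ℕ) :
    ∫ s in (0 : ℝ)..period T, osc j (-s) * osc k s = if j = k then (period T : ℂ) else 0 := by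
  split_ifs with h
  · subst h
    simp [osc_neg_mul]
  · set m : ℤ := (j + 1) ^ 2 - (k + 1) ^ 2
    have hm : m ≠ 0 := by
      intro h0
      have : ((j : ℤ) + 1) ^ 2 = (k + 1) ^ 2 := sub_eq_zero.mp h0
      rw [sq_eq_sq₀ (by positivity) (by positivity)] at this
      exact h (by exact_mod_cast add_right_cancel this)
    set c : ℂ := Complex.I * (m * Real.pi ^ 2)
    have hc : c ≠ 0 := by
      refine mul_ne_zero Complex.I_ne_zero (mul_ne_zero (by exact_mod_cast hm) ?_)
      exact pow_ne_zero _ (by exact_mod_cast Real.pi_ne_zero)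
    have e : ∀ s : ℝ, osc j (-s) * osc k s = Complex.exp (c * s) := fun s => by
      unfold osc
      rw [← Complex.exp_add]
      congr 1
      simp only [freq, c, m]; push_cast; ring
    simp_rw [e]
    rw [integral_exp_mul_complex hc]
    have h1 : Complex.exp (c * (period T : ℝ)) = 1 := by
      rw [Complex.exp_eq_one_iff]
      refine ⟨m * (⌈T * (Real.pi / 2)⌉₊ + 1 : ℕ), ?_⟩
      have hp : (Real.pi : ℂ) ≠ 0 := by exact_mod_cast Real.pi_ne_zero
      simp only [c, period]
      push_cast
      field_simp
    rw [h1]; simp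

/-- Bessel's inequality for the family `osc k`. -/
theorem sum_norm_integral_osc_sq_le {T : ℝ} {f : ℝ → ℂ} {x y : ℝ} (hx : 0 ≤ x) (hxy : x ≤ y)
    (hy : y ≤ T) (hf : MemLp f 2 (volume.restrict (Ioc x y))) (s : Finset ℕ) :
    ∑ k ∈ s, ‖∫ t in x..y, osc k (-t) * f t‖ ^ 2 ≤ period T * ∫ t in x..y, ‖f t‖ ^ 2 := by
  set P := period T
  have hP : 0 < P := period_pos T
  have : Fact ((0 : ℝ) ≤ P) := ⟨hP.le⟩
  have hPc : (P : ℂ) ≠ 0 := by exact_mod_cast hP.ne'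
  let w : ℕ → C(Icc (0 : ℝ) P, ℂ) := fun k => ⟨fun t => osc k t, by fun_prop⟩
  have hw : ∀ k, ∀ t ∈ Icc (0 : ℝ) P, ext (w k) t = osc k t := fun k t ht => ext_apply _ ht
  have inner_w : ∀ k (g : L2 ℂ 0 P), inner ℂ (incl (w k)) g = ∫ t in (0 : ℝ)..P, osc k (-t) * g t :=
    fun k g => by
      rw [inner_incl_L2]
      refine intervalIntegral.integral_congr fun t ht => ?_
      rw [uIcc_of_le hP.le] at ht
      simp only [hw k t ht, conj_osc]
  have on : Orthonormal ℂ fun k => ((√P : ℝ) : ℂ)⁻¹ • incl (w k) := by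
    rw [orthonormal_iff_ite]
    intro j k
    rw [inner_smul_left, inner_smul_right, inner_w]
    have : ∫ t in (0 : ℝ)..P, osc j (-t) * incl (w k) t
        = ∫ t in (0 : ℝ)..P, osc j (-t) * osc k t := by
      rw [intervalIntegral.integral_of_le hP.le, intervalIntegral.integral_of_le hP.le,
        integral_Ioc_eq_integral_Ioo, integral_Ioc_eq_integral_Ioo]
      refine integral_congr_ae ?_
      filter_upwards [incl_ae (w k), ae_restrict_mem measurableSet_Ioo] with t h1 h2
      rw [h1, hw k t (Ioo_subset_Icc_self h2)]
    rw [this, integral_osc_mul_osc]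
    split_ifs
    · rw [map_inv₀, Complex.conj_ofReal, ← mul_assoc, ← mul_inv, ← Complex.ofReal_mul,
        Real.mul_self_sqrt hP.le, inv_mul_cancel₀ hPc]
    · simp
  -- `f` is extended by zero from `(x, y]` to the whole period, on which the normalized family is
  -- orthonormal.
  have hg : MemLp ((Ioc x y).indicator f) 2 (vol 0 P) :=
    ((memLp_indicator_iff_restrict measurableSet_Ioc).mpr hf).restrict _
  set G : L2 ℂ 0 P := hg.toLp
  have sub : Ioc x y ⊆ Ioc 0 P := Ioc_subset_Ioc hx (hy.trans (le_period T))
  have toI : ∀ {E : Type} [NormedAddCommGroup E] [NormedSpace ℝ E] (Φ : ℝ → ℂ → E),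
      (∀ t, Φ t 0 = 0) → ∫ t in (0 : ℝ)..P, Φ t (G t) = ∫ t in x..y, Φ t (f t) := by
    intro E _ _ Φ h0
    rw [intervalIntegral.integral_of_le hP.le, intervalIntegral.integral_of_le hxy,
      ← inter_eq_right.mpr sub, ← setIntegral_indicator measurableSet_Ioc,
      integral_Ioc_eq_integral_Ioo, integral_Ioc_eq_integral_Ioo]
    refine integral_congr_ae (hg.coeFn_toLp.mono fun t ht => ?_)
    have ht : G t = (Ioc x y).indicator f t := ht
    simp only [ht, indicator]
    split_ifs
    · rfl
    · exact h0 t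
  have key := on.sum_inner_products_le G (s := s)
  rw [norm_sq_L2, toI (fun _ z => ‖z‖ ^ 2) (by simp)] at key
  have e : ∀ k, ‖inner ℂ (((√P : ℝ) : ℂ)⁻¹ • incl (w k)) hg.toLp‖ ^ 2
      = P⁻¹ * ‖∫ t in x..y, osc k (-t) * f t‖ ^ 2 := fun k => by
    rw [inner_smul_left, inner_w, toI (fun t z => osc k (-t) * z) (by simp), norm_mul, mul_pow]
    congr 1
    rw [map_inv₀, Complex.conj_ofReal, norm_inv, Complex.norm_real, inv_pow, Real.norm_eq_abs, sq_abs,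
      Real.sq_sqrt hP.le]
  rw [Finset.sum_congr rfl fun k _ => e k, ← Finset.mul_sum, inv_mul_le_iff₀ hP] at key
  exact key

end Bessel

/-! ### Continuous paths and pointwise linear and bilinear maps on them. -/

section Path

/-- Continuous functions on `[a, b]`, as a normed space. -/
def Path (a b : ℝ) (X : Type*) [NormedAddCommGroup X] : Type _ := C(Icc a b, X)

variable {a b : ℝ} {X : Type*} [NormedAddCommGroup X] [NormedSpace ℝ X]

instance : NormedAddCommGroup (Path a b X) := inferInstanceAs (NormedAddCommGroup C(Icc a b, X))
instance : NormedSpace ℝ (Path a b X) := inferInstanceAs (NormedSpace ℝ C(Icc a b, X))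
instance [CompleteSpace X] : CompleteSpace (Path a b X) := inferInstanceAs (CompleteSpace C(Icc a b, X))

variable [hab : Fact (a ≤ b)]

/-- The value at time `t`. -/
def Path.val (f : Path a b X) (t : ℝ) : X := ext (X := X) f t

@[fun_prop]
theorem Path.continuous_val (f : Path a b X) : Continuous f.val := continuous_ext (X := X) f

theorem Path.norm_val_le (f : Path a b X) (t : ℝ) : ‖f.val t‖ ≤ ‖f‖ := norm_ext_le f t

theorem Path.norm_le {f : Path a b X} {C : ℝ} (hC : 0 ≤ C) (h : ∀ t ∈ Icc a b, ‖f.val t‖ ≤ C) :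
    ‖f‖ ≤ C :=
  (ContinuousMap.norm_le (f := (f : C(Icc a b, X))) hC).mpr fun t => by
    have := h t t.2
    rwa [Path.val, ext_apply (X := X) f t.2] at this

theorem Path.eq_of_val {f g : Path a b X} (h : ∀ t ∈ Icc a b, f.val t = g.val t) : f = g :=
  eq_of_ext_eq (X := X) h

@[simp] theorem Path.val_add (f g : Path a b X) (t : ℝ) : (f + g).val t = f.val t + g.val t := rfl
@[simp] theorem Path.val_smul (c : ℝ) (f : Path a b X) (t : ℝ) : (c • f).val t = c • f.val t := rfl
@[simp] theorem Path.val_zero (t : ℝ) : (0 : Path a b X).val t = 0 := rfl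

/-- A path given by a function that is continuous on `[a, b]`. -/
def Path.mk (f : ℝ → X) (hf : ContinuousOn f (Icc a b)) : Path a b X :=
  (⟨fun t => f t, continuousOn_iff_continuous_domRestrict.mp hf⟩ : C(Icc a b, X))

theorem Path.val_mk {f : ℝ → X} (hf : ContinuousOn f (Icc a b)) {t : ℝ} (ht : t ∈ Icc a b) :
    (Path.mk f hf).val t = f t := ext_apply _ ht

/-- Evaluation at time `t`. -/
def Path.eval (t : ℝ) : Path a b X →L[ℝ] X :=
  LinearMap.mkContinuous
    { toFun := fun f => f.val t
      map_add' := fun _ _ => rfl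
      map_smul' := fun _ _ => rfl } 1 fun f => by
    rw [one_mul]; exact f.norm_val_le t

variable {Y V : Type*} [NormedAddCommGroup Y] [NormedSpace ℝ Y] [NormedAddCommGroup V] [NormedSpace ℝ V]

/-- Pointwise action of a bilinear map on paths. -/
def liftB (B : X →L[ℝ] Y →L[ℝ] V) : Path a b X →L[ℝ] Path a b Y →L[ℝ] Path a b V :=
  LinearMap.mkContinuous₂
    (LinearMap.mk₂ ℝ (fun f g => Path.mk (fun t => B (f.val t) (g.val t)) (by fun_prop))
      (fun f f' g => Path.eq_of_val fun t ht => by simp [Path.val_mk _ ht])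
      (fun c f g => Path.eq_of_val fun t ht => by simp [Path.val_mk _ ht])
      (fun f g g' => Path.eq_of_val fun t ht => by simp [Path.val_mk _ ht])
      (fun c f g => Path.eq_of_val fun t ht => by simp [Path.val_mk _ ht])) ‖B‖ fun f g => by
    refine Path.norm_le (by positivity) fun t ht => ?_
    simp only [LinearMap.mk₂_apply, Path.val_mk _ ht]
    refine (B.le_opNorm₂ _ _).trans ?_
    gcongr <;> exact Path.norm_val_le _ _

theorem Path.val_projIcc (f : Path a b X) (t : ℝ) : f.val (projIcc a b Fact.out t) = f.val t := by
  change IccExtend _ _ _ = IccExtend _ _ _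
  simp only [IccExtend, Function.comp_apply, projIcc_val]

theorem liftB_val (B : X →L[ℝ] Y →L[ℝ] V) (f : Path a b X) (g : Path a b Y) (t : ℝ) :
    (liftB B f g).val t = B (f.val t) (g.val t) := by
  change B (f.val (projIcc a b Fact.out t)) (g.val (projIcc a b Fact.out t)) = _
  rw [Path.val_projIcc, Path.val_projIcc]

/-- Pointwise action of a linear map on paths. -/
def liftL (A : X →L[ℝ] V) : Path a b X →L[ℝ] Path a b V :=
  LinearMap.mkContinuous
    { toFun := fun f => Path.mk (fun t => A (f.val t)) (by fun_prop)
      map_add' := fun f g => Path.eq_of_val fun t ht => by simp [Path.val_mk _ ht]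
      map_smul' := fun c f => Path.eq_of_val fun t ht => by simp [Path.val_mk _ ht] } ‖A‖ fun f => by
    refine Path.norm_le (by positivity) fun t ht => ?_
    simp only [LinearMap.coe_mk, AddHom.coe_mk, Path.val_mk _ ht]
    exact A.le_opNorm_of_le (f.norm_val_le t)

theorem liftL_val (A : X →L[ℝ] V) (f : Path a b X) (t : ℝ) : (liftL A f).val t = A (f.val t) := by
  change A (f.val (projIcc a b Fact.out t)) = _
  rw [Path.val_projIcc]

end Path

/-! ### Volterra operators: Grönwall bound and invertibility. -/

section Volterra

variable {a b : ℝ} [hab : Fact (a ≤ b)] {X : Type*} [NormedAddCommGroup X] [NormedSpace ℝ X]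

/-- `‖A f (t)‖²` is controlled by the integral of `k ‖f‖²` up to time `t`. -/
def IsVolterra (k : ℝ → ℝ) (A : Path a b X →L[ℝ] Path a b X) : Prop :=
  ∀ f, ∀ t ∈ Icc a b, ‖Path.val (A f) t‖ ^ 2 ≤ ∫ s in a..t, k s * ‖f.val s‖ ^ 2

variable {k : ℝ → ℝ} {A : Path a b X →L[ℝ] Path a b X}

/-- Grönwall's inequality for `‖f‖²`; the inequality `(p + q)² ≤ 2 p² + 2 q²` doubles both the
kernel and the source. -/
theorem IsVolterra.norm_le (hA : IsVolterra k A) (hk : IntervalIntegrable k volume a b)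
    (hk0 : ∀ t, 0 ≤ k t) {f e : Path a b X} (h : f = A f + e) :
    ‖f‖ ^ 2 ≤ 4 * ‖e‖ ^ 2 * Real.exp (4 * ∫ t in a..b, k t) := by
  have hp : IsPrim a b (fun x => ∫ t in a..x, k t) k := ⟨hk, by simp⟩
  have key := gronwall_of_integral_le (f := fun t => ‖f.val t‖ ^ 2) (k := fun t => 2 * k t)
    (C := 2 * ‖e‖ ^ 2) hab.out (hk.const_mul 2) (fun t => by have := hk0 t; positivity)
    (by fun_prop) fun t ht => by
      have h1 : f.val t = Path.val (A f) t + e.val t := by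
        conv_lhs => rw [h]
        rfl
      have h2 := hA f t ht
      have h3 := e.norm_val_le t
      have h4 : ‖f.val t‖ ≤ ‖Path.val (A f) t‖ + ‖e.val t‖ := by rw [h1]; exact norm_add_le _ _
      have h5 : ∫ s in a..t, 2 * k s * ‖f.val s‖ ^ 2 = 2 * ∫ s in a..t, k s * ‖f.val s‖ ^ 2 := by
        rw [← intervalIntegral.integral_const_mul]; simp only [mul_assoc]
      rw [h5]
      have := norm_nonneg (f.val t); have := norm_nonneg (e.val t)
      have := norm_nonneg (Path.val (A f) t)
      nlinarith [sq_nonneg (‖Path.val (A f) t‖ - ‖e.val t‖)]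
  rw [intervalIntegral.integral_const_mul] at key
  have h0 : 0 ≤ 4 * ‖e‖ ^ 2 * Real.exp (4 * ∫ t in a..b, k t) := by positivity
  have hle : ‖f‖ ≤ √(4 * ‖e‖ ^ 2 * Real.exp (4 * ∫ t in a..b, k t)) := by
    refine Path.norm_le (Real.sqrt_nonneg _) fun t ht => Real.le_sqrt_of_sq_le ?_
    refine (key t ht).trans_eq ?_
    rw [abs_of_nonneg (by positivity)]; ring_nf
  calc ‖f‖ ^ 2 ≤ √(4 * ‖e‖ ^ 2 * Real.exp (4 * ∫ t in a..b, k t)) ^ 2 := by gcongr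
    _ = _ := Real.sq_sqrt h0

variable [CompleteSpace X]

/-- Conjugation by the weight `exp (2 ∫ k)` turns `A` into an operator of norm at most `1/2`,
whatever the size of `k`, and the Neumann series applies. -/
theorem IsVolterra.isUnit_one_sub (hA : IsVolterra k A) (hk : IntervalIntegrable k volume a b)
    (hk0 : ∀ t, 0 ≤ k t) : IsUnit (1 - A) := by
  have hp : IsPrim a b (fun x => ∫ t in a..x, k t) k := ⟨hk, by simp⟩
  have hc := hp.continuousOn hab.out
  let wt : ℝ → Path a b ℝ := fun c =>
    Path.mk (fun t => Real.exp (c * ∫ s in a..t, k s)) (by fun_prop)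
  let M : ℝ → Path a b X →L[ℝ] Path a b X := fun c => liftB (ContinuousLinearMap.lsmul ℝ ℝ) (wt c)
  have hM : ∀ c f, ∀ t ∈ Icc a b, Path.val (M c f) t = Real.exp (c * ∫ s in a..t, k s) • f.val t :=
    fun c f t ht => by
      rw [liftB_val, Path.val_mk _ ht]; rfl
  have hMM : ∀ c, M c * M (-c) = 1 := fun c => by
    ext f : 1
    refine Path.eq_of_val fun t ht => ?_
    change Path.val (M c (M (-c) f)) t = f.val t
    rw [hM _ _ t ht, hM _ _ t ht, smul_smul, ← Real.exp_add]
    simp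
  have hU : ∀ c, IsUnit (M c) := fun c =>
    ⟨⟨M c, M (-c), hMM c, by simpa using hMM (-c)⟩, rfl⟩
  have hn : ‖M (-2) * A * M 2‖ < 1 := by
    refine lt_of_le_of_lt (ContinuousLinearMap.opNorm_le_bound _ (M := 1 / 2) (by norm_num)
      fun f => ?_) (by norm_num)
    refine Path.norm_le (by positivity) fun t ht => ?_
    change ‖Path.val (M (-2) (A (M 2 f))) t‖ ≤ _
    rw [hM _ _ t ht, norm_smul, Real.norm_eq_abs, Real.abs_exp]
    have h1 := hA (M 2 f) t ht
    have h2 : ∫ s in a..t, k s * ‖Path.val (M 2 f) s‖ ^ 2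
        ≤ ∫ s in a..t, ‖f‖ ^ 2 * (k s * Real.exp (4 * ∫ r in a..s, k r)) := by
      have ha : a ∈ Icc a b := ⟨le_rfl, hab.out⟩
      have ik := hp.intervalIntegrable_of_mem ha ht
      have sub : uIcc a t ⊆ Icc a b := uIcc_subset_Icc ha ht
      refine intervalIntegral.integral_mono_on ht.1 (ik.mul_continuousOn (by fun_prop))
        ((ik.mul_continuousOn (by have := hc.mono sub; fun_prop)).const_mul _) fun s hs => ?_
      have h0 := hk0 s
      have h3 := f.norm_val_le s
      rw [hM _ _ s ⟨hs.1, hs.2.trans ht.2⟩, norm_smul, Real.norm_eq_abs, Real.abs_exp, mul_pow,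
        ← Real.exp_nat_mul]
      calc k s * (Real.exp ((2 : ℕ) * (2 * ∫ r in a..s, k r)) * ‖f.val s‖ ^ 2)
          ≤ k s * (Real.exp ((2 : ℕ) * (2 * ∫ r in a..s, k r)) * ‖f‖ ^ 2) := by gcongr
        _ = _ := by push_cast; ring_nf
    rw [intervalIntegral.integral_const_mul] at h2
    have h3 := integral_mul_exp_primitive_le hab.out hk (four_pos) ht
    have h4 : ‖Path.val (A (M 2 f)) t‖ ^ 2 ≤ (1 / 2 * ‖f‖ * Real.exp (2 * ∫ s in a..t, k s)) ^ 2 := by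
      refine (h1.trans h2).trans ((mul_le_mul_of_nonneg_left h3 (by positivity)).trans_eq ?_)
      rw [mul_pow, ← Real.exp_nat_mul]
      push_cast; ring_nf
    have h5 := (sq_le_sq₀ (norm_nonneg _) (by positivity)).mp h4
    calc _ ≤ Real.exp (-2 * ∫ s in a..t, k s) * (1 / 2 * ‖f‖ * Real.exp (2 * ∫ s in a..t, k s)) := by
          gcongr
      _ = 1 / 2 * ‖f‖ * (Real.exp (-2 * ∫ s in a..t, k s) * Real.exp (2 * ∫ s in a..t, k s)) := by
          ring
      _ = _ := by rw [← Real.exp_add]; simp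
  have e : 1 - A = M 2 * (1 - M (-2) * A * M 2) * M (-2) := by
    rw [mul_sub, sub_mul, mul_one, hMM]
    have : M 2 * (M (-2) * A * M 2) * M (-2) = (M 2 * M (-2)) * A * (M 2 * M (-2)) := by
      simp only [mul_assoc]
    rw [this, hMM, one_mul, mul_one]
  rw [e]
  exact ((hU 2).mul (isUnit_one_sub_of_norm_lt_one hn)).mul (hU (-2))

end Volterra

/-! ### An abstract cubic integral equation: stability, continuation, smooth dependence. -/

section Semilinear

variable (a b : ℝ) [hab : Fact (a ≤ b)] (X V : Type*) [NormedAddCommGroup X] [NormedSpace ℝ X]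
  [NormedAddCommGroup V] [NormedSpace ℝ V]

/-- Data of an integral equation `y = y₀ + E w₀ (N y y y) + E w₁ (A y) + E w₂ (B y)` with time weights
`w₀`, `w₁`, `w₂` in `L²`. -/
structure Semilinear where
  init : Path a b X
  E : L2 ℝ a b →L[ℝ] Path a b V →L[ℝ] Path a b X
  N : Path a b X →L[ℝ] Path a b X →L[ℝ] Path a b X →L[ℝ] Path a b V
  A : Path a b X →L[ℝ] Path a b V
  B : Path a b X →L[ℝ] Path a b V
  CE : ℝ
  CN : ℝ
  CL : ℝ
  CE_nonneg : 0 ≤ CE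
  CN_nonneg : 0 ≤ CN
  CL_nonneg : 0 ≤ CL
  norm_E : ∀ w f, ∀ t ∈ Icc a b, ‖Path.val (E w f) t‖ ^ 2 ≤ CE * ∫ s in a..t, w s ^ 2 * ‖f.val s‖ ^ 2
  norm_N : ∀ x y z t, ‖Path.val (N x y z) t‖ ≤ CN * ‖x.val t‖ * ‖y.val t‖ * ‖z.val t‖
  norm_A : ∀ x t, ‖Path.val (A x) t‖ ≤ CL * ‖x.val t‖
  norm_B : ∀ x t, ‖Path.val (B x) t‖ ≤ CL * ‖x.val t‖

variable {a b X V}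

/-- Triples of time weights. -/
abbrev Weights (a b : ℝ) := L2 ℝ a b × L2 ℝ a b × L2 ℝ a b

namespace Semilinear

variable (D : Semilinear a b X V)

/-- The integral operator, linear in the weights. -/
def op (y : Path a b X) : Weights a b →L[ℝ] Path a b X :=
  (D.E.flip (D.N y y y)).comp (.fst ℝ _ _) + (D.E.flip (D.A y)).comp (.comp (.fst ℝ _ _) (.snd ℝ _ _))
    + (D.E.flip (D.B y)).comp (.comp (.snd ℝ _ _) (.snd ℝ _ _))

theorem op_apply (y : Path a b X) (w : Weights a b) :
    D.op y w = D.E w.1 (D.N y y y) + D.E w.2.1 (D.A y) + D.E w.2.2 (D.B y) := rfl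

/-- The divided difference of the integral operator. -/
def diff (w : Weights a b) (x y : Path a b X) : Path a b X →L[ℝ] Path a b X :=
  (D.E w.1).comp ((D.N.flip x).flip x + (D.N y).flip x + D.N y y) + (D.E w.2.1).comp D.A
    + (D.E w.2.2).comp D.B

theorem diff_apply (w : Weights a b) (x y h : Path a b X) :
    D.diff w x y h = D.E w.1 (D.N h x x + D.N y h x + D.N y y h) + D.E w.2.1 (D.A h)
      + D.E w.2.2 (D.B h) := rfl

/-- The trilinear term telescopes. The divided difference is linear in its last argument, so one
Volterra estimate serves both the comparison of two solutions and, at `x = y`, the linearization. -/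
theorem op_sub_op (w : Weights a b) (x y : Path a b X) :
    D.op x w - D.op y w = D.diff w x y (x - y) := by
  simp only [op_apply, diff_apply, map_sub, map_add, sub_apply]
  abel

/-- The integrable kernel controlling the divided differences on a ball. -/
def kernel (w : Weights a b) (R : ℝ) (t : ℝ) : ℝ :=
  3 * D.CE * (9 * D.CN ^ 2 * R ^ 4 + D.CL ^ 2) * (w.1 t ^ 2 + (w.2.1 t ^ 2 + w.2.2 t ^ 2))

theorem kernel_nonneg (w : Weights a b) (R t : ℝ) : 0 ≤ D.kernel w R t := by
  have := D.CE_nonneg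
  unfold kernel; positivity

theorem intervalIntegrable_sq (w : L2 ℝ a b) : IntervalIntegrable (fun t => w t ^ 2) volume a b := by
  have := intervalIntegrable_norm_sq_L2 w
  simpa using this

theorem integral_sq (w : L2 ℝ a b) : ∫ t in a..b, w t ^ 2 = ‖w‖ ^ 2 := by
  rw [norm_sq_L2]; simp

theorem intervalIntegrable_kernel (w : Weights a b) (R : ℝ) :
    IntervalIntegrable (D.kernel w R) volume a b :=
  ((intervalIntegrable_sq w.1).add
    ((intervalIntegrable_sq w.2.1).add (intervalIntegrable_sq w.2.2))).const_mul _

theorem integral_kernel (w : Weights a b) (R : ℝ) :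
    ∫ t in a..b, D.kernel w R t = 3 * D.CE * (9 * D.CN ^ 2 * R ^ 4 + D.CL ^ 2)
      * (‖w.1‖ ^ 2 + (‖w.2.1‖ ^ 2 + ‖w.2.2‖ ^ 2)) := by
  unfold kernel
  rw [intervalIntegral.integral_const_mul, intervalIntegral.integral_add
    (intervalIntegrable_sq w.1) ((intervalIntegrable_sq w.2.1).add (intervalIntegrable_sq w.2.2)),
    intervalIntegral.integral_add (intervalIntegrable_sq w.2.1) (intervalIntegrable_sq w.2.2),
    integral_sq, integral_sq, integral_sq]

/-- Each contribution is estimated by `norm_E`. In the kernel, `9` comes from the square of the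
three trilinear terms, each at most `CN R² ‖h‖`, and `3` from the square of the sum of the three
weighted contributions. -/
theorem isVolterra_diff (w : Weights a b) {x y : Path a b X} {R : ℝ} (hx : ‖x‖ ≤ R) (hy : ‖y‖ ≤ R) :
    IsVolterra (D.kernel w R) (D.diff w x y) := by
  intro h t ht
  have hE0 := D.CE_nonneg
  have hN0 := D.CN_nonneg
  have hL0 := D.CL_nonneg
  have hR : 0 ≤ R := (norm_nonneg _).trans hx
  set c := 9 * D.CN ^ 2 * R ^ 4 + D.CL ^ 2 with hc
  have ha : a ∈ Icc a b := ⟨le_rfl, hab.out⟩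
  have ii : ∀ w : L2 ℝ a b, IntervalIntegrable (fun s => w s ^ 2 * ‖h.val s‖ ^ 2) volume a t := fun w =>
    ((IntervalIntegrable.mono_set (intervalIntegrable_sq w) (by
      rw [uIcc_of_le hab.out]; exact uIcc_subset_Icc ha ht))).mul_continuousOn (by fun_prop)
  have main : ∀ (w : L2 ℝ a b) (f : Path a b V), (∀ s, ‖f.val s‖ ^ 2 ≤ c * ‖h.val s‖ ^ 2) →
      ‖Path.val (D.E w f) t‖ ^ 2 ≤ D.CE * c * ∫ s in a..t, w s ^ 2 * ‖h.val s‖ ^ 2 := fun w f hf => by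
    refine (D.norm_E w f t ht).trans ?_
    rw [mul_assoc]
    refine mul_le_mul_of_nonneg_left ?_ hE0
    rw [← intervalIntegral.integral_const_mul]
    refine intervalIntegral.integral_mono_on ht.1 ?_ ((ii w).const_mul _) fun s _ => ?_
    · exact ((IntervalIntegrable.mono_set (intervalIntegrable_sq w) (by
        rw [uIcc_of_le hab.out]; exact uIcc_subset_Icc ha ht))).mul_continuousOn (by fun_prop)
    · calc w s ^ 2 * ‖f.val s‖ ^ 2 ≤ w s ^ 2 * (c * ‖h.val s‖ ^ 2) := by gcongr; exact hf s
        _ = _ := by ring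
  have lin : ∀ G : Path a b X →L[ℝ] Path a b V, (∀ x t, ‖Path.val (G x) t‖ ≤ D.CL * ‖x.val t‖) →
      ∀ s, ‖Path.val (G h) s‖ ^ 2 ≤ c * ‖h.val s‖ ^ 2 := fun G hG s => by
    calc ‖Path.val (G h) s‖ ^ 2 ≤ (D.CL * ‖h.val s‖) ^ 2 := by gcongr; exact hG h s
      _ = D.CL ^ 2 * ‖h.val s‖ ^ 2 := by ring
      _ ≤ _ := by
        refine mul_le_mul_of_nonneg_right ?_ (by positivity)
        rw [hc]
        have : 0 ≤ 9 * D.CN ^ 2 * R ^ 4 := by positivity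
        linarith
  have m1 := main w.1 (D.N h x x + D.N y h x + D.N y y h) fun s => by
    have n1 : ‖x.val s‖ ≤ R := (x.norm_val_le s).trans hx
    have n2 : ‖y.val s‖ ≤ R := (y.norm_val_le s).trans hy
    have b1 : ‖Path.val (D.N h x x) s‖ ≤ D.CN * R ^ 2 * ‖h.val s‖ := (D.norm_N h x x s).trans (by
      calc _ ≤ D.CN * ‖h.val s‖ * R * R := by gcongr
        _ = _ := by ring)
    have b2 : ‖Path.val (D.N y h x) s‖ ≤ D.CN * R ^ 2 * ‖h.val s‖ := (D.norm_N y h x s).trans (by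
      calc _ ≤ D.CN * R * ‖h.val s‖ * R := by gcongr
        _ = _ := by ring)
    have b3 : ‖Path.val (D.N y y h) s‖ ≤ D.CN * R ^ 2 * ‖h.val s‖ := (D.norm_N y y h s).trans (by
      calc _ ≤ D.CN * R * R * ‖h.val s‖ := by gcongr
        _ = _ := by ring)
    have b4 : ‖Path.val (D.N h x x + D.N y h x + D.N y y h) s‖ ≤ 3 * (D.CN * R ^ 2 * ‖h.val s‖) := by
      change ‖Path.val (D.N h x x) s + Path.val (D.N y h x) s + Path.val (D.N y y h) s‖ ≤ _
      refine (norm_add₃_le).trans ?_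
      linarith
    calc _ ≤ (3 * (D.CN * R ^ 2 * ‖h.val s‖)) ^ 2 := by gcongr
      _ = 9 * D.CN ^ 2 * R ^ 4 * ‖h.val s‖ ^ 2 := by ring
      _ ≤ _ := by
        refine mul_le_mul_of_nonneg_right ?_ (by positivity)
        rw [hc]
        have : 0 ≤ D.CL ^ 2 := by positivity
        linarith
  have m2 := main w.2.1 (D.A h) (lin D.A D.norm_A)
  have m3 := main w.2.2 (D.B h) (lin D.B D.norm_B)
  have e : ∫ s in a..t, D.kernel w R s * ‖h.val s‖ ^ 2
      = 3 * (D.CE * c * (∫ s in a..t, w.1 s ^ 2 * ‖h.val s‖ ^ 2)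
        + D.CE * c * (∫ s in a..t, w.2.1 s ^ 2 * ‖h.val s‖ ^ 2)
        + D.CE * c * ∫ s in a..t, w.2.2 s ^ 2 * ‖h.val s‖ ^ 2) := by
    rw [← mul_add, ← mul_add, ← intervalIntegral.integral_add (ii _) (ii _),
      ← intervalIntegral.integral_add ((ii _).add (ii _)) (ii _), ← mul_assoc,
      ← intervalIntegral.integral_const_mul]
    congr 1
    funext s
    simp only [kernel, ← hc]; ring
  rw [e, diff_apply]
  change ‖Path.val (D.E w.1 (D.N h x x + D.N y h x + D.N y y h)) t + Path.val (D.E w.2.1 (D.A h)) t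
    + Path.val (D.E w.2.2 (D.B h)) t‖ ^ 2 ≤ _
  set p := Path.val (D.E w.1 (D.N h x x + D.N y h x + D.N y y h)) t
  set q := Path.val (D.E w.2.1 (D.A h)) t
  set r := Path.val (D.E w.2.2 (D.B h)) t
  calc ‖p + q + r‖ ^ 2 ≤ (‖p‖ + ‖q‖ + ‖r‖) ^ 2 := by gcongr; exact norm_add₃_le
    _ ≤ 3 * (‖p‖ ^ 2 + ‖q‖ ^ 2 + ‖r‖ ^ 2) := by
      nlinarith [sq_nonneg (‖p‖ - ‖q‖), sq_nonneg (‖p‖ - ‖r‖), sq_nonneg (‖q‖ - ‖r‖)]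
    _ ≤ _ := by linarith

/-- `y` solves the integral equation with weights `w`. -/
def Solves (w : Weights a b) (y : Path a b X) : Prop := y = D.init + D.op y w

theorem norm_op_le {y : Path a b X} {R : ℝ} (hy : ‖y‖ ≤ R) (w : Weights a b) :
    ‖D.op y w‖ ≤ ‖D.E‖ * (D.CN * R ^ 3 + ‖D.A‖ * R + ‖D.B‖ * R) * ‖w‖ := by
  have hR : 0 ≤ R := (norm_nonneg _).trans hy
  have n1 : ‖w.1‖ ≤ ‖w‖ := norm_fst_le w
  have n2 : ‖w.2.1‖ ≤ ‖w‖ := (norm_fst_le w.2).trans (norm_snd_le w)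
  have n3 : ‖w.2.2‖ ≤ ‖w‖ := (norm_snd_le w.2).trans (norm_snd_le w)
  have m1 : ‖D.N y y y‖ ≤ D.CN * R ^ 3 := by
    have hN0 := D.CN_nonneg
    refine Path.norm_le (by positivity) fun t _ => (D.norm_N y y y t).trans ?_
    have := (y.norm_val_le t).trans hy
    calc _ ≤ D.CN * R * R * R := by gcongr
      _ = _ := by ring
  have m2 : ‖D.A y‖ ≤ ‖D.A‖ * R := D.A.le_opNorm_of_le hy
  have m3 : ‖D.B y‖ ≤ ‖D.B‖ * R := D.B.le_opNorm_of_le hy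
  have key : ∀ (v : L2 ℝ a b) (f : Path a b V) (c : ℝ), ‖v‖ ≤ ‖w‖ → ‖f‖ ≤ c →
      ‖D.E v f‖ ≤ ‖D.E‖ * ‖w‖ * c := fun v f c hv hf =>
    (D.E.le_opNorm₂ v f).trans (by gcongr)
  have k1 := key _ _ _ n1 m1
  have k2 := key _ _ _ n2 m2
  have k3 := key _ _ _ n3 m3
  rw [op_apply]
  refine norm_add₃_le.trans ?_
  linarith

/-- The difference solves a linear Volterra equation with source `op y (w - v)`. Uniqueness is the
case `w = v`; in general this is Lipschitz dependence on the weights. -/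
theorem Solves.norm_sub_le {w v : Weights a b} {x y : Path a b X} (hx : D.Solves w x)
    (hy : D.Solves v y) {R : ℝ} (hxR : ‖x‖ ≤ R) (hyR : ‖y‖ ≤ R) :
    ‖x - y‖ ^ 2 ≤ 4 * ‖D.op y (w - v)‖ ^ 2 * Real.exp (4 * ∫ t in a..b, D.kernel w R t) := by
  refine (D.isVolterra_diff w hxR hyR).norm_le (D.intervalIntegrable_kernel w R)
    (D.kernel_nonneg w R) ?_
  rw [← op_sub_op, map_sub]
  have h1 : x = D.init + D.op x w := hx
  have h2 : y = D.init + D.op y v := hy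
  calc x - y = (D.init + D.op x w) - (D.init + D.op y v) := by rw [← h1, ← h2]
    _ = _ := by abel

theorem Solves.unique {w : Weights a b} {x y : Path a b X} (hx : D.Solves w x)
    (hy : D.Solves w y) : x = y := by
  have := Solves.norm_sub_le D hx hy (le_max_left ‖x‖ ‖y‖) (le_max_right _ _)
  simp only [sub_self, map_zero, norm_zero] at this
  have h0 : ‖x - y‖ ^ 2 ≤ 0 := by simpa using this
  have := pow_eq_zero_iff (two_ne_zero) |>.mp (le_antisymm h0 (by positivity))
  exact sub_eq_zero.mp (norm_eq_zero.mp this)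

variable [CompleteSpace X]

/-- The map whose zeros solve the integral equation. -/
def defect (p : Weights a b × Path a b X) : Path a b X := p.2 - D.init - D.op p.2 p.1

theorem defect_eq_zero {w : Weights a b} {y : Path a b X} : D.defect (w, y) = 0 ↔ D.Solves w y := by
  rw [defect, Solves, sub_sub, sub_eq_zero]

set_option maxSynthPendingDepth 6 in
theorem contDiff_defect : ContDiff ℝ 1 D.defect := by
  have h1 : ContDiff ℝ 1 fun p : Weights a b × Path a b X => p.2 := contDiff_snd
  have hN : ContDiff ℝ 1 fun y => D.N y := ContinuousLinearMap.contDiff (𝕜 := ℝ) D.N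
  have h2 : ContDiff ℝ 1 fun p : Weights a b × Path a b X => D.N p.2 p.2 p.2 :=
    ((ContDiff.comp (g := fun y => D.N y) hN h1).clm_apply h1).clm_apply h1
  have hw0 : ContDiff ℝ 1 fun p : Weights a b × Path a b X => p.1.1 := by fun_prop
  have hw1 : ContDiff ℝ 1 fun p : Weights a b × Path a b X => p.1.2.1 := by fun_prop
  have hw2 : ContDiff ℝ 1 fun p : Weights a b × Path a b X => p.1.2.2 := by fun_prop
  unfold defect
  simp only [op_apply]
  exact (h1.sub contDiff_const).sub ((((D.E.contDiff.comp hw0).clm_apply h2).add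
    ((D.E.contDiff.comp hw1).clm_apply (D.A.contDiff.comp h1))).add
    ((D.E.contDiff.comp hw2).clm_apply (D.B.contDiff.comp h1)))

theorem hasFDerivAt_defect_snd (w : Weights a b) (y : Path a b X) :
    HasFDerivAt (fun y => D.defect (w, y)) (1 - D.diff w y y) y := by
  have hid : HasFDerivAt (fun y : Path a b X => y) (.id ℝ _) y := hasFDerivAt_id y
  have h2 := (D.N.hasFDerivAt (x := y)).clm_apply hid |>.clm_apply hid
  have h3 := (((D.E w.1).hasFDerivAt.comp y h2).add (((D.E w.2.1).comp D.A).hasFDerivAt)).add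
    (((D.E w.2.2).comp D.B).hasFDerivAt)
  have h4 : HasFDerivAt (fun y => D.defect (w, y)) _ y := (hid.sub_const D.init).sub h3
  refine h4.congr_fderiv ?_
  ext h : 1
  change h - (D.E w.1 (D.N y y h + (D.N y h y + D.N h y y)) + D.E w.2.1 (D.A h) + D.E w.2.2 (D.B h))
    = h - D.diff w y y h
  rw [diff_apply, add_comm (D.N y y h), add_comm (D.N y h y)]

theorem hasFDerivAt_defect_fst (w : Weights a b) (y : Path a b X) :
    HasFDerivAt (fun w => D.defect (w, y)) (-D.op y) w :=
  (D.op y).hasFDerivAt.const_sub (y - D.init)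

theorem fderiv_defect (w : Weights a b) (y : Path a b X) (p : Weights a b × Path a b X) :
    fderiv ℝ D.defect (w, y) p = p.2 - D.diff w y y p.2 - D.op y p.1 := by
  have hd : HasFDerivAt D.defect (fderiv ℝ D.defect (w, y)) (w, y) :=
    (D.contDiff_defect.differentiable (by norm_num) _).hasFDerivAt
  have h1 := (hd.comp y (hasFDerivAt_prodMk_right w y)).unique (D.hasFDerivAt_defect_snd w y)
  have h2 := (HasFDerivAt.comp (g := D.defect) (f := fun e => (e, y)) w hd
    (hasFDerivAt_prodMk_left w y)).unique (D.hasFDerivAt_defect_fst w y)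
  have e : p = ContinuousLinearMap.inl ℝ _ _ p.1 + ContinuousLinearMap.inr ℝ _ _ p.2 := by simp
  have e1 := DFunLike.congr_fun h1 p.2
  have e2 := DFunLike.congr_fun h2 p.1
  rw [e, map_add]
  change _ = -(D.op y p.1) at e2
  change _ = p.2 - D.diff w y y p.2 at e1
  rw [ContinuousLinearMap.comp_apply] at e1 e2
  rw [e1, e2]
  simp
  abel

/-- The partial derivative in the path is `1` minus a Volterra operator. This is the hypothesis of
the implicit function theorem, and it holds at every point without smallness. -/
theorem isInvertible_fderiv_defect (w : Weights a b) (y : Path a b X) :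
    (fderiv ℝ D.defect (w, y) ∘L .inr ℝ _ _).IsInvertible := by
  obtain ⟨U, hU⟩ := (D.isVolterra_diff w le_rfl le_rfl (x := y) (y := y)).isUnit_one_sub
    (D.intervalIntegrable_kernel w _) (D.kernel_nonneg w _)
  refine ⟨ContinuousLinearEquiv.unitsEquiv ℝ _ U, ?_⟩
  ext h : 1
  change (U : Path a b X →L[ℝ] Path a b X) h = fderiv ℝ D.defect (w, y) (0, h)
  rw [hU, fderiv_defect]
  simp

theorem exists_isOpen_solves {w : Weights a b} {y : Path a b X} (h : D.Solves w y) :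
    ∃ φ : Weights a b → Path a b X, ContDiffAt ℝ 1 φ w ∧ ∀ᶠ v in nhds w, D.Solves v (φ v) := by
  have hc : ContDiffAt ℝ 1 D.defect (w, y) := D.contDiff_defect.contDiffAt
  have hi := D.isInvertible_fderiv_defect w y
  refine ⟨hc.implicitFunction (by norm_num) hi, hc.contDiffAt_implicitFunction (by norm_num) hi, ?_⟩
  filter_upwards [hc.eventually_apply_implicitFunction (by norm_num) hi] with v hv
  rw [D.defect_eq_zero.mpr h] at hv
  exact D.defect_eq_zero.mp hv

/-- On a ball, solutions depend on the weights in a Lipschitz way, so those of a convergent sequence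
of weights form a Cauchy sequence. This is the closedness in the continuation argument. -/
theorem solves_of_tendsto {w : ℕ → Weights a b} {y : ℕ → Path a b X} {v : Weights a b} {R : ℝ}
    (h : ∀ n, D.Solves (w n) (y n)) (hR : ∀ n, ‖y n‖ ≤ R) (hw : Filter.Tendsto w .atTop (nhds v)) :
    ∃ x, D.Solves v x := by
  have hR0 : 0 ≤ R := (norm_nonneg _).trans (hR 0)
  obtain ⟨M, hM⟩ := hw.norm.bddAbove_range
  have hM : ∀ n, ‖w n‖ ≤ M := fun n => hM ⟨n, rfl⟩
  have hM0 : 0 ≤ M := (norm_nonneg _).trans (hM 0)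
  have hE0 := D.CE_nonneg
  obtain ⟨c, hc0, hc⟩ : ∃ c, 0 ≤ c ∧ ∀ n m, ‖y n - y m‖ ≤ c * ‖w n - w m‖ := by
    set κ := 3 * D.CE * (9 * D.CN ^ 2 * R ^ 4 + D.CL ^ 2) * (M ^ 2 + (M ^ 2 + M ^ 2)) with hκ
    set d := ‖D.E‖ * (D.CN * R ^ 3 + ‖D.A‖ * R + ‖D.B‖ * R)
    have hd : 0 ≤ d := by have := D.CN_nonneg; positivity
    refine ⟨2 * d * Real.exp (2 * κ), by positivity, fun n m => ?_⟩
    have h1 := Solves.norm_sub_le D (h n) (h m) (hR n) (hR m)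
    have h2 := D.norm_op_le (hR m) (w n - w m)
    have h3 : ∫ t in a..b, D.kernel (w n) R t ≤ κ := by
      rw [integral_kernel, hκ]
      have n1 : ‖(w n).1‖ ≤ M := (norm_fst_le _).trans (hM n)
      have n2 : ‖(w n).2.1‖ ≤ M := (norm_fst_le _).trans ((norm_snd_le _).trans (hM n))
      have n3 : ‖(w n).2.2‖ ≤ M := (norm_snd_le _).trans ((norm_snd_le _).trans (hM n))
      gcongr
    refine (sq_le_sq₀ (norm_nonneg _) (by positivity)).mp (h1.trans ?_)
    calc _ ≤ 4 * (d * ‖w n - w m‖) ^ 2 * Real.exp (4 * κ) := by gcongr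
      _ = _ := by
        have : Real.exp (4 * κ) = Real.exp (2 * κ) ^ 2 := by rw [← Real.exp_nat_mul]; push_cast; ring_nf
        rw [this]; ring
  have hy : CauchySeq y := by
    have hwc := hw.cauchySeq
    rw [Metric.cauchySeq_iff'] at hwc ⊢
    intro ε hε
    obtain ⟨N, hN⟩ := hwc (ε / (c + 1)) (by positivity)
    refine ⟨N, fun n hn => ?_⟩
    have h1 := hN n hn
    rw [dist_eq_norm] at h1 ⊢
    rw [lt_div_iff₀ (by positivity)] at h1
    have := norm_nonneg (w n - w N)
    nlinarith [hc n N]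
  obtain ⟨x, hx⟩ := cauchySeq_tendsto_of_complete hy
  refine ⟨x, D.defect_eq_zero.mp ?_⟩
  have h1 := (D.contDiff_defect.continuous.tendsto (v, x)).comp (hw.prodMk_nhds hx)
  refine tendsto_nhds_unique h1 ?_
  have : (D.defect ∘ fun n => (w n, y n)) = fun _ => 0 := funext fun n => D.defect_eq_zero.mpr (h n)
  rw [this]
  exact tendsto_const_nhds

/-- Global solvability along a family of weights with an a priori bound, and smooth dependence. -/
theorem exists_contDiff_solves {P : Type*} [NormedAddCommGroup P] [NormedSpace ℝ P]
    {W : P → Weights a b} (hW : ContDiff ℝ 1 W)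
    (bound : ∀ r, ∃ R, ∀ p, ‖p‖ ≤ r → ∀ y, D.Solves (W p) y → ‖y‖ ≤ R) {p₀ : P} {y₀ : Path a b X}
    (h₀ : D.Solves (W p₀) y₀) :
    ∃ y : P → Path a b X, (∀ p, D.Solves (W p) (y p)) ∧ ContDiff ℝ 1 y ∧
      ∀ p q, fderiv ℝ y p q
        = D.diff (W p) (y p) (y p) (fderiv ℝ y p q) + D.op (y p) (fderiv ℝ W p q) := by
  have all : ∀ p, ∃ y, D.Solves (W p) y := by
    set A : Set P := {p | ∃ y, D.Solves (W p) y}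
    -- The solvable parameters form a clopen set in a connected space: closed by the a priori bound,
    -- open by the implicit function theorem.
    have hA : IsClopen A := by
      refine ⟨IsSeqClosed.isClosed fun p q hp hq => ?_, isOpen_iff_mem_nhds.mpr ?_⟩
      · choose y hy using hp
        obtain ⟨r, hr⟩ := hq.norm.bddAbove_range
        obtain ⟨R, hR⟩ := bound r
        exact D.solves_of_tendsto hy (fun n => hR (p n) (hr ⟨n, rfl⟩) _ (hy n))
          ((hW.continuous.tendsto q).comp hq)
      · rintro p ⟨y, hy⟩
        obtain ⟨φ, -, h⟩ := D.exists_isOpen_solves hy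
        filter_upwards [(hW.continuous.tendsto p).eventually h] with q hq using ⟨_, hq⟩
    have := hA.eq_univ ⟨p₀, y₀, h₀⟩
    intro p
    have hp : p ∈ A := this ▸ mem_univ p
    exact hp
  choose y hy using all
  have hd : ContDiff ℝ 1 y := by
    refine contDiff_iff_contDiffAt.mpr fun p => ?_
    obtain ⟨φ, hφ, h⟩ := D.exists_isOpen_solves (hy p)
    -- By uniqueness the global solution map agrees near `p` with the implicit function.
    refine (hφ.comp p hW.contDiffAt).congr_of_eventuallyEq ?_
    filter_upwards [(hW.continuous.tendsto p).eventually h] with q hq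
    exact Solves.unique D (hy q) hq
  refine ⟨y, hy, hd, fun p q => ?_⟩
  have dW : HasFDerivAt W (fderiv ℝ W p) p := (hW.differentiable (by norm_num) p).hasFDerivAt
  have dy : HasFDerivAt y (fderiv ℝ y p) p := (hd.differentiable (by norm_num) p).hasFDerivAt
  have dd : HasFDerivAt D.defect (fderiv ℝ D.defect (W p, y p)) (W p, y p) :=
    (D.contDiff_defect.differentiable (by norm_num) _).hasFDerivAt
  have h1 : HasFDerivAt (fun p => D.defect (W p, y p)) _ p :=
    HasFDerivAt.comp (g := D.defect) (f := fun p => (W p, y p)) p dd (dW.prodMk dy)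
  -- The defect vanishes identically along the solution map; differentiating this identity gives the
  -- linearized equation.
  have h2 : (fun p => D.defect (W p, y p)) = fun _ => 0 := funext fun p => D.defect_eq_zero.mpr (hy p)
  rw [h2] at h1
  have h3 := DFunLike.congr_fun (h1.unique (hasFDerivAt_const 0 p)) q
  change fderiv ℝ D.defect (W p, y p) (fderiv ℝ W p q, fderiv ℝ y p q) = 0 at h3
  rw [fderiv_defect, sub_sub, sub_eq_zero] at h3
  exact h3

end Semilinear
end Semilinear

/-! ### The Duhamel operator and its smoothing effect. -/

section Duhamel

/-- The functional `lam k` as a continuous linear map. -/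
def lamL (k : ℕ) : Z →L[ℂ] ℂ :=
  (lp.evalCLM ℂ (fun _ : ℕ => ℂ) 2 k) ∘L coeffs ∘L (.snd ℂ K _ ∘L .snd ℂ K _ ∘L .snd ℂ K _)
    - (√2 : ℂ) • (((Real.cos (freq k) : ℝ) : ℂ) • (evK 1 ∘L (.fst ℂ K _ ∘L .snd ℂ K _ ∘L .snd ℂ K _))
      - (evK 0 ∘L (.fst ℂ K _ ∘L .snd ℂ K _ ∘L .snd ℂ K _)))

theorem lamL_apply (k : ℕ) (z : Z) : lamL k z = lam k z := rfl

@[fun_prop]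
theorem continuous_lam (k : ℕ) : Continuous (lam k) := (lamL k).continuous

variable {T : ℝ} [hT : Fact (0 ≤ T)]

theorem intervalIntegrable_L2_mul (w : L2 ℝ 0 T) {f : ℝ → ℂ} (hf : Continuous f) {x y : ℝ} (hx : 0 ≤ x)
    (hxy : x ≤ y) (hy : y ≤ T) : IntervalIntegrable (fun s => (w s : ℂ) * f s) volume x y := by
  have h1 : IntervalIntegrable (fun s => (w s : ℂ)) volume 0 T := by
    have := intervalIntegrable_L2 w
    exact ⟨this.1.ofReal, this.2.ofReal⟩
  refine (h1.mono_set ?_).mul_continuousOn hf.continuousOn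
  rw [uIcc_of_le hxy, uIcc_of_le hT.out]
  exact Icc_subset_Icc hx hy

theorem intervalIntegrable_sq_mul (w : L2 ℝ 0 T) {f : ℝ → ℝ} (hf : Continuous f) {x y : ℝ} (hx : 0 ≤ x)
    (hxy : x ≤ y) (hy : y ≤ T) : IntervalIntegrable (fun s => w s ^ 2 * f s) volume x y := by
  refine ((Semilinear.intervalIntegrable_sq w).mono_set ?_).mul_continuousOn hf.continuousOn
  rw [uIcc_of_le hxy, uIcc_of_le hT.out]
  exact Icc_subset_Icc hx hy

theorem memLp_L2_mul (w : L2 ℝ 0 T) {f : ℝ → ℂ} (hf : Continuous f) {x y : ℝ} (hx : 0 ≤ x)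
    (hxy : x ≤ y) (hy : y ≤ T) : MemLp (fun s => (w s : ℂ) * f s) 2 (volume.restrict (Ioc x y)) := by
  have h0 : MemLp w 2 (volume.restrict (Ioc (0 : ℝ) T)) := by
    rw [← restrict_Ioo_eq_restrict_Ioc]; exact Lp.memLp w
  have h1 : MemLp (fun s => (w s : ℂ)) 2 (volume.restrict (Ioc x y)) :=
    (h0.mono_measure (Measure.restrict_mono (Ioc_subset_Ioc hx hy) le_rfl)).ofReal
  obtain ⟨C, hC⟩ := (isCompact_Icc (a := x) (b := y)).exists_bound_of_continuousOn hf.continuousOn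
  refine h1.of_le_mul (c := C) (h1.1.mul hf.aestronglyMeasurable) ?_
  filter_upwards [ae_restrict_mem measurableSet_Ioc] with s hs
  rw [norm_mul, mul_comm]
  gcongr
  exact hC s (Ioc_subset_Icc_self hs)

/-- The constant in the energy estimate of the Duhamel operator. -/
def duhC (T : ℝ) : ℝ := 3 * (T + 4 * period T)

theorem duhC_nonneg : 0 ≤ duhC T := by
  have := period_pos T
  have := hT.out
  unfold duhC; linarith

theorem norm_lam_parts (f : Z) : ‖coeffs f.2.2.2‖ ≤ ‖f‖ ∧ (∀ x, ‖ext f.2.2.1 x‖ ≤ ‖f‖) := by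
  have h2 : ‖f.2.2‖ ≤ ‖f‖ := (norm_snd_le f.2).trans (norm_snd_le f)
  exact ⟨(norm_coeffs_le _).trans ((norm_snd_le f.2.2).trans h2),
    fun x => (norm_ext_le _ x).trans ((norm_fst_le f.2.2).trans h2)⟩

/-- For a forcing whose coordinates are in `ℓ²` no oscillation is needed: Cauchy-Schwarz in time for
each coordinate, then summation under the integral. -/
theorem sum_norm_integral_coord_sq_le (w : L2 ℝ 0 T) {c : ℝ → H} (hc : Continuous c) {x y : ℝ}
    (hx : 0 ≤ x) (hxy : x ≤ y) (hy : y ≤ T) (s : Finset ℕ) :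
    ∑ k ∈ s, ‖∫ t in x..y, (w t : ℂ) * (osc k (-t) * c t k)‖ ^ 2
      ≤ T * ∫ t in x..y, w t ^ 2 * ‖c t‖ ^ 2 := by
  have cr : ∀ k, Continuous fun t => c t k := fun k =>
    (lp.evalCLM ℂ (fun _ : ℕ => ℂ) 2 k).continuous.comp hc
  have icr : ∀ k, IntervalIntegrable (fun t => w t ^ 2 * ‖c t k‖ ^ 2) volume x y :=
    fun k => intervalIntegrable_sq_mul w ((cr k).norm.pow 2) hx hxy hy
  have h1 : ∀ k, ‖∫ t in x..y, (w t : ℂ) * (osc k (-t) * c t k)‖ ^ 2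
      ≤ T * ∫ t in x..y, w t ^ 2 * ‖c t k‖ ^ 2 := fun k => by
    have cc : Continuous fun t => osc k (-t) * c t k :=
      (by fun_prop : Continuous fun t => osc k (-t)).mul (cr k)
    have i1 := intervalIntegrable_L2_mul w cc hx hxy hy
    have e : ∀ t, ‖(w t : ℂ) * (osc k (-t) * c t k)‖ ^ 2
        = w t ^ 2 * ‖c t k‖ ^ 2 := fun t => by
      rw [norm_mul, norm_mul, norm_osc, one_mul, mul_pow, Complex.norm_real, Real.norm_eq_abs, sq_abs]
    have := sq_integral_le_mul_integral_sq hxy i1.norm (by simp_rw [e]; exact icr k)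
    simp_rw [e] at this
    calc _ ≤ (∫ t in x..y, ‖(w t : ℂ) * (osc k (-t) * c t k)‖) ^ 2 := by
          gcongr
          exact intervalIntegral.norm_integral_le_integral_norm hxy
      _ ≤ _ := this
      _ ≤ _ := by
        refine mul_le_mul_of_nonneg_right (by linarith) ?_
        exact intervalIntegral.integral_nonneg hxy fun t _ => by positivity
  calc _ ≤ ∑ k ∈ s, T * ∫ t in x..y, w t ^ 2 * ‖c t k‖ ^ 2 :=
        Finset.sum_le_sum fun k _ => h1 k
    _ = T * ∫ t in x..y, ∑ k ∈ s, w t ^ 2 * ‖c t k‖ ^ 2 := by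
        rw [← Finset.mul_sum, ← intervalIntegral.integral_finsetSum fun k _ => icr k]
    _ ≤ _ := by
        refine mul_le_mul_of_nonneg_left ?_ hT.out
        refine intervalIntegral.integral_mono_on hxy ?_
          (intervalIntegrable_sq_mul w (hc.norm.pow 2) hx hxy hy) fun t _ => ?_
        · have := IntervalIntegrable.sum s (f := fun k t => w t ^ 2 * ‖c t k‖ ^ 2)
            fun k _ => icr k
          convert! this using 1
          ext t; simp
        · rw [← Finset.mul_sum]
          simp only [Pi.pow_apply]
          gcongr
          refine ((summable_sq_H _).sum_le_tsum s fun k _ => by positivity).trans ?_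
          rw [← norm_sq_H]

/-- The smoothing effect. In `lam`, the coefficients of the third derivative are in `ℓ²` at each
time. The boundary values of the second derivative do not depend on `k` except for a bounded factor,
so they are not; but their time integrals against `osc k` are Fourier coefficients of the `L²`
functions `w(t) f''(t, z)`, `z = 0, 1`, and Bessel's inequality bounds the sum. -/
theorem sum_norm_duhamel_sq_le (w : L2 ℝ 0 T) (f : Path 0 T Z) {x y : ℝ} (hx : 0 ≤ x) (hxy : x ≤ y)
    (hy : y ≤ T) (s : Finset ℕ) :
    ∑ k ∈ s, ‖∫ t in x..y, (w t : ℂ) * (osc k (-t) * lam k (f.val t))‖ ^ 2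
      ≤ duhC T * ∫ t in x..y, w t ^ 2 * ‖f.val t‖ ^ 2 := by
  set I := ∫ t in x..y, w t ^ 2 * ‖f.val t‖ ^ 2 with hI
  have c3 : Continuous fun t => coeffs (f.val t).2.2.2 := by fun_prop
  have cr : ∀ k, Continuous fun t => coeffs (f.val t).2.2.2 k := fun k =>
    (lp.evalCLM ℂ (fun _ : ℕ => ℂ) 2 k).continuous.comp c3
  have cb : ∀ z : ℝ, Continuous fun t => ext (f.val t).2.2.1 z := fun z =>
    (evK z).continuous.comp (by fun_prop : Continuous fun t => (f.val t).2.2.1)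
  have iI : IntervalIntegrable (fun t => w t ^ 2 * ‖f.val t‖ ^ 2) volume x y :=
    intervalIntegrable_sq_mul w (by fun_prop) hx hxy hy
  set A : ℕ → ℂ := fun k => ∫ t in x..y, (w t : ℂ) * (osc k (-t) * coeffs (f.val t).2.2.2 k)
  set B : ℝ → ℕ → ℂ := fun z k => ∫ t in x..y, osc k (-t) * ((w t : ℂ) * ext (f.val t).2.2.1 z)
  have hA : ∑ k ∈ s, ‖A k‖ ^ 2 ≤ T * I := by
    refine (sum_norm_integral_coord_sq_le w c3 hx hxy hy s).trans ?_
    refine mul_le_mul_of_nonneg_left ?_ hT.out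
    refine intervalIntegral.integral_mono_on hxy
      (intervalIntegrable_sq_mul w (c3.norm.pow 2) hx hxy hy) iI fun t _ => ?_
    have := (norm_lam_parts (f.val t)).1
    gcongr
  have hB : ∀ z, ∑ k ∈ s, ‖B z k‖ ^ 2 ≤ period T * I := fun z => by
    refine (sum_norm_integral_osc_sq_le hx hxy hy (memLp_L2_mul w (cb z) hx hxy hy) s).trans ?_
    refine mul_le_mul_of_nonneg_left ?_ (period_pos T).le
    have e : ∀ t, ‖(w t : ℂ) * ext (f.val t).2.2.1 z‖ ^ 2 = w t ^ 2 * ‖ext (f.val t).2.2.1 z‖ ^ 2 :=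
      fun t => by rw [norm_mul, mul_pow, Complex.norm_real, Real.norm_eq_abs, sq_abs]
    simp_rw [e]
    refine intervalIntegral.integral_mono_on hxy
      (intervalIntegrable_sq_mul w ((cb z).norm.pow 2) hx hxy hy) iI fun t _ => ?_
    have := (norm_lam_parts (f.val t)).2 z
    gcongr
  -- Three summands cost a factor `3`, and each boundary term carries `√2`, whose square is `2`.
  -- Summation yields `3 (T + 2 period T + 2 period T)`, which is `duhC T`.
  have hk : ∀ k, ‖∫ t in x..y, (w t : ℂ) * (osc k (-t) * lam k (f.val t))‖ ^ 2
      ≤ 3 * (‖A k‖ ^ 2 + 2 * ‖B 1 k‖ ^ 2 + 2 * ‖B 0 k‖ ^ 2) := fun k => by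
    have co : Continuous fun t => osc k (-t) := by fun_prop
    have iA : IntervalIntegrable (fun t => (w t : ℂ) * (osc k (-t) * coeffs (f.val t).2.2.2 k)) volume x y :=
      intervalIntegrable_L2_mul w (co.mul (cr k)) hx hxy hy
    have iB : ∀ z, IntervalIntegrable (fun t => osc k (-t) * ((w t : ℂ) * ext (f.val t).2.2.1 z))
        volume x y := fun z => by
      have := intervalIntegrable_L2_mul w (co.mul (cb z)) hx hxy hy
      refine this.congr fun t _ => ?_
      simp only [Pi.mul_apply]; ring
    have e : ∫ t in x..y, (w t : ℂ) * (osc k (-t) * lam k (f.val t))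
        = A k - √2 * Real.cos (freq k) * B 1 k + √2 * B 0 k := by
      simp only [A, B]
      rw [← intervalIntegral.integral_const_mul, ← intervalIntegral.integral_const_mul,
        ← intervalIntegral.integral_sub iA ((iB 1).const_mul _),
        ← intervalIntegral.integral_add (iA.sub ((iB 1).const_mul _)) ((iB 0).const_mul _)]
      refine intervalIntegral.integral_congr fun t _ => ?_
      simp only [lam, Pi.mul_apply]; ring
    rw [e]
    have n1 : ‖(√2 * Real.cos (freq k) * B 1 k : ℂ)‖ ≤ √2 * ‖B 1 k‖ := by
      rw [norm_mul, norm_mul, Complex.norm_real, Complex.norm_real, Real.norm_of_nonneg (Real.sqrt_nonneg _)]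
      gcongr
      exact mul_le_of_le_one_right (Real.sqrt_nonneg _) (Real.abs_cos_le_one _)
    have n2 : ‖(√2 * B 0 k : ℂ)‖ = √2 * ‖B 0 k‖ := by
      rw [norm_mul, Complex.norm_real, Real.norm_of_nonneg (Real.sqrt_nonneg _)]
    have n3 : ‖A k - √2 * Real.cos (freq k) * B 1 k + √2 * B 0 k‖
        ≤ ‖A k‖ + √2 * ‖B 1 k‖ + √2 * ‖B 0 k‖ :=
      (norm_add_le _ _).trans (by rw [n2]; gcongr; exact (norm_sub_le _ _).trans (by gcongr))
    have s2 := Real.sq_sqrt (show (0 : ℝ) ≤ 2 by norm_num)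
    have p1 := norm_nonneg (A k); have p2 := norm_nonneg (B 1 k); have p3 := norm_nonneg (B 0 k)
    calc _ ≤ (‖A k‖ + √2 * ‖B 1 k‖ + √2 * ‖B 0 k‖) ^ 2 := by gcongr
      _ ≤ 3 * (‖A k‖ ^ 2 + (√2 * ‖B 1 k‖) ^ 2 + (√2 * ‖B 0 k‖) ^ 2) := by
        nlinarith [sq_nonneg (‖A k‖ - √2 * ‖B 1 k‖), sq_nonneg (‖A k‖ - √2 * ‖B 0 k‖),
          sq_nonneg (√2 * ‖B 1 k‖ - √2 * ‖B 0 k‖)]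
      _ = _ := by rw [mul_pow, mul_pow, s2]
  have hB1 := hB 1
  have hB0 := hB 0
  calc _ ≤ ∑ k ∈ s, 3 * (‖A k‖ ^ 2 + 2 * ‖B 1 k‖ ^ 2 + 2 * ‖B 0 k‖ ^ 2) :=
        Finset.sum_le_sum fun k _ => hk k
    _ = 3 * (∑ k ∈ s, ‖A k‖ ^ 2 + 2 * ∑ k ∈ s, ‖B 1 k‖ ^ 2 + 2 * ∑ k ∈ s, ‖B 0 k‖ ^ 2) := by
        rw [← Finset.mul_sum, Finset.sum_add_distrib, Finset.sum_add_distrib, Finset.mul_sum, Finset.mul_sum]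
    _ ≤ _ := by unfold duhC; linarith

/-- A sequence of complex numbers with bounded partial sums of squares, as a vector. -/
def mkH (c : ℕ → ℂ) (C : ℝ) (h : ∀ s : Finset ℕ, ∑ k ∈ s, ‖c k‖ ^ 2 ≤ C) : H :=
  ⟨c, memℓp_gen' (C := C) fun s => by simpa using h s⟩

theorem norm_sq_H_le {a : H} {C : ℝ} (h : ∀ s : Finset ℕ, ∑ k ∈ s, ‖a k‖ ^ 2 ≤ C) : ‖a‖ ^ 2 ≤ C := by
  rw [norm_sq_H]
  exact (summable_sq_H a).tsum_le_of_sum_le h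

/-- The integral of the Duhamel formula on `[0, t]`. -/
def duhH (w : L2 ℝ 0 T) (f : Path 0 T Z) (t : Icc 0 T) : H :=
  mkH (fun k => ∫ s in (0 : ℝ)..t, (w s : ℂ) * (osc k (-s) * lam k (f.val s))) _
    (sum_norm_duhamel_sq_le w f le_rfl t.2.1 t.2.2)

theorem duhH_apply (w : L2 ℝ 0 T) (f : Path 0 T Z) (t : Icc 0 T) (k : ℕ) :
    duhH w f t k = ∫ s in (0 : ℝ)..t, (w s : ℂ) * (osc k (-s) * lam k (f.val s)) := rfl

theorem continuous_duhamel_integrand (f : Path 0 T Z) (k : ℕ) :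
    Continuous fun s => osc k (-s) * lam k (f.val s) := by fun_prop

theorem isPrim_duhamel (w : L2 ℝ 0 T) (f : Path 0 T Z) (k : ℕ) :
    IsPrim 0 T (fun t => ∫ s in (0 : ℝ)..t, (w s : ℂ) * (osc k (-s) * lam k (f.val s)))
      (fun s => (w s : ℂ) * (osc k (-s) * lam k (f.val s))) :=
  ⟨intervalIntegrable_L2_mul w (continuous_duhamel_integrand f k) le_rfl hT.out le_rfl, by simp⟩

theorem norm_duhH_sub_sq_le (w : L2 ℝ 0 T) (f : Path 0 T Z) (r t : Icc 0 T) (hrt : r ≤ t) :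
    ‖duhH w f t - duhH w f r‖ ^ 2 ≤ duhC T * ∫ s in (r : ℝ)..t, w s ^ 2 * ‖f.val s‖ ^ 2 := by
  refine norm_sq_H_le fun s => ?_
  have e : ∀ k, (duhH w f t - duhH w f r) k
      = ∫ s in (r : ℝ)..t, (w s : ℂ) * (osc k (-s) * lam k (f.val s)) := fun k =>
    (isPrim_duhamel w f k).sub_eq r.2 t.2
  simp_rw [e]
  exact sum_norm_duhamel_sq_le w f r.2.1 hrt t.2.2 s

theorem norm_duhH_sq_le (w : L2 ℝ 0 T) (f : Path 0 T Z) (t : Icc 0 T) :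
    ‖duhH w f t‖ ^ 2 ≤ duhC T * ∫ s in (0 : ℝ)..t, w s ^ 2 * ‖f.val s‖ ^ 2 :=
  norm_sq_H_le fun s => sum_norm_duhamel_sq_le w f le_rfl t.2.1 t.2.2 s

/-- The smoothing estimate on `[r, t]` bounds the increment by an integral over `[r, t]` of an
integrable function, which tends to zero with the length. -/
theorem continuous_duhH (w : L2 ℝ 0 T) (f : Path 0 T Z) : Continuous (duhH w f) := by
  have hp : IsPrim 0 T (fun t => ∫ s in (0 : ℝ)..t, w s ^ 2 * ‖f.val s‖ ^ 2)
      (fun s => w s ^ 2 * ‖f.val s‖ ^ 2) :=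
    ⟨intervalIntegrable_sq_mul w (by fun_prop) le_rfl hT.out le_rfl, by simp⟩
  have hc := continuousOn_iff_continuous_domRestrict.mp (hp.continuousOn hT.out)
  set F : Icc 0 T → ℝ := fun t => ∫ s in (0 : ℝ)..t, w s ^ 2 * ‖f.val s‖ ^ 2 with hF
  have hc : Continuous F := hc
  have key : ∀ r t : Icc 0 T, ‖duhH w f t - duhH w f r‖ ^ 2 ≤ duhC T * |F t - F r| := fun r t => by
    rcases le_total r t with h | h
    · refine (norm_duhH_sub_sq_le w f r t h).trans ?_
      rw [← hp.sub_eq r.2 t.2]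
      exact mul_le_mul_of_nonneg_left (le_abs_self _) duhC_nonneg
    · rw [norm_sub_rev, abs_sub_comm]
      refine (norm_duhH_sub_sq_le w f t r h).trans ?_
      rw [← hp.sub_eq t.2 r.2]
      exact mul_le_mul_of_nonneg_left (le_abs_self _) duhC_nonneg
  rw [continuous_iff_continuousAt]
  intro r
  rw [ContinuousAt, tendsto_iff_norm_sub_tendsto_zero]
  have h1 : Filter.Tendsto (fun t => √(duhC T * |F t - F r|)) (nhds r) (nhds 0) := by
    have : Continuous fun t => √(duhC T * |F t - F r|) := by fun_prop
    simpa using this.tendsto r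
  exact squeeze_zero (fun _ => norm_nonneg _) (fun t => Real.le_sqrt_of_sq_le (key r t)) h1

/-- The Duhamel operator, as a path. -/
def duhPath (w : L2 ℝ 0 T) (f : Path 0 T Z) : Path 0 T H :=
  (⟨duhH w f, continuous_duhH w f⟩ : C(Icc 0 T, H))

theorem duhPath_val (w : L2 ℝ 0 T) (f : Path 0 T Z) {t : ℝ} (ht : t ∈ Icc 0 T) :
    (duhPath w f).val t = duhH w f ⟨t, ht⟩ := ext_apply (X := H) _ ht

/-- The Duhamel operator: in the coordinate `k`, the integral of `w osc_k(-s) lam_k (f(s))`. -/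
def duh : L2 ℝ 0 T →L[ℝ] Path 0 T Z →L[ℝ] Path 0 T H :=
  LinearMap.mkContinuous₂
    (LinearMap.mk₂ ℝ duhPath
      (fun w w' f => Path.eq_of_val fun t ht => by
        rw [Path.val_add, duhPath_val _ _ ht, duhPath_val _ _ ht, duhPath_val _ _ ht]
        ext k
        change duhH _ _ _ k = duhH _ _ _ k + duhH _ _ _ k
        rw [duhH_apply, duhH_apply, duhH_apply, ← intervalIntegral.integral_add]
        · refine ((isPrim_duhamel (w + w') f k).congr_ae
            (g := fun s => (w s : ℂ) * (osc k (-s) * lam k (f.val s))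
              + (w' s : ℂ) * (osc k (-s) * lam k (f.val s))) hT.out ?_).eq t ht |>.trans (by simp)
          refine (ae_restrict_iff' measurableSet_Ioo).mp ((Lp.coeFn_add w w').mono fun s hs => ?_)
          rw [hs, Pi.add_apply]; push_cast; ring
        · exact intervalIntegrable_L2_mul w (continuous_duhamel_integrand f k) le_rfl ht.1 ht.2
        · exact intervalIntegrable_L2_mul w' (continuous_duhamel_integrand f k) le_rfl ht.1 ht.2)
      (fun c w f => Path.eq_of_val fun t ht => by
        rw [Path.val_smul, duhPath_val _ _ ht, duhPath_val _ _ ht]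
        ext k
        change duhH _ _ _ k = c • duhH _ _ _ k
        rw [duhH_apply, duhH_apply, ← intervalIntegral.integral_smul]
        refine ((isPrim_duhamel (c • w) f k).congr_ae
            (g := fun s => c • ((w s : ℂ) * (osc k (-s) * lam k (f.val s)))) hT.out ?_).eq t ht
            |>.trans (by simp)
        refine (ae_restrict_iff' measurableSet_Ioo).mp ((Lp.coeFn_smul c w).mono fun s hs => ?_)
        rw [hs, Pi.smul_apply, Complex.real_smul, smul_eq_mul]; push_cast; ring)
      (fun w f g => Path.eq_of_val fun t ht => by
        rw [Path.val_add, duhPath_val _ _ ht, duhPath_val _ _ ht, duhPath_val _ _ ht]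
        ext k
        change duhH _ _ _ k = duhH _ _ _ k + duhH _ _ _ k
        rw [duhH_apply, duhH_apply, duhH_apply, ← intervalIntegral.integral_add]
        · refine intervalIntegral.integral_congr fun s _ => ?_
          simp only [Path.val_add, ← lamL_apply, map_add]; ring
        · exact intervalIntegrable_L2_mul w (continuous_duhamel_integrand f k) le_rfl ht.1 ht.2
        · exact intervalIntegrable_L2_mul w (continuous_duhamel_integrand g k) le_rfl ht.1 ht.2)
      (fun c w f => Path.eq_of_val fun t ht => by
        rw [Path.val_smul, duhPath_val _ _ ht, duhPath_val _ _ ht]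
        ext k
        change duhH _ _ _ k = c • duhH _ _ _ k
        rw [duhH_apply, duhH_apply, ← intervalIntegral.integral_smul]
        refine intervalIntegral.integral_congr fun s _ => ?_
        have : lam k (c • f.val s) = c * lam k (f.val s) := by
          exact ((lamL k).restrictScalars ℝ).map_smul c (f.val s) |>.trans Complex.real_smul
        simp only [Path.val_smul, this, Complex.real_smul]; ring)) (√(duhC T)) fun w f => by
    refine Path.norm_le (by positivity) fun t ht => ?_
    rw [LinearMap.mk₂_apply, duhPath_val _ _ ht]
    have h0 := duhC_nonneg (T := T)
    refine (sq_le_sq₀ (norm_nonneg _) (by positivity)).mp ((norm_duhH_sq_le w f ⟨t, ht⟩).trans ?_)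
    rw [mul_pow, mul_pow, Real.sq_sqrt h0, mul_assoc]
    refine mul_le_mul_of_nonneg_left ?_ h0
    have i1 := intervalIntegrable_sq_mul w (f := fun s => ‖f.val s‖ ^ 2) (by fun_prop) le_rfl hT.out le_rfl
    calc ∫ s in (0 : ℝ)..t, w s ^ 2 * ‖f.val s‖ ^ 2 ≤ ∫ s in (0 : ℝ)..T, w s ^ 2 * ‖f.val s‖ ^ 2 :=
          intervalIntegral.integral_mono_interval le_rfl ht.1 ht.2 (.of_forall fun _ => by positivity) i1
      _ ≤ ∫ s in (0 : ℝ)..T, w s ^ 2 * ‖f‖ ^ 2 := by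
          refine intervalIntegral.integral_mono_on hT.out i1
            ((Semilinear.intervalIntegrable_sq w).mul_const _) fun s _ => ?_
          have := f.norm_val_le s
          gcongr
      _ = _ := by rw [intervalIntegral.integral_mul_const, Semilinear.integral_sq]

theorem duh_val_apply (w : L2 ℝ 0 T) (f : Path 0 T Z) {t : ℝ} (ht : t ∈ Icc 0 T) (k : ℕ) :
    (duh w f).val t k = ∫ s in (0 : ℝ)..t, (w s : ℂ) * (osc k (-s) * lam k (f.val s)) := by
  change (duhPath w f).val t k = _
  rw [duhPath_val _ _ ht, duhH_apply]

theorem norm_duh_sq_le (w : L2 ℝ 0 T) (f : Path 0 T Z) {t : ℝ} (ht : t ∈ Icc 0 T) :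
    ‖(duh w f).val t‖ ^ 2 ≤ duhC T * ∫ s in (0 : ℝ)..t, w s ^ 2 * ‖f.val s‖ ^ 2 := by
  change ‖(duhPath w f).val t‖ ^ 2 ≤ _
  rw [duhPath_val _ _ ht]
  exact norm_duhH_sq_le w f ⟨t, ht⟩

end Duhamel

/-! ### Trilinear maps on paths. -/

section Trilinear

variable {a b : ℝ} [hab : Fact (a ≤ b)] {X V : Type*} [NormedAddCommGroup X] [NormedSpace ℝ X]
  [NormedAddCommGroup V] [NormedSpace ℝ V]

/-- The trilinear map `(x, y, z) ↦ m (m (A x) (B y)) (C z)` on paths. -/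
def triple (m : V →L[ℝ] V →L[ℝ] V) (A B C : Path a b X →L[ℝ] Path a b V) :
    Path a b X →L[ℝ] Path a b X →L[ℝ] Path a b X →L[ℝ] Path a b V :=
  (ContinuousLinearMap.compL ℝ (Path a b X) (Path a b V) (Path a b X →L[ℝ] Path a b V)
    ((liftB m).bilinearComp (.id ℝ _) C)) ∘L ((liftB m).bilinearComp A B)

theorem triple_val (m : V →L[ℝ] V →L[ℝ] V) (A B C : Path a b X →L[ℝ] Path a b V) (x y z : Path a b X)
    (t : ℝ) : (triple m A B C x y z).val t = m (m ((A x).val t) ((B y).val t)) ((C z).val t) := by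
  change (liftB m (liftB m (A x) (B y)) (C z)).val t = _
  rw [liftB_val, liftB_val]

end Trilinear

theorem exists_bilinear_bound {𝕜 E F G : Type*} [RCLike 𝕜] [NormedAddCommGroup E] [NormedSpace 𝕜 E]
    [NormedAddCommGroup F] [NormedSpace 𝕜 F] [NormedAddCommGroup G] [NormedSpace 𝕜 G]
    (B : E →L[𝕜] F →L[𝕜] G) : ∃ M, 0 ≤ M ∧ ∀ x y, ‖B x y‖ ≤ M * ‖x‖ * ‖y‖ :=
  ⟨‖B‖, B.opNorm_nonneg, B.le_opNorm₂⟩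

/-- A bound for the multiplication of jets. -/
def mulC : ℝ := (exists_bilinear_bound mulZ).choose

theorem mulC_nonneg : 0 ≤ mulC := (exists_bilinear_bound mulZ).choose_spec.1

theorem norm_mulZ_le (z w : Z) : ‖mulZ z w‖ ≤ mulC * ‖z‖ * ‖w‖ :=
  (exists_bilinear_bound mulZ).choose_spec.2 z w

/-! ### The integral equation of the gauged profile. -/

section Model

variable {T : ℝ} [hT : Fact (0 ≤ T)]

/-- The free group acting on paths. -/
def rot : Path 0 T H →L[ℝ] Path 0 T H :=
  LinearMap.mkContinuous
    { toFun := fun y => Path.mk (fun t => phase t (y.val t))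
        (continuous_phase continuous_id y.continuous_val).continuousOn
      map_add' := fun y z => Path.eq_of_val fun t ht => by simp [Path.val_mk _ ht]
      map_smul' := fun c y => Path.eq_of_val fun t ht => by
        simp only [Path.val_mk _ ht, Path.val_smul, RingHom.id_apply]
        exact ((phase t).restrictScalars ℝ).map_smul c (y.val t) } 1 fun y => by
    refine Path.norm_le (by positivity) fun t ht => ?_
    simp only [LinearMap.coe_mk, AddHom.coe_mk, Path.val_mk _ ht, norm_phase, one_mul]
    exact y.norm_val_le t

theorem rot_val (y : Path 0 T H) {t : ℝ} (ht : t ∈ Icc 0 T) : (rot y).val t = phase t (y.val t) :=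
  Path.val_mk _ ht

theorem norm_rot_val (y : Path 0 T H) (t : ℝ) : ‖(rot y).val t‖ = ‖y.val t‖ := by
  rw [← Path.val_projIcc (rot y), ← Path.val_projIcc y, rot_val y (projIcc 0 T hT.out t).2, norm_phase]

/-- The product of jets, over the reals. -/
def mulZR : Z →L[ℝ] Z →L[ℝ] Z := mulZ.bilinearRestrictScalars ℝ

/-- The jets of the profile in the rotating frame. -/
def prof : Path 0 T H →L[ℝ] Path 0 T Z := liftL (S.restrictScalars ℝ) ∘L rot

theorem prof_val (y : Path 0 T H) (t : ℝ) : (prof y).val t = S ((rot y).val t) := liftL_val _ _ _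

/-- Multiplication by `i` on jets. -/
def iZ : Z →L[ℝ] Z := (Complex.I • ContinuousLinearMap.id ℂ Z).restrictScalars ℝ

theorem iZ_apply (z : Z) : iZ z = Complex.I • z := rfl

/-- The cubic term `i |χ|² χ`. -/
def cubic : Path 0 T H →L[ℝ] Path 0 T H →L[ℝ] Path 0 T H →L[ℝ] Path 0 T Z :=
  triple mulZR prof (liftL conjZ ∘L prof) (liftL iZ ∘L prof)

theorem cubic_val (x y z : Path 0 T H) (t : ℝ) :
    (cubic x y z).val t
      = Complex.I • cub (S ((rot x).val t)) (S ((rot y).val t)) (S ((rot z).val t)) := by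
  rw [cubic, triple_val]
  change mulZ (mulZ ((prof x).val t) ((liftL conjZ (prof y)).val t)) ((liftL iZ (prof z)).val t) = _
  rw [liftL_val, liftL_val, prof_val, prof_val, prof_val, iZ_apply, map_smul, cub]

/-- The damping term `χ / 2`. -/
def damp : Path 0 T H →L[ℝ] Path 0 T Z := (1 / 2 : ℝ) • prof

theorem damp_val (y : Path 0 T H) (t : ℝ) : (damp y).val t = (1 / 2 : ℝ) • S ((rot y).val t) := by
  change (1 / 2 : ℝ) • (prof y).val t = _
  rw [prof_val]

/-- The potential term `i x² χ`. -/
def pot : Path 0 T H →L[ℝ] Path 0 T Z := liftL ((iZ ∘L mulZR sqZ)) ∘L prof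

theorem pot_val (y : Path 0 T H) (t : ℝ) :
    (pot y).val t = Complex.I • mulZ sqZ (S ((rot y).val t)) := by
  change (liftL (iZ ∘L mulZR sqZ) (prof y)).val t = _
  rw [liftL_val, prof_val]; rfl

theorem norm_cub_le (x y z : H) :
    ‖cub (S x) (S y) (S z)‖ ≤ mulC ^ 2 * ‖S‖ ^ 3 * ‖conjZ‖ * ‖x‖ * ‖y‖ * ‖z‖ := by
  have h0 := mulC_nonneg
  have h1 := S.le_opNorm x
  have h2 := S.le_opNorm y
  have h3 := S.le_opNorm z
  have h4 := conjZ.le_opNorm_of_le h2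
  have h5 : ‖mulZ (S x) (conjZ (S y))‖ ≤ mulC * (‖S‖ * ‖x‖) * (‖conjZ‖ * (‖S‖ * ‖y‖)) :=
    (norm_mulZ_le _ _).trans (by gcongr)
  calc _ ≤ mulC * (mulC * (‖S‖ * ‖x‖) * (‖conjZ‖ * (‖S‖ * ‖y‖))) * (‖S‖ * ‖z‖) :=
        (norm_mulZ_le _ _).trans (by gcongr)
    _ = _ := by ring

theorem norm_I_smul (z : Z) : ‖Complex.I • z‖ = ‖z‖ := by rw [norm_smul, Complex.norm_I, one_mul]

/-- The integral equation for the profile in the rotating frame. -/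
def model (T : ℝ) [hT : Fact (0 ≤ T)] (a₀ : H) : Semilinear 0 T H Z where
  init := Path.mk (fun _ => a₀) continuousOn_const
  E := duh
  N := cubic
  A := damp
  B := pot
  CE := duhC T
  CN := mulC ^ 2 * ‖S‖ ^ 3 * ‖conjZ‖
  CL := ‖S‖ + mulC * ‖sqZ‖ * ‖S‖
  CE_nonneg := duhC_nonneg
  CN_nonneg := by have := mulC_nonneg; positivity
  CL_nonneg := by have := mulC_nonneg; positivity
  norm_E := fun w f t ht => norm_duh_sq_le w f ht
  norm_N := fun x y z t => by
    rw [cubic_val, norm_I_smul, ← norm_rot_val x, ← norm_rot_val y, ← norm_rot_val z]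
    exact norm_cub_le _ _ _
  norm_A := fun y t => by
    rw [damp_val, norm_smul, ← norm_rot_val y]
    have h0 := mulC_nonneg
    have h1 := S.le_opNorm ((rot y).val t)
    have h2 : ‖(1 / 2 : ℝ)‖ ≤ 1 := by norm_num
    calc _ ≤ 1 * (‖S‖ * ‖(rot y).val t‖) := by gcongr
      _ = ‖S‖ * ‖(rot y).val t‖ := one_mul _
      _ ≤ _ := by
        refine mul_le_mul_of_nonneg_right ?_ (norm_nonneg _)
        have : 0 ≤ mulC * ‖sqZ‖ * ‖S‖ := by positivity
        linarith
  norm_B := fun y t => by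
    rw [pot_val, norm_I_smul, ← norm_rot_val y]
    have h0 := mulC_nonneg
    have h1 := S.le_opNorm ((rot y).val t)
    calc _ ≤ mulC * ‖sqZ‖ * (‖S‖ * ‖(rot y).val t‖) := (norm_mulZ_le _ _).trans (by gcongr)
      _ = mulC * ‖sqZ‖ * ‖S‖ * ‖(rot y).val t‖ := by ring
      _ ≤ _ := by
        refine mul_le_mul_of_nonneg_right ?_ (norm_nonneg _)
        have : 0 ≤ ‖S‖ := by positivity
        linarith

/-- The amplitude of the potential in the rotating frame, `(u² - u') / 4` for `u' = g`. -/
def vel (g : L2 ℝ 0 T) : L2 ℝ 0 T := (1 / 4 : ℝ) • (incl (prim g * prim g) - g)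

/-- The directional derivative of `vel`. -/
def velD (g h : L2 ℝ 0 T) : L2 ℝ 0 T := (1 / 4 : ℝ) • (incl (prim g * prim h + prim h * prim g) - h)

theorem contDiff_vel : ContDiff ℝ 1 (vel (T := T)) := by
  have h1 : ContDiff ℝ 1 fun g : L2 ℝ 0 T => prim g * prim g :=
    (ContinuousLinearMap.contDiff (𝕜 := ℝ) (prim (𝕜 := ℝ))).mul
      (ContinuousLinearMap.contDiff (𝕜 := ℝ) (prim (𝕜 := ℝ)))
  have h2 : ContDiff ℝ 1 fun g : L2 ℝ 0 T => incl (prim g * prim g) :=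
    (ContinuousLinearMap.contDiff (𝕜 := ℝ) (incl (𝕜 := ℝ) (a := 0) (b := T))).comp h1
  exact (h2.sub contDiff_id).const_smul (1 / 4 : ℝ)

theorem fderiv_vel (g h : L2 ℝ 0 T) : fderiv ℝ (vel (T := T)) g h = velD g h := by
  have hp : HasFDerivAt (fun g : L2 ℝ 0 T => prim g) (prim (𝕜 := ℝ)) g :=
    (prim (𝕜 := ℝ) (a := 0) (b := T)).hasFDerivAt
  have h1 := hp.mul' hp
  have h2 : HasFDerivAt (fun g : L2 ℝ 0 T => incl (prim g * prim g)) _ g :=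
    HasFDerivAt.comp (g := fun f => incl (𝕜 := ℝ) (a := 0) (b := T) f) g
      (incl (𝕜 := ℝ) (a := 0) (b := T)).hasFDerivAt h1
  have h3 : HasFDerivAt (vel (T := T)) _ g := (h2.sub (hasFDerivAt_id g)).const_smul (1 / 4 : ℝ)
  rw [h3.fderiv]
  rfl

/-- The constant function `1`. -/
def oneL2 (T : ℝ) [Fact (0 ≤ T)] : L2 ℝ 0 T := incl (1 : C(Icc 0 T, ℝ))

/-- The weights associated with the derivative of the control and the coupling constant. -/
def wts (p : L2 ℝ 0 T × ℝ) : Weights 0 T := (p.2 • oneL2 T, incl (prim p.1), vel p.1)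

theorem contDiff_wts : ContDiff ℝ 1 (wts (T := T)) := by
  have h1 : ContDiff ℝ 1 fun p : L2 ℝ 0 T × ℝ => p.2 • oneL2 T := contDiff_snd.smul contDiff_const
  have h2 : ContDiff ℝ 1 fun p : L2 ℝ 0 T × ℝ => incl (prim p.1) :=
    (ContinuousLinearMap.contDiff (𝕜 := ℝ) (incl ∘L prim (𝕜 := ℝ) (a := 0) (b := T))).comp contDiff_fst
  exact h1.prodMk (h2.prodMk (contDiff_vel.comp contDiff_fst))

theorem fderiv_wts (p : L2 ℝ 0 T × ℝ) (h : L2 ℝ 0 T) :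
    fderiv ℝ wts p (h, 0) = (0, incl (prim h), velD p.1 h) := by
  have h1 : HasFDerivAt (fun p : L2 ℝ 0 T × ℝ => p.2 • oneL2 T) _ p :=
    (hasFDerivAt_snd (𝕜 := ℝ)).smul_const (oneL2 T)
  have h2 : HasFDerivAt (fun p : L2 ℝ 0 T × ℝ => incl (prim p.1)) _ p :=
    HasFDerivAt.comp (g := fun f => (incl ∘L prim (𝕜 := ℝ) (a := 0) (b := T)) f) p
      (incl ∘L prim (𝕜 := ℝ) (a := 0) (b := T)).hasFDerivAt (hasFDerivAt_fst (𝕜 := ℝ))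
  have h3 : HasFDerivAt (fun p : L2 ℝ 0 T × ℝ => vel p.1) _ p :=
    HasFDerivAt.comp (g := vel (T := T)) p
      ((contDiff_vel.differentiable (by norm_num) p.1).hasFDerivAt) (hasFDerivAt_fst (𝕜 := ℝ))
  have h4 : HasFDerivAt (wts (T := T)) _ p := h1.prodMk (h2.prodMk h3)
  rw [h4.fderiv, ← fderiv_vel]
  change ((0 : ℝ) • oneL2 T, _, _) = _
  rw [zero_smul]
  rfl

end Model

/-! ### From the integral equation back to an evolution equation. -/

section Regularity

/-- Jets of `H³` functions that vanish at the end points. -/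
structure IsAdm (z : Z) : Prop where
  jet : IsJet z
  zero : ext z.1 0 = 0
  one : ext z.1 1 = 0

theorem IsAdm.add {z w : Z} (hz : IsAdm z) (hw : IsAdm w) : IsAdm (z + w) where
  jet := ⟨hz.jet.one.add hw.jet.one, hz.jet.two.add hw.jet.two,
    (hz.jet.three.add hw.jet.three).congr_L2_symm (Lp.coeFn_add _ _)⟩
  zero := by change ext z.1 0 + ext w.1 0 = 0; rw [hz.zero, hw.zero, add_zero]
  one := by change ext z.1 1 + ext w.1 1 = 0; rw [hz.one, hw.one, add_zero]

theorem IsPrim.const_mul {a b : ℝ} {F f : ℝ → ℂ} (c : ℂ) (h : IsPrim a b F f) :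
    IsPrim a b (fun x => c * F x) (fun x => c * f x) :=
  h.clm_comp ((ContinuousLinearMap.mul ℂ ℂ c).restrictScalars ℝ)

theorem IsAdm.smul {z : Z} (c : ℂ) (hz : IsAdm z) : IsAdm (c • z) where
  jet := ⟨hz.jet.one.const_mul c, hz.jet.two.const_mul c,
    (hz.jet.three.const_mul c).congr_L2_symm (Lp.coeFn_smul _ _)⟩
  zero := by change c * ext z.1 0 = 0; rw [hz.zero, mul_zero]
  one := by change c * ext z.1 1 = 0; rw [hz.one, mul_zero]

theorem coe_smul_Z (c : ℝ) (z : Z) : (c : ℂ) • z = c • z := by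
  refine Prod.ext ?_ (Prod.ext ?_ (Prod.ext ?_ ?_))
  · exact Complex.coe_smul c z.1
  · exact Complex.coe_smul c z.2.1
  · exact Complex.coe_smul c z.2.2.1
  · exact Complex.coe_smul c z.2.2.2

theorem IsAdm.rsmul {z : Z} (c : ℝ) (hz : IsAdm z) : IsAdm (c • z) := by
  rw [← coe_smul_Z]; exact hz.smul c

theorem isAdm_S (a : H) : IsAdm (S a) := ⟨isJet_S a, D0_zero a, D0_one a⟩

theorem IsAdm.mul_left {z w : Z} (hz : IsJet z) (hw : IsAdm w) : IsAdm (mulZ z w) where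
  jet := hz.mul hw.jet
  zero := by simp [mulZ_apply, mulZFun, ext_mul, hw.zero]
  one := by simp [mulZ_apply, mulZFun, ext_mul, hw.one]

theorem isAdm_cub {x y z : Z} (hx : IsJet x) (hy : IsJet y) (hz : IsAdm z) : IsAdm (cub x y z) :=
  IsAdm.mul_left (hx.mul hy.conj) hz

variable {T : ℝ} [hT : Fact (0 ≤ T)]

theorem intervalIntegrable_smul {E : Type*} [NormedAddCommGroup E] [NormedSpace ℝ E] (w : L2 ℝ 0 T)
    {f : ℝ → E} (hf : Continuous f) : IntervalIntegrable (fun s => w s • f s) volume 0 T :=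
  (intervalIntegrable_L2 w).smul_continuousOn hf.continuousOn

/-- `y` is the interaction-picture path driven by the forcing `n`. -/
structure IsDuh (y : Path 0 T H) (n : ℝ → Z) : Prop where
  integrable : IntervalIntegrable n volume 0 T
  coord : ∀ k, IsPrim 0 T (fun t => y.val t k) (fun s => osc k (-s) * lam k (n s))

theorem IsDuh.add {y y' : Path 0 T H} {n n' : ℝ → Z} (h : IsDuh y n) (h' : IsDuh y' n') :
    IsDuh (y + y') (fun s => n s + n' s) where
  integrable := h.integrable.add h'.integrable
  coord := fun k => ((h.coord k).add (h'.coord k)).congr_ae hT.out <| .of_forall fun s _ => by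
    simp only [← lamL_apply, map_add]; ring

theorem lam_rsmul (k : ℕ) (c : ℝ) (z : Z) : lam k (c • z) = c * lam k z := by
  rw [← coe_smul_Z, ← lamL_apply, map_smul]; rfl

theorem isDuh_duh (w : L2 ℝ 0 T) (f : Path 0 T Z) : IsDuh (duh w f) (fun s => w s • f.val s) where
  integrable := intervalIntegrable_smul w f.continuous_val
  coord := fun k => ((isPrim_duhamel w f k).congr fun t ht => (duh_val_apply w f ht k).symm).congr_ae
    hT.out <| .of_forall fun s _ => by simp only [lam_rsmul]; ring

theorem isDuh_const (a : H) : IsDuh (Path.mk (fun _ => a) continuousOn_const : Path 0 T H) 0 where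
  integrable := intervalIntegrable_const (c := (0 : Z))
  coord := fun k => by
    have e : lam k 0 = 0 := (lamL k).map_zero
    refine ⟨by simp [e], fun t ht => ?_⟩
    rw [Path.val_mk _ ht, Path.val_mk _ ⟨le_rfl, hT.out⟩]
    simp [e]

/-- Leaving the interaction picture: the product rule with `osc k` restores the free term of the
equation. -/
theorem IsDuh.coord_rot {y : Path 0 T H} {n : ℝ → Z} (h : IsDuh y n) (k : ℕ) :
    IsPrim 0 T (fun t => (rot y).val t k)
      (fun s => -(Complex.I * freq k ^ 2) * (rot y).val s k + lam k (n s)) := by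
  have ho : IsPrim 0 T (osc k) (fun s => -(Complex.I * freq k ^ 2) * osc k s) :=
    IsPrim.of_hasDerivAt (hasDerivAt_osc k) (by fun_prop)
  have e : ∀ t ∈ Icc 0 T, osc k t • (fun t => y.val t k) t = (rot y).val t k := fun t ht => by
    rw [rot_val y ht]; rfl
  refine ((ho.smul hT.out (h.coord k)).congr e).congr_ae hT.out <| .of_forall fun s hs => ?_
  rw [← e s (Ioo_subset_Icc_self hs)]
  simp only [smul_eq_mul]
  linear_combination lam k (n s) * osc_neg_mul k s

/-- The evolution equation, in the space of continuous functions of `x`. -/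
theorem IsDuh.isPrim_D0 {y : Path 0 T H} {n : ℝ → Z} (h : IsDuh y n) (hn : ∀ s, IsAdm (n s)) :
    IsPrim 0 T (fun t => D0 ((rot y).val t))
      (fun s => Complex.I • D2 ((rot y).val s) + (n s).1) := by
  have i1 : IntervalIntegrable (fun s => Complex.I • D2 ((rot y).val s)) volume 0 T := by
    refine Continuous.intervalIntegrable ?_ _ _
    fun_prop
  have i2 : IntervalIntegrable (fun s => (n s).1) volume 0 T :=
    ⟨h.integrable.1.fst, h.integrable.2.fst⟩
  refine ⟨i1.add i2, fun t ht => ?_⟩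
  have h0 : (0 : ℝ) ∈ Icc 0 T := ⟨le_rfl, hT.out⟩
  have hi : IntervalIntegrable (fun s => Complex.I • D2 ((rot y).val s) + (n s).1) volume 0 t := by
    refine (i1.add i2).mono_set ?_
    rw [uIcc_of_le hT.out]
    exact uIcc_subset_Icc h0 ht
  rw [← sub_eq_zero, ← sub_sub]
  -- The identity between continuous functions is tested against all sines. Multiplied by `freq k ^
  -- 3`, it becomes the scalar equation of `IsDuh.coord_rot`; `D2` contributes `freq k ^ 2` times
  -- the coordinate.
  refine eq_zero_of_sinC fun k => ?_
  have hf : (freq k : ℂ) ^ 3 ≠ 0 := pow_ne_zero _ (by exact_mod_cast (freq_pos k).ne')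
  refine (mul_eq_zero_iff_left hf).mp ?_
  rw [map_sub, map_sub, mul_sub, mul_sub]
  have c1 : ∀ a : H, (freq k : ℂ) ^ 3 * sinC k (D0 a) = -a k := fun a => by
    have := freq_cube_mul_sinC k (isJet_S a) (D0_zero a) (D0_one a)
    rwa [lam_S] at this
  have c2 : ∀ a : H, (freq k : ℂ) * sinC k (D2 a) = a k := fun a => by
    have := freq_mul_sinC_two k (isJet_S a)
    rwa [lam_S] at this
  have e : (freq k : ℂ) ^ 3 * sinC k (∫ s in (0 : ℝ)..t, (Complex.I • D2 ((rot y).val s) + (n s).1))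
      = -∫ s in (0 : ℝ)..t, (-(Complex.I * freq k ^ 2) * (rot y).val s k + lam k (n s)) := by
    have := (sinC k).intervalIntegral_comp_comm hi
    rw [← this, ← intervalIntegral.integral_const_mul, ← intervalIntegral.integral_neg]
    refine intervalIntegral.integral_congr fun s _ => ?_
    simp only [map_add, map_smul, smul_eq_mul, mul_add]
    have := freq_cube_mul_sinC k (hn s).jet (hn s).zero (hn s).one
    rw [this]
    linear_combination Complex.I * freq k ^ 2 * c2 ((rot y).val s)
  have h2 := (h.coord_rot k).sub_eq h0 ht
  rw [e, c1, c1]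
  linear_combination -h2

end Regularity

/-! ### The gauge transform. -/

section Gauge

/-- The jet of `exp (i θ x²) χ`. -/
def gz (θ : ℝ) (a : H) : Z := mulZ (gaugeZ θ) (S a)

theorem isAdm_gz (θ : ℝ) (a : H) : IsAdm (gz θ a) := IsAdm.mul_left (isJet_gaugeZ θ) (isAdm_S a)

theorem gz_one (θ : ℝ) (a : H) (x : ℝ) : ext (gz θ a).1 x = ext (gauge θ) x * ext (D0 a) x := by
  simp [gz, mulZ_apply, mulZFun, gaugeZ, S_apply, ext_mul]

theorem gz_two (θ : ℝ) (a : H) {x : ℝ} (hx : x ∈ Icc (0 : ℝ) 1) : ext (gz θ a).2.1 x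
    = ext (gauge θ) x * (ext (D1 a) x + 2 * Complex.I * θ * x * ext (D0 a) x) := by
  simp [gz, mulZ_apply, mulZFun, gaugeZ, S_apply, ext_mul, ext_add, ext_smul, ext_XK hx]
  ring

theorem gz_three (θ : ℝ) (a : H) {x : ℝ} (hx : x ∈ Icc (0 : ℝ) 1) : ext (gz θ a).2.2.1 x
    = ext (gauge θ) x * (ext (D2 a) x + 4 * Complex.I * θ * x * ext (D1 a) x
      + (2 * Complex.I * θ - 4 * θ ^ 2 * x ^ 2) * ext (D0 a) x) := by
  simp [gz, mulZ_apply, mulZFun, gaugeZ, S_apply, ext_mul, ext_add, ext_sub, ext_smul, ext_XK hx, pow_two]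
  ring

theorem hasDerivAt_gauge (θ : ℝ) {x : ℝ} :
    HasDerivAt (fun θ : ℝ => Complex.exp (Complex.I * θ * (x : ℂ) ^ 2))
      (Complex.I * x ^ 2 * Complex.exp (Complex.I * θ * (x : ℂ) ^ 2)) θ := by
  convert! (((hasDerivAt_ofReal θ).const_mul Complex.I).mul_const ((x : ℂ) ^ 2)).cexp using 1
  ring

variable {T : ℝ}

/-- For `θ = u / 4` the second term on the right is `u ∂ₓ(x ψ)`. The last bracket shows which terms
the profile equation must contain besides `i χ''` to be consistent with it: the damping `u / 2` and
the potential `(u² - u') / 4` times `i x²`. -/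
theorem isPrim_gz (hT : 0 ≤ T) {θ θ' : ℝ → ℝ} (hθ : IsPrim 0 T θ θ') {a : ℝ → H} {m : ℝ → ℂ} {x : ℝ}
    (hx : x ∈ Icc (0 : ℝ) 1)
    (hχ : IsPrim 0 T (fun t => ext (D0 (a t)) x) (fun t => Complex.I * ext (D2 (a t)) x + m t)) :
    IsPrim 0 T (fun t => ext (gz (θ t) (a t)).1 x)
      (fun t => Complex.I * ext (gz (θ t) (a t)).2.2.1 x
        + 4 * θ t * (ext (gz (θ t) (a t)).1 x + x * ext (gz (θ t) (a t)).2.1 x)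
        + ext (gauge (θ t)) x * (m t - 2 * θ t * ext (D0 (a t)) x
          - Complex.I * (4 * θ t ^ 2 - θ' t) * x ^ 2 * ext (D0 (a t)) x)) := by
  have h1 := hθ.comp hT (g := fun θ : ℝ => Complex.exp (Complex.I * θ * (x : ℂ) ^ 2))
    (g' := fun θ : ℝ => Complex.I * x ^ 2 * Complex.exp (Complex.I * θ * (x : ℂ) ^ 2))
    (fun θ => hasDerivAt_gauge θ) (by fun_prop)
  refine ((h1.smul hT hχ).congr fun t ht => ?_).congr_ae hT <| .of_forall fun t ht => ?_
  · rw [gz_one, ext_gauge _ hx]; rfl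
  · rw [gz_one, gz_two _ _ hx, gz_three _ _ hx, ext_gauge _ hx]
    simp only [smul_eq_mul, Complex.real_smul]
    linear_combination (-(4 * x * θ t * Complex.exp (Complex.I * θ t * (x : ℂ) ^ 2) * ext (D1 (a t)) x)
      - 2 * θ t * Complex.exp (Complex.I * θ t * (x : ℂ) ^ 2) * ext (D0 (a t)) x) * Complex.I_sq

end Gauge

/-! ### Product rules for primitives with values in normed spaces. -/

section Products

variable {a b : ℝ} {E F G : Type*} [NormedAddCommGroup E] [NormedSpace ℝ E] [CompleteSpace E]
  [NormedAddCommGroup F] [NormedSpace ℝ F] [CompleteSpace F]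
  [NormedAddCommGroup G] [NormedSpace ℝ G] [CompleteSpace G]

theorem IsPrim.dist_le {u v : ℝ → E} (h : IsPrim a b u v) {x y : ℝ} (hx : x ∈ Icc a b) (hy : y ∈ Icc a b) :
    ‖u x - u y‖ ≤ |(∫ t in a..x, ‖v t‖) - ∫ t in a..y, ‖v t‖| := by
  have ha : a ∈ Icc a b := ⟨le_rfl, hx.1.trans hx.2⟩
  rw [h.sub_eq hy hx, intervalIntegral.integral_interval_sub_left
    (h.intervalIntegrable_of_mem ha hx).norm (h.intervalIntegrable_of_mem ha hy).norm]
  exact intervalIntegral.norm_integral_le_abs_integral_norm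

theorem intervalIntegrable_bilinear {X Y W : Type*} [NormedAddCommGroup X] [NormedSpace ℝ X]
    [NormedAddCommGroup Y] [NormedSpace ℝ Y] [NormedAddCommGroup W] [NormedSpace ℝ W]
    (B : X →L[ℝ] Y →L[ℝ] W) {p : ℝ → X} {q : ℝ → Y} (hp : ContinuousOn p (uIcc a b))
    (hq : IntervalIntegrable q volume a b) :
    IntervalIntegrable (fun x => B (p x) (q x)) volume a b := by
  obtain ⟨C, hC⟩ := isCompact_uIcc.exists_bound_of_continuousOn hp
  have hpm : AEStronglyMeasurable p (volume.restrict (uIoc a b)) :=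
    (hp.mono uIoc_subset_uIcc).aestronglyMeasurable measurableSet_uIoc
  rw [intervalIntegrable_iff] at hq ⊢
  refine (hq.norm.const_mul (‖B‖ * C)).mono' (B.aestronglyMeasurable_comp₂ hpm hq.1) ?_
  filter_upwards [ae_restrict_mem measurableSet_uIoc] with x hx
  refine (B.le_opNorm₂ _ _).trans ?_
  have := hC x (uIoc_subset_uIcc hx)
  gcongr

/-- The product rule for primitives. -/
theorem IsPrim.bilinear (B : E →L[ℝ] F →L[ℝ] G) {u u' : ℝ → E} {v v' : ℝ → F} (hab : a ≤ b)
    (hu : IsPrim a b u u') (hv : IsPrim a b v v') :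
    IsPrim a b (fun x => B (u x) (v x)) (fun x => B (u x) (v' x) + B (u' x) (v x)) := by
  have cu : ContinuousOn u (uIcc a b) := by rw [uIcc_of_le hab]; exact hu.continuousOn hab
  have cv : ContinuousOn v (uIcc a b) := by rw [uIcc_of_le hab]; exact hv.continuousOn hab
  obtain ⟨Cu, hCu⟩ := isCompact_uIcc.exists_bound_of_continuousOn cu
  obtain ⟨Cv, hCv⟩ := isCompact_uIcc.exists_bound_of_continuousOn cv
  refine .of_absolutelyContinuous hab ?_ ?_ ?_
  -- Absolute continuity of the product: its increments are dominated by those of a multiple of the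
  -- primitive of `‖u'‖ + ‖v'‖`.
  · have hn : IsPrim a b (fun x => ∫ t in a..x, (‖u' t‖ + ‖v' t‖)) (fun t => ‖u' t‖ + ‖v' t‖) :=
      ⟨hu.integrable.norm.add hv.integrable.norm, by simp⟩
    have h1 := (hn.absolutelyContinuous hab).const_mul (‖B‖ * (|Cu| + |Cv|))
    refine absolutelyContinuousOnInterval_of_dist_le h1 fun x hx y hy => ?_
    have nu := hCu y hy
    have nv := hCv x hx
    rw [uIcc_of_le hab] at hx hy
    have ha : a ∈ Icc a b := ⟨le_rfl, hab⟩
    have du := hu.dist_le hx hy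
    have dv := hv.dist_le hx hy
    rw [dist_eq_norm, Real.dist_eq, ← mul_sub, abs_mul, abs_of_nonneg (by positivity)]
    have e : B (u x) (v x) - B (u y) (v y) = B (u x - u y) (v x) + B (u y) (v x - v y) := by
      simp
    have hsum : ∀ z ∈ Icc a b, ∫ t in a..z, (‖u' t‖ + ‖v' t‖)
        = (∫ t in a..z, ‖u' t‖) + ∫ t in a..z, ‖v' t‖ := fun z hz =>
      intervalIntegral.integral_add (hu.intervalIntegrable_of_mem ha hz).norm
        (hv.intervalIntegrable_of_mem ha hz).norm
    have hP : ∃ P Q : ℝ, |(∫ t in a..x, ‖u' t‖) - ∫ t in a..y, ‖u' t‖| = P ∧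
        |(∫ t in a..x, ‖v' t‖) - ∫ t in a..y, ‖v' t‖| = Q ∧ 0 ≤ P ∧ 0 ≤ Q ∧
        |(∫ t in a..x, (‖u' t‖ + ‖v' t‖)) - ∫ t in a..y, (‖u' t‖ + ‖v' t‖)| = P + Q := by
      refine ⟨_, _, rfl, rfl, abs_nonneg _, abs_nonneg _, ?_⟩
      rw [hsum x hx, hsum y hy, add_sub_add_comm]
      have iu := intervalIntegral.integral_interval_sub_left (hu.intervalIntegrable_of_mem ha hx).norm
        (hu.intervalIntegrable_of_mem ha hy).norm
      have iv := intervalIntegral.integral_interval_sub_left (hv.intervalIntegrable_of_mem ha hx).norm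
        (hv.intervalIntegrable_of_mem ha hy).norm
      rw [iu, iv]
      rcases le_total x y with h | h
      · rw [intervalIntegral.integral_symm x y, intervalIntegral.integral_symm x y]
        have p1 := intervalIntegral.integral_nonneg h (fun t _ => norm_nonneg (u' t)) (μ := volume)
        have p2 := intervalIntegral.integral_nonneg h (fun t _ => norm_nonneg (v' t)) (μ := volume)
        rw [← neg_add, abs_neg, abs_neg, abs_neg, abs_of_nonneg p1, abs_of_nonneg p2,
          abs_of_nonneg (add_nonneg p1 p2)]
      · have p1 := intervalIntegral.integral_nonneg h (fun t _ => norm_nonneg (u' t)) (μ := volume)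
        have p2 := intervalIntegral.integral_nonneg h (fun t _ => norm_nonneg (v' t)) (μ := volume)
        rw [abs_of_nonneg p1, abs_of_nonneg p2, abs_of_nonneg (add_nonneg p1 p2)]
    obtain ⟨P, Q, hP1, hQ1, hP0, hQ0, hPQ⟩ := hP
    rw [hP1] at du
    rw [hQ1] at dv
    rw [e, hPQ]
    have nu' := nu.trans (le_abs_self Cu)
    have nv' := nv.trans (le_abs_self Cv)
    calc _ ≤ ‖B (u x - u y) (v x)‖ + ‖B (u y) (v x - v y)‖ := norm_add_le _ _
      _ ≤ ‖B‖ * P * |Cv| + ‖B‖ * |Cu| * Q := by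
        refine add_le_add ((B.le_opNorm₂ _ _).trans ?_) ((B.le_opNorm₂ _ _).trans ?_) <;> gcongr
      _ ≤ _ := by
        have h1 : 0 ≤ ‖B‖ * (|Cu| * P) := by positivity
        have h2 : 0 ≤ ‖B‖ * (|Cv| * Q) := by positivity
        nlinarith
  · exact (intervalIntegrable_bilinear B cu hv.integrable).add
      (intervalIntegrable_bilinear B.flip cv hu.integrable)
  · filter_upwards [hu.ae_hasDerivAt hab, hv.ae_hasDerivAt hab] with x h1 h2 hx
    exact B.hasDerivAt_of_bilinear (fun _ => h1 hx) (fun _ => h2 hx)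

variable {V : Type*} [NormedAddCommGroup V] [InnerProductSpace ℂ V] [NormedSpace ℝ V]
  [IsScalarTower ℝ ℂ V] [CompleteSpace V]

/-- The complex inner product as a real bilinear map. -/
def innerR : V →L[ℝ] V →L[ℝ] ℂ :=
  LinearMap.mkContinuous₂
    (LinearMap.mk₂ ℝ (fun x y => inner ℂ x y) (fun x y z => inner_add_left _ _ _)
      (fun c x y => by
        rw [← algebraMap_smul ℂ c x, inner_smul_left, Complex.coe_algebraMap, Complex.conj_ofReal, Complex.real_smul])
      (fun x y z => inner_add_right _ _ _)
      (fun c x y => by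
        rw [← algebraMap_smul ℂ c y, inner_smul_right, Complex.coe_algebraMap, Complex.real_smul])) 1
    fun x y => by rw [one_mul]; exact norm_inner_le_norm x y

theorem IsPrim.norm_sq {u u' : ℝ → V} (hab : a ≤ b) (hu : IsPrim a b u u') :
    IsPrim a b (fun x => ‖u x‖ ^ 2) (fun x => 2 * (inner ℂ (u x) (u' x)).re) := by
  have h := (hu.bilinear innerR hab hu).clm_comp Complex.reCLM
  refine (h.congr fun x _ => ?_).congr_ae hab <| .of_forall fun x _ => ?_
  · change (inner ℂ (u x) (u x) : ℂ).re = _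
    exact inner_self_eq_norm_sq (𝕜 := ℂ) (u x)
  · change (inner ℂ (u x) (u' x) + inner ℂ (u' x) (u x) : ℂ).re = _
    rw [← inner_conj_symm (u' x) (u x), Complex.add_re, Complex.conj_re]; ring

end Products

/-! ### The forcing of the profile equation. -/

section Forcing

variable {T : ℝ} [hT : Fact (0 ≤ T)]

/-- The terms of the evolution equation of the profile besides `i χ''`. -/
def forcing (σ u v : ℝ) (a : H) : Z :=
  σ • (Complex.I • cub (S a) (S a) (S a)) + u • ((1 / 2 : ℝ) • S a) + v • (Complex.I • mulZ sqZ (S a))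

theorem isAdm_cub_S (a : H) : IsAdm (cub (S a) (S a) (S a)) :=
  isAdm_cub (isJet_S a) (isJet_S a) (isAdm_S a)

theorem isAdm_sq (a : H) : IsAdm (mulZ sqZ (S a)) := IsAdm.mul_left isJet_sqZ (isAdm_S a)

theorem isAdm_forcing (σ u v : ℝ) (a : H) : IsAdm (forcing σ u v a) :=
  ((((isAdm_cub_S a).smul _).rsmul _).add (((isAdm_S a).rsmul _).rsmul _)).add
    (((isAdm_sq a).smul _).rsmul _)

theorem IsDuh.congr_ae {y : Path 0 T H} {n m : ℝ → Z} (h : IsDuh y n)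
    (e : ∀ᵐ s ∂vol 0 T, n s = m s) : IsDuh y m where
  integrable := by
    have := h.integrable
    rw [intervalIntegrable_iff_integrableOn_Ioo_of_le hT.out] at this ⊢
    exact this.congr e
  coord := fun k => (h.coord k).congr_ae hT.out <|
    ((ae_restrict_iff' measurableSet_Ioo).mp e).mono fun s hs hm => by rw [hs hm]

theorem oneL2_smul_ae (σ : ℝ) : ∀ᵐ s ∂vol 0 T, (σ • oneL2 T : L2 ℝ 0 T) s = σ := by
  filter_upwards [Lp.coeFn_smul σ (oneL2 T), incl_ae (1 : C(Icc 0 T, ℝ))] with s h1 h2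
  have h3 : (oneL2 T : L2 ℝ 0 T) s = 1 := h2
  rw [h1, Pi.smul_apply, h3, smul_eq_mul, mul_one]

theorem isDuh_of_solves {a₀ : H} {p : L2 ℝ 0 T × ℝ} {y : Path 0 T H}
    (h : (model T a₀).Solves (wts p) y) :
    IsDuh y (fun s => forcing p.2 (ext (prim p.1) s) (vel p.1 s) ((rot y).val s)) := by
  have h1 := (isDuh_const (T := T) a₀).add
    (((isDuh_duh (wts p).1 (cubic y y y)).add (isDuh_duh (wts p).2.1 (damp y))).add
      (isDuh_duh (wts p).2.2 (pot y)))
  have e : y = Path.mk (fun _ => a₀) continuousOn_const + (duh (wts p).1 (cubic y y y)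
      + duh (wts p).2.1 (damp y) + duh (wts p).2.2 (pot y)) := h
  rw [← e] at h1
  refine h1.congr_ae ?_
  filter_upwards [oneL2_smul_ae (T := T) p.2, incl_ae (prim p.1)] with s e1 e2
  have e1 : (wts p).1 s = p.2 := e1
  have e2 : (wts p).2.1 s = ext (prim p.1) s := e2
  rw [e1, e2, cubic_val, damp_val, pot_val, Pi.zero_apply, zero_add]
  rfl

theorem coe_smul_K (c : ℝ) (f : K) : c • f = (c : ℂ) • f := (algebraMap_smul ℂ c f).symm

theorem forcing_one (σ u v : ℝ) (a : H) : (forcing σ u v a).1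
    = (σ * Complex.I) • (cub (S a) (S a) (S a)).1 + (u / 2 : ℂ) • D0 a
      + (v * Complex.I) • (sqZ.1 * D0 a) := by
  simp only [forcing, Prod.fst_add, Prod.smul_fst, mulZ_apply, mulZFun, S_apply, coe_smul_K, smul_smul]
  congr 3
  push_cast; ring

theorem forcing_two (σ u v : ℝ) (a : H) : (forcing σ u v a).2.1
    = (σ * Complex.I) • (cub (S a) (S a) (S a)).2.1 + (u / 2 : ℂ) • D1 a
      + (v * Complex.I) • (sqZ.2.1 * D0 a + sqZ.1 * D1 a) := by
  simp only [forcing, Prod.snd_add, Prod.smul_snd, Prod.fst_add, Prod.smul_fst, mulZ_apply, mulZFun,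
    S_apply, coe_smul_K, smul_smul]
  congr 3
  push_cast; ring

end Forcing

/-! ### Inner products and integration by parts in `x`. -/

section InnerProducts

theorem inner_incl_incl (f g : K) :
    inner ℂ (incl f) (incl g) = ∫ x in (0 : ℝ)..1, starRingEnd ℂ (ext f x) * ext g x := by
  rw [inner_incl]
  exact integral_incl_congr g fun x y => starRingEnd ℂ (ext f x) * y

theorem inner_incl_eq_ofReal {f g : K} {r : ℝ → ℝ} (h : ∀ x, starRingEnd ℂ (ext f x) * ext g x = r x) :
    inner ℂ (incl f) (incl g) = ((∫ x in (0 : ℝ)..1, r x : ℝ) : ℂ) := by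
  rw [inner_incl_incl, ← intervalIntegral.integral_ofReal]
  exact intervalIntegral.integral_congr fun x _ => h x

/-- Integration by parts. -/
theorem inner_incl_second {z w : Z} (hz : IsAdm z) (hw : IsJet w) :
    inner ℂ (incl z.1) (incl w.2.2.1) = -inner ℂ (incl z.2.1) (incl w.2.1) := by
  have h := (hz.jet.one.clm_comp Complex.conjCLE.toContinuousLinearMap).smul zero_le_one hw.two
  have e := h.eq 1 ⟨zero_le_one, le_rfl⟩
  change (starRingEnd ℂ) (ext z.1 1) • ext w.2.1 1 = starRingEnd ℂ (ext z.1 0) • ext w.2.1 0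
    + ∫ t in (0 : ℝ)..1, (starRingEnd ℂ (ext z.1 t) • ext w.2.2.1 t
      + starRingEnd ℂ (ext z.2.1 t) • ext w.2.1 t) at e
  rw [hz.one, hz.zero, map_zero, zero_smul, zero_smul, zero_add] at e
  simp only [smul_eq_mul] at e
  rw [intervalIntegral.integral_add (Continuous.intervalIntegrable (by fun_prop) _ _)
    (Continuous.intervalIntegrable (by fun_prop) _ _), ← inner_incl_incl, ← inner_incl_incl] at e
  linear_combination -e

theorem inner_incl_D2 {z : Z} (hz : IsAdm z) (a : H) :
    inner ℂ (incl z.1) (incl (D2 a)) = -inner ℂ (incl z.2.1) (incl (D1 a)) := by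
  have h := inner_incl_second hz (isJet_S a)
  rwa [S_apply] at h

theorem freq_sq_mul_coeffs (k : ℕ) {z : Z} (hz : IsAdm z) :
    (freq k : ℂ) ^ 2 * coeffs (incl z.2.1) k = -lam k z := by
  have e1 := integral_sin_mul_of_isPrim (c := freq k) z.1 hz.jet.one
  rw [hz.zero, hz.one] at e1
  have e2 := freq_cube_mul_sinC k hz.jet hz.zero hz.one
  rw [sinC_apply] at e2
  rw [coeffs_incl, ← e2]
  linear_combination -(√2 * freq k ^ 2 : ℂ) * e1

theorem integral_incl_two {z : Z} (hz : IsAdm z) : ∫ x in (0 : ℝ)..1, incl z.2.1 x = 0 := by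
  have := integral_incl_congr z.2.1 fun _ y => y
  rw [this]
  have e := hz.jet.one.eq 1 ⟨zero_le_one, le_rfl⟩
  rw [hz.zero, hz.one, zero_add] at e
  exact e.symm

theorem inner_coeffs {f : L} (hf : ∫ x in (0 : ℝ)..1, f x = 0) (g : L) :
    inner ℂ (coeffs f) (coeffs g) = inner ℂ f g := by
  conv_rhs => rw [← D3_coeffs hf]
  exact ContinuousLinearMap.adjoint_inner_right D3.toContinuousLinearMap (coeffs f) g

theorem norm_coeffs {f : L} (hf : ∫ x in (0 : ℝ)..1, f x = 0) : ‖coeffs f‖ = ‖f‖ := by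
  conv_rhs => rw [← D3_coeffs hf]
  exact (D3.norm_map _).symm

theorem inner_phase_neg (s : ℝ) (a b : H) : inner ℂ a (phase (-s) b) = inner ℂ (phase s a) b := by
  rw [lp.inner_eq_tsum, lp.inner_eq_tsum]
  refine tsum_congr fun k => ?_
  rw [phase_apply, phase_apply]
  simp only [RCLike.inner_apply, map_mul, conj_osc]
  ring

end InnerProducts

/-! ### Time derivatives of mass, kinetic energy and interaction energy. -/

section Energy

variable {T : ℝ} [hT : Fact (0 ≤ T)]

/-- The first derivative of the profile in cosine coordinates. -/
def slope : H →L[ℂ] H := coeffs ∘L incl ∘L D1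

theorem slope_apply (a : H) (k : ℕ) : (freq k : ℂ) ^ 2 * slope a k = -a k := by
  have := freq_sq_mul_coeffs k (isAdm_S a)
  rwa [lam_S] at this

theorem slope_phase (s : ℝ) (a : H) : slope (phase s a) = phase s (slope a) := by
  ext k
  have hf : (freq k : ℂ) ^ 2 ≠ 0 := pow_ne_zero _ (by exact_mod_cast (freq_pos k).ne')
  refine mul_left_cancel₀ hf ?_
  rw [slope_apply, phase_apply, phase_apply]
  linear_combination -osc k s * slope_apply a k

theorem norm_slope (a : H) : ‖slope a‖ = ‖incl (D1 a)‖ := norm_coeffs (integral_incl_two (isAdm_S a))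

theorem integrable_phase_neg {μ : Measure ℝ} {f : ℝ → H} (hf : Integrable f μ) :
    Integrable (fun s => phase (-s) (f s)) μ := by
  have hc : Continuous fun p : ℝ × H => phase (-p.1) p.2 :=
    continuous_phase (s := fun p : ℝ × H => -p.1) (a := fun p => p.2) continuous_fst.neg continuous_snd
  have h2 : AEStronglyMeasurable (fun s => (s, f s)) μ :=
    (continuous_id (X := ℝ)).aestronglyMeasurable.prodMk hf.1
  have hm := Continuous.comp_aestronglyMeasurable (f := fun s => (s, f s)) hc h2
  exact hf.mono hm (Filter.Eventually.of_forall fun s => (norm_phase _ _).le)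

theorem intervalIntegrable_phase_neg {f : ℝ → H} (hf : IntervalIntegrable f volume 0 T) :
    IntervalIntegrable (fun s => phase (-s) (f s)) volume 0 T :=
  ⟨integrable_phase_neg hf.1, integrable_phase_neg hf.2⟩

/-- At the level of first derivatives no boundary term is left: the forcing vanishes at the ends, so
its derivative has zero mean and its cosine coefficients are those required. In the interaction
picture the slope thus has an integrable time derivative in `ℓ²`. -/
theorem IsDuh.isPrim_slope {y : Path 0 T H} {n : ℝ → Z} (h : IsDuh y n) (hn : ∀ s, IsAdm (n s)) :
    IsPrim 0 T (fun t => slope (y.val t)) (fun s => phase (-s) (coeffs (incl (n s).2.1))) := by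
  have i0 : IntervalIntegrable (fun s => (n s).2.1) volume 0 T :=
    ⟨h.integrable.1.snd.fst, h.integrable.2.snd.fst⟩
  have i1 : IntervalIntegrable (fun s => coeffs (incl (n s).2.1)) volume 0 T :=
    ⟨(coeffs ∘L incl).integrable_comp i0.1, (coeffs ∘L incl).integrable_comp i0.2⟩
  have i2 := intervalIntegrable_phase_neg i1
  refine ⟨i2, fun t ht => ?_⟩
  have h0 : (0 : ℝ) ∈ Icc 0 T := ⟨le_rfl, hT.out⟩
  have hi := i2.mono_set (c := 0) (d := t) (by
    rw [uIcc_of_le hT.out]; exact uIcc_subset_Icc h0 ht)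
  ext k
  have hf : (freq k : ℂ) ^ 2 ≠ 0 := pow_ne_zero _ (by exact_mod_cast (freq_pos k).ne')
  refine mul_left_cancel₀ hf ?_
  change (freq k : ℂ) ^ 2 * slope (y.val t) k = (freq k : ℂ) ^ 2 * (slope (y.val 0) k
    + lp.evalCLM ℂ (fun _ : ℕ => ℂ) 2 k (∫ s in (0 : ℝ)..t, phase (-s) (coeffs (incl (n s).2.1))))
  rw [← ContinuousLinearMap.intervalIntegral_comp_comm _ hi, mul_add,
    slope_apply, slope_apply, ← intervalIntegral.integral_const_mul]
  have e := (h.coord k).eq t ht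
  have e2 : ∀ s, (freq k : ℂ) ^ 2 * lp.evalCLM ℂ (fun _ : ℕ => ℂ) 2 k (phase (-s) (coeffs (incl (n s).2.1)))
      = -(osc k (-s) * lam k (n s)) := fun s => by
    change (freq k : ℂ) ^ 2 * (osc k (-s) * coeffs (incl (n s).2.1) k) = _
    linear_combination osc k (-s) * freq_sq_mul_coeffs k (hn s)
  simp_rw [e2]
  rw [intervalIntegral.integral_neg]
  linear_combination -e

/-- The free group commutes with `slope` and preserves its norm, so the kinetic energy may be
computed in the interaction picture, where only the forcing contributes. -/
theorem IsDuh.isPrim_norm_D1 {y : Path 0 T H} {n : ℝ → Z} (h : IsDuh y n) (hn : ∀ s, IsAdm (n s)) :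
    IsPrim 0 T (fun t => ‖incl (D1 ((rot y).val t))‖ ^ 2)
      (fun s => 2 * (inner ℂ (incl (D1 ((rot y).val s))) (incl (n s).2.1)).re) := by
  refine (((h.isPrim_slope hn).norm_sq hT.out).congr fun t ht => ?_).congr_ae hT.out <|
    .of_forall fun s hs => ?_
  · rw [rot_val y ht, ← norm_slope, slope_phase, norm_phase]
  · rw [inner_phase_neg, ← slope_phase, ← rot_val y (Ioo_subset_Icc_self hs)]
    change 2 * (inner ℂ (coeffs (incl (D1 ((rot y).val s)))) _ : ℂ).re = _
    rw [inner_coeffs (f := incl (D1 ((rot y).val s))) (integral_incl_two (isAdm_S ((rot y).val s)))]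

theorem IsDuh.isPrim_norm_D0 {y : Path 0 T H} {n : ℝ → Z} (h : IsDuh y n) (hn : ∀ s, IsAdm (n s)) :
    IsPrim 0 T (fun t => ‖incl (D0 ((rot y).val t))‖ ^ 2)
      (fun s => 2 * (inner ℂ (incl (D0 ((rot y).val s)))
        (incl (Complex.I • D2 ((rot y).val s) + (n s).1))).re) :=
  ((h.isPrim_D0 hn).clm_comp (incl.restrictScalars ℝ)).norm_sq hT.out

/-- The position density. -/
def dens (a : H) : K := conjK (D0 a) * D0 a

theorem ext_dens (a : H) (x : ℝ) : ext (dens a) x = ((‖ext (D0 a) x‖ ^ 2 : ℝ) : ℂ) := by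
  rw [dens, ext_mul, ext_conjK, mul_comm, Complex.mul_conj, Complex.normSq_eq_norm_sq]

theorem ext_cub_S (a : H) (x : ℝ) :
    ext (cub (S a) (S a) (S a)).1 x = ((‖ext (D0 a) x‖ ^ 2 : ℝ) : ℂ) * ext (D0 a) x := by
  rw [← ext_dens]
  simp only [cub, mulZ_apply, mulZFun, conjZ_apply, S_apply, ext_mul, dens, ext_conjK]
  ring

/-- The squared norm of the density is `∫ |χ|⁴`. The two halves of the time derivative of the
density give complex conjugate inner products, whence the factor `4`. -/
theorem IsDuh.isPrim_norm_dens {y : Path 0 T H} {n : ℝ → Z} (h : IsDuh y n) (hn : ∀ s, IsAdm (n s)) :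
    IsPrim 0 T (fun t => ‖incl (dens ((rot y).val t))‖ ^ 2)
      (fun s => 4 * (inner ℂ (incl (cub (S ((rot y).val s)) (S ((rot y).val s)) (S ((rot y).val s))).1)
        (incl (Complex.I • D2 ((rot y).val s) + (n s).1))).re) := by
  have h1 := h.isPrim_D0 hn
  have h2 := (h1.clm_comp conjK).bilinear (ContinuousLinearMap.mul ℝ K) hT.out h1
  have h3 := (h2.clm_comp (incl.restrictScalars ℝ)).norm_sq hT.out
  refine h3.congr_ae hT.out <| .of_forall fun s _ => ?_
  set a := (rot y).val s
  set f := Complex.I • D2 a + (n s).1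
  change 2 * (inner ℂ (incl (dens a)) (incl (conjK (D0 a) * f + conjK f * D0 a)) : ℂ).re = _
  have e : inner ℂ (incl (dens a)) (incl (conjK f * D0 a))
      = starRingEnd ℂ (inner ℂ (incl (dens a)) (incl (conjK (D0 a) * f))) := by
    rw [inner_incl_incl, inner_incl_incl, ← intervalIntegral.intervalIntegral_conj]
    refine intervalIntegral.integral_congr fun x _ => ?_
    simp only [ext_mul, ext_conjK, ext_dens, map_mul, Complex.conj_ofReal, Complex.conj_conj]
    ring
  have e2 : inner ℂ (incl (dens a)) (incl (conjK (D0 a) * f))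
      = inner ℂ (incl (cub (S a) (S a) (S a)).1) (incl f) := by
    rw [inner_incl_incl, inner_incl_incl]
    refine intervalIntegral.integral_congr fun x _ => ?_
    simp only [ext_mul, ext_conjK, ext_dens, map_mul, Complex.conj_ofReal, ext_cub_S]
    ring
  rw [map_add, inner_add_right, e, e2, Complex.add_re, Complex.conj_re]
  ring

end Energy

/-! ### The balance of mass and energy. -/

section EnergyRates

theorem ext_sqZ {x : ℝ} (hx : x ∈ Icc (0 : ℝ) 1) : ext sqZ.1 x = ((x ^ 2 : ℝ) : ℂ) := by
  rw [ext_apply _ hx]; push_cast; rfl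

theorem inner_incl_congr_ofReal {f g : K} {r : ℝ → ℝ}
    (h : ∀ x ∈ Icc (0 : ℝ) 1, starRingEnd ℂ (ext f x) * ext g x = r x) :
    (inner ℂ (incl f) (incl g) : ℂ).im = 0 := by
  rw [inner_incl_incl, intervalIntegral.integral_congr (g := fun x => ((r x : ℝ) : ℂ)) fun x hx =>
    h x (by rwa [uIcc_of_le zero_le_one] at hx), intervalIntegral.integral_ofReal, Complex.ofReal_im]

theorem inner_D0_cub_im (a : H) :
    (inner ℂ (incl (D0 a)) (incl (cub (S a) (S a) (S a)).1) : ℂ).im = 0 :=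
  inner_incl_congr_ofReal (r := fun x => ‖ext (D0 a) x‖ ^ 4) fun x _ => by
    rw [ext_cub_S, mul_left_comm, mul_comm (starRingEnd ℂ _), Complex.mul_conj, Complex.normSq_eq_norm_sq,
      ← Complex.ofReal_mul]
    congr 1; ring

theorem inner_cub_sq_im (a : H) :
    (inner ℂ (incl (cub (S a) (S a) (S a)).1) (incl (sqZ.1 * D0 a)) : ℂ).im = 0 :=
  inner_incl_congr_ofReal (r := fun x => ‖ext (D0 a) x‖ ^ 4 * x ^ 2) fun x hx => by
    have := Complex.mul_conj (ext (D0 a) x)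
    rw [Complex.normSq_eq_norm_sq] at this
    rw [ext_cub_S, ext_mul, ext_sqZ hx, map_mul, Complex.conj_ofReal]
    push_cast at this ⊢
    linear_combination (‖ext (D0 a) x‖ : ℂ) ^ 2 * (x : ℂ) ^ 2 * this

theorem inner_sq_im (f : K) : (inner ℂ (incl f) (incl (sqZ.1 * f)) : ℂ).im = 0 :=
  inner_incl_congr_ofReal (r := fun x => ‖ext f x‖ ^ 2 * x ^ 2) fun x hx => by
    have := Complex.mul_conj (ext f x)
    rw [Complex.normSq_eq_norm_sq] at this
    rw [ext_mul, ext_sqZ hx]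
    push_cast at this ⊢
    linear_combination (x : ℂ) ^ 2 * this

theorem inner_cub_D0 (a : H) :
    inner ℂ (incl (cub (S a) (S a) (S a)).1) (incl (D0 a)) = ((‖incl (dens a)‖ ^ 2 : ℝ) : ℂ) := by
  rw [norm_incl_sq]
  refine inner_incl_eq_ofReal fun x => ?_
  have := Complex.mul_conj (ext (D0 a) x)
  rw [Complex.normSq_eq_norm_sq] at this
  rw [ext_cub_S, map_mul, Complex.conj_ofReal, ext_dens, Complex.norm_real, norm_pow, norm_norm]
  push_cast at this ⊢
  linear_combination (‖ext (D0 a) x‖ : ℂ) ^ 2 * this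

theorem inner_self_incl (f : K) : inner ℂ (incl f) (incl f) = ((‖incl f‖ ^ 2 : ℝ) : ℂ) := by
  rw [inner_self_eq_norm_sq_to_K]; push_cast; rfl

/-- The contribution of the potential to the growth of the kinetic energy. -/
def drift (a : H) : ℝ := (Complex.I * inner ℂ (incl (D1 a)) (incl (sqZ.2.1 * D0 a))).re

theorem abs_drift_le (a : H) : |drift a| ≤ 2 * (‖incl (D1 a)‖ * ‖incl (D0 a)‖) := by
  refine (Complex.abs_re_le_norm _).trans ?_
  rw [norm_mul, Complex.norm_I, one_mul]
  refine (norm_inner_le_norm _ _).trans ?_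
  have h : ‖sqZ.2.1‖ ≤ 2 := (ContinuousMap.norm_le _ zero_le_two).mpr fun x => by
    change ‖2 * ((x : ℝ) : ℂ)‖ ≤ 2
    rw [norm_mul, Complex.norm_real, Complex.norm_two, Real.norm_of_nonneg x.2.1]
    linarith [x.2.2]
  have h2 := norm_incl_mul_le sqZ.2.1 (D0 a)
  have h3 : ‖sqZ.2.1‖ * ‖incl (D0 a)‖ ≤ 2 * ‖incl (D0 a)‖ := by gcongr
  have h4 := mul_le_mul_of_nonneg_left (h2.trans h3) (norm_nonneg (incl (D1 a)))
  linarith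

/-- The exchange between kinetic and interaction energy. -/
def exchange (a : H) : ℝ :=
  (inner ℂ (incl (D1 a)) (incl (cub (S a) (S a) (S a)).2.1) : ℂ).im

/-- The terms `i χ''`, `i |χ|² χ` and `i x² χ` are `i` times a quantity whose inner product with `χ`
is real; only the damping contributes to the mass. -/
theorem rate_mass (σ u v : ℝ) (a : H) :
    2 * (inner ℂ (incl (D0 a)) (incl (Complex.I • D2 a + (forcing σ u v a).1))).re
      = u * ‖incl (D0 a)‖ ^ 2 := by
  have h1 := inner_incl_D2 (isAdm_S a) a
  rw [show (S a).1 = D0 a from rfl, show (S a).2.1 = D1 a from rfl, inner_self_incl] at h1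
  have h2 := inner_D0_cub_im a
  have h3 := inner_sq_im (D0 a)
  rw [forcing_one]
  simp only [map_add, map_smul, inner_add_right, inner_smul_right, inner_self_incl, h1]
  simp only [Complex.add_re, Complex.mul_re, Complex.mul_im, h2, h3, Complex.I_re, Complex.I_im,
    Complex.ofReal_re, Complex.ofReal_im, Complex.neg_im, Complex.neg_re, Complex.div_ofNat_re,
    Complex.div_ofNat_im]
  ring

theorem rate_kinetic (σ u v : ℝ) (a : H) :
    2 * (inner ℂ (incl (D1 a)) (incl (forcing σ u v a).2.1)).re
      = -2 * σ * exchange a + u * ‖incl (D1 a)‖ ^ 2 + 2 * v * drift a := by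
  have h3 := inner_sq_im (D1 a)
  rw [forcing_two]
  simp only [map_add, map_smul, inner_add_right, inner_smul_right, inner_self_incl, drift, exchange]
  simp only [Complex.add_re, Complex.mul_re, Complex.mul_im, Complex.add_im, h3, Complex.I_re,
    Complex.I_im,
    Complex.ofReal_re, Complex.ofReal_im, Complex.neg_im, Complex.neg_re, Complex.div_ofNat_re,
    Complex.div_ofNat_im]
  ring

/-- The free term, integrated by parts, produces the same `exchange` that the cubic term produces in
`rate_kinetic`. The two cancel in the kinetic energy minus `σ / 2` times the interaction. -/
theorem rate_interaction (σ u v : ℝ) (a : H) :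
    4 * (inner ℂ (incl (cub (S a) (S a) (S a)).1)
        (incl (Complex.I • D2 a + (forcing σ u v a).1))).re
      = -4 * exchange a + 2 * u * ‖incl (dens a)‖ ^ 2 := by
  have h1 := inner_incl_D2 (isAdm_cub_S a) a
  have h2 := inner_cub_sq_im a
  rw [forcing_one]
  simp only [map_add, map_smul, inner_add_right, inner_smul_right, inner_self_incl, inner_cub_D0,
    exchange]
  have h4 := congrArg Complex.im h1
  rw [Complex.neg_im] at h4
  rw [← inner_conj_symm (incl (D1 a))]
  simp only [Complex.add_re, Complex.mul_re, Complex.mul_im, Complex.add_im, h2, Complex.I_re,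
    Complex.I_im, Complex.conj_im, Complex.conj_re,
    Complex.ofReal_re, Complex.ofReal_im, Complex.neg_im, Complex.neg_re, Complex.div_ofNat_re,
    Complex.div_ofNat_im]
  linarith

/-- A Gagliardo-Nirenberg inequality: at bounded mass the quartic integral grows only linearly in
the `L²` norm of the derivative, so it cannot compete with the kinetic energy, even in the focusing
case. -/
theorem norm_dens_sq_le (a : H) :
    ‖incl (dens a)‖ ^ 2 ≤ (‖incl (D0 a)‖ ^ 2 + 2 * ‖incl (D0 a)‖ * ‖incl (D1 a)‖) * ‖incl (D0 a)‖ ^ 2 := by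
  have h1 : ‖incl (dens a)‖ ≤ ‖D0 a‖ * ‖incl (D0 a)‖ := by
    rw [dens, ← norm_conjK]; exact norm_incl_mul_le _ _
  have h2 := norm_ext_sq_le ((isJet_S a).one.congr_L2_symm (incl_ae _))
  calc ‖incl (dens a)‖ ^ 2 ≤ (‖D0 a‖ * ‖incl (D0 a)‖) ^ 2 := by gcongr
    _ = ‖D0 a‖ ^ 2 * ‖incl (D0 a)‖ ^ 2 := by ring
    _ ≤ _ := by gcongr; exact h2

end EnergyRates

theorem gronwall_of_isPrim {a b : ℝ} {f r k : ℝ → ℝ} (hab : a ≤ b) (h : IsPrim a b f r)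
    (hk : IntervalIntegrable k volume a b) (hk0 : ∀ t, 0 ≤ k t)
    (hr : ∀ s ∈ Icc a b, r s ≤ k s * f s) :
    ∀ t ∈ Icc a b, f t ≤ 2 * |f a| * Real.exp (2 * ∫ s in a..b, k s) := by
  have hf := h.continuousOn hab
  have ha : a ∈ Icc a b := ⟨le_rfl, hab⟩
  refine gronwall_of_integral_le hab hk hk0 hf fun x hx => ?_
  rw [h.eq x hx]
  have hs : uIcc a x ⊆ uIcc a b := by rw [uIcc_of_le hab]; exact uIcc_subset_Icc ha hx
  have hi : IntervalIntegrable (fun s => k s * f s) volume a x :=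
    (hk.mono_set hs).mul_continuousOn (hf.mono (by rwa [uIcc_of_le hab] at hs))
  have := intervalIntegral.integral_mono_on hx.1 (h.intervalIntegrable_of_mem ha hx) hi
    fun s hs => hr s ⟨hs.1, hs.2.trans hx.2⟩
  linarith

/-! ### A priori bounds on mass and kinetic energy. -/

section Bounds

variable {T : ℝ} [hT : Fact (0 ≤ T)]

theorem integral_abs_L2_le (w : L2 ℝ 0 T) : ∫ t in (0 : ℝ)..T, |w t| ≤ √T * ‖w‖ := by
  have h1 := intervalIntegrable_L2 w
  have h2 := intervalIntegrable_norm_sq_L2 w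
  have h3 := sq_integral_le_mul_integral_sq hT.out h1.norm h2
  rw [← norm_sq_L2, sub_zero] at h3
  refine abs_le_of_sq_le_sq (a := ∫ t in (0 : ℝ)..T, ‖w t‖) ?_ (by positivity) |>.trans' (le_abs_self _)
  rwa [mul_pow, Real.sq_sqrt hT.out]

theorem exists_bound_wts (r : ℝ) : ∃ B, 0 ≤ B ∧ ∀ p : L2 ℝ 0 T × ℝ, ‖p‖ ≤ r →
    |p.2| ≤ B ∧ ‖prim p.1‖ ≤ B ∧ ‖vel p.1‖ ≤ B := by
  set c := √T
  have hc : 0 ≤ c := Real.sqrt_nonneg _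
  set I := ‖(incl : C(Icc 0 T, ℝ) →L[ℝ] L2 ℝ 0 T)‖
  refine ⟨|r| + c * |r| + (I * (c * |r|) ^ 2 + |r|), by positivity, fun p hp => ?_⟩
  have hp : ‖p‖ ≤ |r| := hp.trans (le_abs_self r)
  have h1 : ‖p.1‖ ≤ |r| := (norm_fst_le p).trans hp
  have h2 : |p.2| ≤ |r| := (norm_snd_le p).trans hp
  have h3 : ‖prim p.1‖ ≤ c * |r| := by
    have := norm_prim_le p.1
    rw [sub_zero] at this
    exact this.trans (by gcongr)
  have h4 : ‖vel p.1‖ ≤ I * (c * |r|) ^ 2 + |r| := by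
    rw [vel, norm_smul]
    have e1 : ‖incl (prim p.1 * prim p.1)‖ ≤ I * (c * |r|) ^ 2 := by
      refine (ContinuousLinearMap.le_opNorm _ _).trans ?_
      have : ‖prim p.1 * prim p.1‖ ≤ (c * |r|) ^ 2 := by
        rw [pow_two]; exact (norm_mul_le _ _).trans (by gcongr)
      gcongr
    have e2 := norm_sub_le (incl (prim p.1 * prim p.1)) p.1
    have e3 := norm_nonneg (incl (prim p.1 * prim p.1) - p.1)
    norm_num
    linarith
  have p1 : 0 ≤ |r| := abs_nonneg r
  have p2 : 0 ≤ c * |r| := by positivity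
  have p3 : 0 ≤ I * (c * |r|) ^ 2 := by positivity
  exact ⟨by linarith, by linarith, by linarith⟩

variable {a₀ : H} {p : L2 ℝ 0 T × ℝ} {y : Path 0 T H}

theorem val_zero_of_solves (h : (model T a₀).Solves (wts p) y) : y.val 0 = a₀ := by
  have e : y = Path.mk (fun _ => a₀) continuousOn_const + (duh (wts p).1 (cubic y y y)
      + duh (wts p).2.1 (damp y) + duh (wts p).2.2 (pot y)) := h
  have h0 : (0 : ℝ) ∈ Icc 0 T := ⟨le_rfl, hT.out⟩
  have hz : ∀ w f, (duh (T := T) w f).val 0 = 0 := fun w f => by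
    ext k
    rw [duh_val_apply w f h0, intervalIntegral.integral_same]; rfl
  rw [e, Path.val_add, Path.val_add, Path.val_add, hz, hz, hz, Path.val_mk _ h0]
  simp

theorem rot_zero_of_solves (h : (model T a₀).Solves (wts p) y) : (rot y).val 0 = a₀ := by
  rw [rot_val y ⟨le_rfl, hT.out⟩, phase_zero, val_zero_of_solves h]

theorem isPrim_mass (h : (model T a₀).Solves (wts p) y) :
    IsPrim 0 T (fun t => ‖incl (D0 ((rot y).val t))‖ ^ 2)
      (fun s => ext (prim p.1) s * ‖incl (D0 ((rot y).val s))‖ ^ 2) :=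
  ((isDuh_of_solves h).isPrim_norm_D0 fun s => isAdm_forcing _ _ _ _).congr_ae hT.out <|
    .of_forall fun s _ => rate_mass _ _ _ _

theorem isPrim_energy (h : (model T a₀).Solves (wts p) y) :
    IsPrim 0 T (fun t => ‖incl (D1 ((rot y).val t))‖ ^ 2
        + (-p.2 / 2) * ‖incl (dens ((rot y).val t))‖ ^ 2)
      (fun s => ext (prim p.1) s * ‖incl (D1 ((rot y).val s))‖ ^ 2
        - p.2 * ext (prim p.1) s * ‖incl (dens ((rot y).val s))‖ ^ 2
        + 2 * vel p.1 s * drift ((rot y).val s)) := by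
  have hd := isDuh_of_solves h
  have ha := fun s => isAdm_forcing p.2 (ext (prim p.1) s) (vel p.1 s) ((rot y).val s)
  refine ((hd.isPrim_norm_D1 ha).add ((hd.isPrim_norm_dens ha).clm_comp
    ((-p.2 / 2) • ContinuousLinearMap.id ℝ ℝ))).congr_ae hT.out <| .of_forall fun s _ => ?_
  change _ + (-p.2 / 2) * (4 * _) = _
  rw [rate_kinetic, rate_interaction]
  ring

theorem exists_bound_mass (a₀ : H) (r : ℝ) : ∃ m, 0 ≤ m ∧ ∀ p : L2 ℝ 0 T × ℝ, ‖p‖ ≤ r →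
    ∀ y, (model T a₀).Solves (wts p) y → ∀ t ∈ Icc 0 T, ‖incl (D0 ((rot y).val t))‖ ≤ m := by
  obtain ⟨B, hB, hb⟩ := exists_bound_wts (T := T) r
  refine ⟨√(2 * |‖incl (D0 a₀)‖ ^ 2| * Real.exp (2 * ∫ t in (0 : ℝ)..T, B)), Real.sqrt_nonneg _,
    fun p hp y h t ht => Real.le_sqrt_of_sq_le ?_⟩
  have hm := isPrim_mass h
  have key := gronwall_of_isPrim (k := fun _ => B) hT.out hm intervalIntegrable_const (fun _ => hB)
    (fun s _ => mul_le_mul_of_nonneg_right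
      ((le_abs_self _).trans ((norm_ext_le (prim p.1) s).trans (hb p hp).2.1)) (sq_nonneg _)) t ht
  rwa [rot_zero_of_solves h] at key

/-- The energy controls the kinetic part because half of `N²` absorbs the quartic term. Its rate is
at most `κ (1 + |v|) (N² + 1)`; since `v` is only square integrable in time, Grönwall's inequality
is used with an integrable weight. -/
theorem exists_bound_kinetic (a₀ : H) (r : ℝ) : ∃ m, 0 ≤ m ∧ ∀ p : L2 ℝ 0 T × ℝ, ‖p‖ ≤ r →
    ∀ y, (model T a₀).Solves (wts p) y → ∀ t ∈ Icc 0 T, ‖incl (D1 ((rot y).val t))‖ ^ 2 ≤ m := by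
  obtain ⟨B, hB, hb⟩ := exists_bound_wts (T := T) r
  obtain ⟨m, hm0, hm⟩ := exists_bound_mass (T := T) a₀ r
  -- The summands bound, in order, the damping, the quartic term (by `q1`) and the drift (by `q2`)
  -- against `N² + 1`.
  set κ := B + B ^ 2 * (m ^ 4 + m ^ 6 + 1) + 2 * (1 + m ^ 2)
  have hκ : 0 ≤ κ := by positivity
  -- What Young's inequality `B m³ N ≤ B² m⁶ / 2 + N² / 2` leaves of the quartic term besides `N² /
  -- 2`.
  set C1 := B * m ^ 4 / 2 + B ^ 2 * m ^ 6 / 2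
  set C := 1 + 2 * (‖incl (D1 a₀)‖ ^ 2 + B / 2 * ‖incl (dens a₀)‖ ^ 2) + 2 * C1
  refine ⟨2 * |C| * Real.exp (2 * (2 * κ * (T + √T * B))), by positivity, fun p hp y h t ht => ?_⟩
  obtain ⟨b1, b2, b3⟩ := hb p hp
  have he := isPrim_energy h
  have hM := hm p hp y h
  set N : ℝ → ℝ := fun t => ‖incl (D1 ((rot y).val t))‖ with hN
  set Q : ℝ → ℝ := fun t => ‖incl (dens ((rot y).val t))‖ ^ 2 with hQ
  have hN0 : ∀ t, 0 ≤ N t := fun t => norm_nonneg _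
  have hQ0 : ∀ t, 0 ≤ Q t := fun t => by positivity
  have hcN : Continuous N := ((incl ∘L D1).continuous.comp (rot y).continuous_val).norm
  have hQN : ∀ t ∈ Icc 0 T, Q t ≤ m ^ 4 + 2 * m ^ 3 * N t := fun t ht => by
    refine (norm_dens_sq_le _).trans ?_
    have h1 := hM t ht
    have h2 : 0 ≤ ‖incl (D0 ((rot y).val t))‖ := norm_nonneg _
    have h3 : 0 ≤ ‖incl (D1 ((rot y).val t))‖ := norm_nonneg _
    calc _ ≤ (m ^ 2 + 2 * m * ‖incl (D1 ((rot y).val t))‖) * m ^ 2 := by gcongr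
      _ = _ := by rw [hN]; ring
  have hQ1 : ∀ t ∈ Icc 0 T, Q t ≤ m ^ 4 + m ^ 6 + N t ^ 2 := fun t ht => by
    nlinarith [hQN t ht, sq_nonneg (m ^ 3 - N t)]
  have hQ2 : ∀ t ∈ Icc 0 T, p.2 / 2 * Q t ≤ C1 + N t ^ 2 / 2 := fun t ht => by
    have h1 : p.2 / 2 * Q t ≤ B / 2 * (m ^ 4 + 2 * m ^ 3 * N t) := by
      have := (le_abs_self p.2).trans b1
      have h2 := hQN t ht
      have h3 := hQ0 t
      gcongr
    have := sq_nonneg (B * m ^ 3 - N t)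
    have e : C1 = B * m ^ 4 / 2 + B ^ 2 * m ^ 6 / 2 := rfl
    nlinarith
  have hk : IntervalIntegrable (fun s => 2 * κ * (1 + |vel p.1 s|)) volume 0 T :=
    (intervalIntegrable_const.add (intervalIntegrable_L2 (vel p.1)).abs).const_mul _
  have rate : ∀ s ∈ Icc 0 T, ext (prim p.1) s * N s ^ 2 - p.2 * ext (prim p.1) s * Q s
      + 2 * vel p.1 s * drift ((rot y).val s) ≤ κ * (1 + |vel p.1 s|) * (N s ^ 2 + 1) := fun s hs => by
    set u := ext (prim p.1) s
    set v := vel p.1 s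
    have hu : |u| ≤ B := (norm_ext_le (prim p.1) s).trans b2
    have hd : |drift ((rot y).val s)| ≤ N s ^ 2 + m ^ 2 := by
      have h1 := abs_drift_le ((rot y).val s)
      have h2 : N s * ‖incl (D0 ((rot y).val s))‖ ≤ N s * m :=
        mul_le_mul_of_nonneg_left (hM s hs) (hN0 s)
      change _ ≤ 2 * (N s * _) at h1
      nlinarith [sq_nonneg (N s - m)]
    have t1 : u * N s ^ 2 ≤ B * N s ^ 2 := by
      have := (le_abs_self u).trans hu
      gcongr
    have t2 : -(p.2 * u) * Q s ≤ B ^ 2 * (m ^ 4 + m ^ 6 + N s ^ 2) := by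
      have h1 : -(p.2 * u) ≤ B ^ 2 := by
        refine (neg_le_abs _).trans ?_
        rw [abs_mul, pow_two]
        gcongr
      have h2 := hQ1 s hs
      have h3 := hQ0 s
      gcongr
    have t3 : 2 * v * drift ((rot y).val s) ≤ 2 * |v| * (N s ^ 2 + m ^ 2) := by
      refine (le_abs_self _).trans ?_
      rw [abs_mul, abs_mul, abs_two]
      gcongr
    have hv : 0 ≤ |v| := abs_nonneg v
    have hn : 0 ≤ N s ^ 2 := by positivity
    have q1 : B ^ 2 * (m ^ 4 + m ^ 6 + N s ^ 2) ≤ B ^ 2 * (m ^ 4 + m ^ 6 + 1) * (N s ^ 2 + 1) := by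
      have : 0 ≤ B ^ 2 * (m ^ 4 + m ^ 6) * N s ^ 2 := by positivity
      nlinarith [sq_nonneg B]
    have q2 : 2 * |v| * (N s ^ 2 + m ^ 2) ≤ 2 * (1 + m ^ 2) * |v| * (N s ^ 2 + 1) := by
      have : 0 ≤ |v| * (m ^ 2 * N s ^ 2) := by positivity
      nlinarith
    have q3 : 0 ≤ (B + B ^ 2 * (m ^ 4 + m ^ 6 + 1)) * |v| * (N s ^ 2 + 1) := by positivity
    have q4 : 0 ≤ 2 * (1 + m ^ 2) * (N s ^ 2 + 1) := by positivity
    have e : κ = B + B ^ 2 * (m ^ 4 + m ^ 6 + 1) + 2 * (1 + m ^ 2) := rfl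
    rw [e]
    nlinarith
  -- Adding `1` makes the affine bound on the rate linear. The factor `2 κ` appears because only
  -- half of `N²` is left after absorption.
  have key := gronwall_of_integral_le (f := fun t => N t ^ 2 + 1) (C := C) hT.out hk
    (fun s => by positivity) (by fun_prop) (fun x hx => ?_) t ht
  · have hi : ∫ s in (0 : ℝ)..T, 2 * κ * (1 + |vel p.1 s|) ≤ 2 * κ * (T + √T * B) := by
      rw [intervalIntegral.integral_const_mul, intervalIntegral.integral_add (by simp)
        (intervalIntegrable_L2 (vel p.1)).abs, intervalIntegral.integral_const, smul_eq_mul, mul_one,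
        sub_zero]
      have := integral_abs_L2_le (vel p.1)
      have h2 : √T * ‖vel p.1‖ ≤ √T * B := by gcongr
      gcongr
      exact this.trans h2
    have h3 : 2 * |C| * Real.exp (2 * ∫ s in (0 : ℝ)..T, 2 * κ * (1 + |vel p.1 s|))
        ≤ 2 * |C| * Real.exp (2 * (2 * κ * (T + √T * B))) := by gcongr
    have h4 : N t ^ 2 + 1 ≤ _ := key.trans h3
    change N t ^ 2 ≤ _
    linarith
  · have e := he.eq x hx
    rw [rot_zero_of_solves h] at e
    have h0 : (0 : ℝ) ∈ Icc 0 T := ⟨le_rfl, hT.out⟩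
    have hkx := hk.mono_set (c := 0) (d := x) (by
      rw [uIcc_of_le hT.out]; exact uIcc_subset_Icc h0 hx)
    have hkN : IntervalIntegrable (fun s => 2 * κ * (1 + |vel p.1 s|) * (N s ^ 2 + 1)) volume 0 x :=
      hkx.mul_continuousOn (by fun_prop)
    have mono := intervalIntegral.integral_mono_on hx.1 (he.intervalIntegrable_of_mem h0 hx)
      (hkN.const_mul (1 / 2)) fun s hs => (rate s ⟨hs.1, hs.2.trans hx.2⟩).trans_eq (by ring)
    rw [intervalIntegral.integral_const_mul] at mono
    have i0 : -p.2 / 2 * ‖incl (dens a₀)‖ ^ 2 ≤ B / 2 * ‖incl (dens a₀)‖ ^ 2 := by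
      have := (neg_le_abs p.2).trans b1
      gcongr
    have i1 := hQ2 x hx
    have e' : N x ^ 2 + -p.2 / 2 * Q x = _ := e
    have eC : C = 1 + 2 * (‖incl (D1 a₀)‖ ^ 2 + B / 2 * ‖incl (dens a₀)‖ ^ 2) + 2 * C1 := rfl
    linarith

end Bounds

/-! ### The `H³` bound and global existence of the profile. -/

section Existence

variable {T : ℝ} [hT : Fact (0 ≤ T)]

theorem continuous_N3_self : Continuous fun a : H => N3 a a a := by
  have h1 : Continuous fun a : H => mulZ (S a) (conjZ (S a)) :=
    (mulZ.continuous.comp S.continuous).clm_apply (conjZ.continuous.comp S.continuous)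
  have h2 : Continuous fun a : H => mulZ (mulZ (S a) (conjZ (S a))) (S a) :=
    (mulZ.continuous.comp h1).clm_apply S.continuous
  exact coeffs.continuous.comp h2.snd.snd.snd

theorem lam_I_smul_cub (k : ℕ) (a : H) :
    lam k (Complex.I • cub (S a) (S a) (S a)) = (Complex.I • N3 a a a : H) k := by
  rw [← lamL_apply, map_smul, ← S_N3, lamL_apply, lam_S]; rfl

/-- The cubic term stays in `H³₍₀₎`, so its `lam` carries no boundary values and the estimate
without smoothing applies. The bound is then in terms of `N3`, for which the tame estimate is
available, and not of the norm of the whole jet. -/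
theorem norm_duh_cubic_sq_le (w : L2 ℝ 0 T) (y : Path 0 T H) {t : ℝ} (ht : t ∈ Icc 0 T) :
    ‖(duh w (cubic y y y)).val t‖ ^ 2
      ≤ T * ∫ s in (0 : ℝ)..t, w s ^ 2 *
        ‖(Complex.I • N3 ((rot y).val s) ((rot y).val s) ((rot y).val s) : H)‖ ^ 2 := by
  have hc : Continuous fun s => (Complex.I • N3 ((rot y).val s) ((rot y).val s) ((rot y).val s) : H) :=
    (continuous_N3_self.comp (rot y).continuous_val).const_smul Complex.I
  refine norm_sq_H_le fun s => ?_
  refine le_trans (le_of_eq ?_) (sum_norm_integral_coord_sq_le w hc le_rfl ht.1 ht.2 s)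
  refine Finset.sum_congr rfl fun k _ => ?_
  rw [duh_val_apply w _ ht]
  simp_rw [cubic_val, lam_I_smul_cub]

theorem norm_sq_add_four_le {V : Type*} [NormedAddCommGroup V] (a b c d : V) :
    ‖a + (b + c + d)‖ ^ 2 ≤ 4 * (‖a‖ ^ 2 + ‖b‖ ^ 2 + ‖c‖ ^ 2 + ‖d‖ ^ 2) := by
  have h1 : ‖a + (b + c + d)‖ ≤ ‖a‖ + (‖b‖ + ‖c‖ + ‖d‖) :=
    (norm_add_le _ _).trans (by gcongr; exact norm_add₃_le)
  calc _ ≤ (‖a‖ + (‖b‖ + ‖c‖ + ‖d‖)) ^ 2 := by gcongr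
    _ ≤ _ := by
      nlinarith [sq_nonneg (‖a‖ - ‖b‖), sq_nonneg (‖a‖ - ‖c‖), sq_nonneg (‖a‖ - ‖d‖),
        sq_nonneg (‖b‖ - ‖c‖), sq_nonneg (‖b‖ - ‖d‖), sq_nonneg (‖c‖ - ‖d‖)]

theorem integral_sq_mul_le (w : L2 ℝ 0 T) {f g : ℝ → ℝ} (hf : Continuous f) (hg : Continuous g)
    {x : ℝ} (hx : x ∈ Icc 0 T) (h : ∀ s ∈ Icc 0 T, f s ≤ g s) :
    ∫ s in (0 : ℝ)..x, w s ^ 2 * f s ≤ ∫ s in (0 : ℝ)..x, w s ^ 2 * g s :=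
  intervalIntegral.integral_mono_on hx.1 (intervalIntegrable_sq_mul w hf le_rfl hx.1 hx.2)
    (intervalIntegrable_sq_mul w hg le_rfl hx.1 hx.2) fun s hs =>
      mul_le_mul_of_nonneg_left (h s ⟨hs.1, hs.2.trans hx.2⟩) (sq_nonneg _)

theorem norm_sq_smul_oneL2 {c : ℝ} : ‖(c • oneL2 T : L2 ℝ 0 T)‖ ^ 2 = c ^ 2 * T := by
  rw [← Semilinear.integral_sq, intervalIntegral.integral_of_le hT.out, integral_Ioc_eq_integral_Ioo,
    integral_congr_ae (g := fun _ => c ^ 2) ((oneL2_smul_ae c).mono fun s hs => by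
      change (c • oneL2 T : L2 ℝ 0 T) s ^ 2 = c ^ 2; rw [hs])]
  simp [hT.out]
  ring

theorem gronwall_sq_weights (w : Weights 0 T) {f : ℝ → ℝ} (hf : Continuous f) {C c₁ c₂ c₃ : ℝ} (h₁ : 0 ≤ c₁)
    (h₂ : 0 ≤ c₂) (h₃ : 0 ≤ c₃)
    (h : ∀ x ∈ Icc 0 T, f x ≤ C + 4 * (c₁ * (∫ s in (0 : ℝ)..x, w.1 s ^ 2 * f s)
          + c₂ * (∫ s in (0 : ℝ)..x, w.2.1 s ^ 2 * f s) + c₃ * ∫ s in (0 : ℝ)..x, w.2.2 s ^ 2 * f s)) :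
    ∀ t ∈ Icc 0 T, f t
      ≤ 2 * |C| * Real.exp (2 * (4 * (c₁ * ‖w.1‖ ^ 2 + c₂ * ‖w.2.1‖ ^ 2 + c₃ * ‖w.2.2‖ ^ 2))) := by
  have i1 := Semilinear.intervalIntegrable_sq w.1
  have i2 := Semilinear.intervalIntegrable_sq w.2.1
  have i3 := Semilinear.intervalIntegrable_sq w.2.2
  have hk : IntervalIntegrable (fun s => 4 * (c₁ * w.1 s ^ 2 + c₂ * w.2.1 s ^ 2
      + c₃ * w.2.2 s ^ 2)) volume 0 T :=
    (((i1.const_mul c₁).add (i2.const_mul c₂)).add (i3.const_mul c₃)).const_mul 4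
  have hi : ∫ s in (0 : ℝ)..T, 4 * (c₁ * w.1 s ^ 2 + c₂ * w.2.1 s ^ 2 + c₃ * w.2.2 s ^ 2)
      = 4 * (c₁ * ‖w.1‖ ^ 2 + c₂ * ‖w.2.1‖ ^ 2 + c₃ * ‖w.2.2‖ ^ 2) := by
    rw [intervalIntegral.integral_const_mul, intervalIntegral.integral_add ((i1.const_mul _).add
      (i2.const_mul _)) (i3.const_mul _), intervalIntegral.integral_add (i1.const_mul _) (i2.const_mul _),
      intervalIntegral.integral_const_mul, intervalIntegral.integral_const_mul,
      intervalIntegral.integral_const_mul, Semilinear.integral_sq, Semilinear.integral_sq,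
      Semilinear.integral_sq]
  rw [← hi]
  refine gronwall_of_integral_le hT.out hk (fun s => by positivity) hf.continuousOn fun x hx => ?_
  have j1 := intervalIntegrable_sq_mul w.1 hf le_rfl hx.1 hx.2
  have j2 := intervalIntegrable_sq_mul w.2.1 hf le_rfl hx.1 hx.2
  have j3 := intervalIntegrable_sq_mul w.2.2 hf le_rfl hx.1 hx.2
  refine (h x hx).trans_eq ?_
  rw [← intervalIntegral.integral_const_mul, ← intervalIntegral.integral_const_mul,
    ← intervalIntegral.integral_const_mul, ← intervalIntegral.integral_add (j1.const_mul _) (j2.const_mul _),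
    ← intervalIntegral.integral_add ((j1.const_mul _).add (j2.const_mul _)) (j3.const_mul _),
    ← intervalIntegral.integral_const_mul]
  congr 1
  refine intervalIntegral.integral_congr fun s _ => ?_
  ring

theorem integral_sq_mul_norm_sq_le (w : L2 ℝ 0 T) (y : Path 0 T H) {f : ℝ → ℝ} (hf : Continuous f) {C : ℝ}
    {x : ℝ} (hx : x ∈ Icc 0 T) (h0 : ∀ s, 0 ≤ f s)
    (h : ∀ s ∈ Icc 0 T, f s ≤ C * ‖y.val s‖) :
    ∫ s in (0 : ℝ)..x, w s ^ 2 * f s ^ 2 ≤ C ^ 2 * ∫ s in (0 : ℝ)..x, w s ^ 2 * ‖y.val s‖ ^ 2 := by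
  rw [← intervalIntegral.integral_const_mul]
  refine (integral_sq_mul_le w (g := fun s => (C * ‖y.val s‖) ^ 2) (hf.pow 2) ((continuous_const (y := C)).mul y.continuous_val.norm |>.pow 2)
    hx fun s hs => pow_le_pow_left₀ (h0 s) (h s hs) 2).trans_eq ?_
  refine intervalIntegral.integral_congr fun s _ => ?_
  ring

theorem norm_duh_damp_sq_le (w : L2 ℝ 0 T) (y : Path 0 T H) {x : ℝ} (hx : x ∈ Icc 0 T) :
    ‖(duh w (damp y)).val x‖ ^ 2
      ≤ duhC T * ((1 / 2 * ‖S‖) ^ 2 * ∫ s in (0 : ℝ)..x, w s ^ 2 * ‖y.val s‖ ^ 2) := by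
  refine (norm_duh_sq_le w (damp y) hx).trans (mul_le_mul_of_nonneg_left ?_ duhC_nonneg)
  refine integral_sq_mul_norm_sq_le w y (damp y).continuous_val.norm hx (fun _ => norm_nonneg _) fun s _ => ?_
  have h := S.le_opNorm ((rot y).val s)
  rw [norm_rot_val] at h
  have h2 : ‖(1 / 2 : ℝ)‖ = 1 / 2 := by norm_num
  rw [damp_val, norm_smul, h2, mul_assoc]
  gcongr

theorem norm_duh_pot_sq_le (w : L2 ℝ 0 T) (y : Path 0 T H) {x : ℝ} (hx : x ∈ Icc 0 T) :
    ‖(duh w (pot y)).val x‖ ^ 2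
      ≤ duhC T * ((mulC * ‖sqZ‖ * ‖S‖) ^ 2 * ∫ s in (0 : ℝ)..x, w s ^ 2 * ‖y.val s‖ ^ 2) := by
  refine (norm_duh_sq_le w (pot y) hx).trans (mul_le_mul_of_nonneg_left ?_ duhC_nonneg)
  refine integral_sq_mul_norm_sq_le w y (pot y).continuous_val.norm hx (fun _ => norm_nonneg _) fun s _ => ?_
  have h := S.le_opNorm ((rot y).val s)
  rw [norm_rot_val] at h
  have h4 := mulC_nonneg
  rw [pot_val, norm_I_smul, mul_assoc (mulC * ‖sqZ‖)]
  exact (norm_mulZ_le sqZ (S ((rot y).val s))).trans (by gcongr)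

theorem norm_duh_cubic_sq_le_of_kinetic (w : L2 ℝ 0 T) (y : Path 0 T H) {m : ℝ}
    (hm : ∀ t ∈ Icc 0 T, ‖incl (D1 ((rot y).val t))‖ ^ 2 ≤ m) {x : ℝ} (hx : x ∈ Icc 0 T) :
    ‖(duh w (cubic y y y)).val x‖ ^ 2
      ≤ T * ((45 * m) ^ 2 * ∫ s in (0 : ℝ)..x, w s ^ 2 * ‖y.val s‖ ^ 2) := by
  refine (norm_duh_cubic_sq_le w y hx).trans (mul_le_mul_of_nonneg_left ?_ hT.out)
  refine integral_sq_mul_norm_sq_le w y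
    (f := fun s => ‖(Complex.I • N3 ((rot y).val s) ((rot y).val s) ((rot y).val s) : H)‖) ((continuous_N3_self.comp (rot y).continuous_val).const_smul Complex.I).norm hx
    (fun _ => norm_nonneg _) fun s hs => ?_
  have h := norm_N3_self_le ((rot y).val s)
  rw [norm_rot_val] at h
  simp only [norm_smul, Complex.norm_I, one_mul]
  have h2 := hm s hs
  exact h.trans (by gcongr)

theorem val_of_solves {a₀ : H} {p : L2 ℝ 0 T × ℝ} {y : Path 0 T H} (h : (model T a₀).Solves (wts p) y)
    {x : ℝ} (hx : x ∈ Icc 0 T) : y.val x = a₀ + ((duh (wts p).1 (cubic y y y)).val x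
      + (duh (wts p).2.1 (damp y)).val x + (duh (wts p).2.2 (pot y)).val x) := by
  have e : y = Path.mk (fun _ => a₀) continuousOn_const + (duh (wts p).1 (cubic y y y)
      + duh (wts p).2.1 (damp y) + duh (wts p).2.2 (pot y)) := h
  conv_lhs => rw [e]
  rw [Path.val_add, Path.val_add, Path.val_add, Path.val_mk _ hx]

/-- With the kinetic energy bounded by `m`, the cubic term is at most `45 m ‖y‖`, so the integral
equation gives a linear inequality for `‖y‖²` and Grönwall's inequality closes without any
restriction on the size of the data. -/
theorem exists_bound_solves (a₀ : H) (r : ℝ) : ∃ R, ∀ p : L2 ℝ 0 T × ℝ, ‖p‖ ≤ r →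
    ∀ y, (model T a₀).Solves (wts p) y → ‖y‖ ≤ R := by
  obtain ⟨B, hB, hb⟩ := exists_bound_wts (T := T) r
  obtain ⟨m, hm0, hm⟩ := exists_bound_kinetic (T := T) a₀ r
  have hT0 := hT.out
  have hD := duhC_nonneg (T := T)
  refine ⟨√(2 * |4 * ‖a₀‖ ^ 2| * Real.exp (2 * (4 * (T * (45 * m) ^ 2 * (B ^ 2 * T)
    + duhC T * (1 / 2 * ‖S‖) ^ 2 * (‖(incl : C(Icc 0 T, ℝ) →L[ℝ] L2 ℝ 0 T)‖ * B) ^ 2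
    + duhC T * (mulC * ‖sqZ‖ * ‖S‖) ^ 2 * B ^ 2)))), fun p hp y h => ?_⟩
  refine Path.norm_le (Real.sqrt_nonneg _) fun t ht => Real.le_sqrt_of_sq_le ?_
  obtain ⟨b1, b2, b3⟩ := hb p hp
  have hN := hm p hp y h
  refine (gronwall_sq_weights (wts p) (f := fun s => ‖y.val s‖ ^ 2) (y.continuous_val.norm.pow 2) (C := 4 * ‖a₀‖ ^ 2)
    (c₁ := T * (45 * m) ^ 2) (c₂ := duhC T * (1 / 2 * ‖S‖) ^ 2)
    (c₃ := duhC T * (mulC * ‖sqZ‖ * ‖S‖) ^ 2) (by positivity) (by positivity) (by positivity)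
    (fun x hx => ?_) t ht).trans ?_
  · have d1 := norm_duh_cubic_sq_le_of_kinetic (wts p).1 y hN hx
    have d2 := norm_duh_damp_sq_le (wts p).2.1 y hx
    have d3 := norm_duh_pot_sq_le (wts p).2.2 y hx
    have hf := norm_sq_add_four_le a₀ ((duh (wts p).1 (cubic y y y)).val x)
      ((duh (wts p).2.1 (damp y)).val x) ((duh (wts p).2.2 (pot y)).val x)
    rw [← val_of_solves h hx] at hf
    rw [← mul_assoc] at d1 d2 d3
    linarith
  · have n1 : ‖(wts p).1‖ ^ 2 ≤ B ^ 2 * T := by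
      refine norm_sq_smul_oneL2.trans_le ?_
      have := sq_le_sq' (neg_le_of_abs_le b1) (le_of_abs_le b1)
      gcongr
    have n2 : ‖(wts p).2.1‖ ≤ ‖(incl : C(Icc 0 T, ℝ) →L[ℝ] L2 ℝ 0 T)‖ * B :=
      (ContinuousLinearMap.le_opNorm _ _).trans (by gcongr)
    have n3 : ‖(wts p).2.2‖ ≤ B := b3
    gcongr

/-- For zero control and zero coupling all weights vanish, and in the interaction picture the
solution is constant. This is the starting point of the continuation. -/
theorem model_solves_const (a₀ : H) :
    (model T a₀).Solves (wts (0 : L2 ℝ 0 T × ℝ)) (Path.mk (fun _ => a₀) continuousOn_const) := by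
  have : wts (0 : L2 ℝ 0 T × ℝ) = 0 := by
    simp [wts, vel]
  rw [this, Semilinear.Solves, map_zero, add_zero]
  rfl

theorem exists_contDiff_profile (T : ℝ) [hT : Fact (0 ≤ T)] (a₀ : H) : ∃ y : L2 ℝ 0 T × ℝ → Path 0 T H,
    (∀ p, (model T a₀).Solves (wts p) (y p)) ∧ ContDiff ℝ 1 y ∧
      ∀ p q, fderiv ℝ y p q = (model T a₀).diff (wts p) (y p) (y p) (fderiv ℝ y p q)
        + (model T a₀).op (y p) (fderiv ℝ wts p q) :=
  (model T a₀).exists_contDiff_solves contDiff_wts (exists_bound_solves a₀) (model_solves_const a₀)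

end Existence

/-! ### Functions with their first derivative, and operators from jets to them. -/

section FirstOrderPairs

/-- A continuous function together with its weak derivative. -/
def IsPair (r : K × L) : Prop := IsPrim 0 1 (ext r.1) r.2

theorem IsPair.add {r s : K × L} (hr : IsPair r) (hs : IsPair s) : IsPair (r + s) :=
  (IsPrim.add hr hs).congr_L2_symm (Lp.coeFn_add _ _)

theorem IsPair.smul {r : K × L} (c : ℂ) (hr : IsPair r) : IsPair (c • r) :=
  (IsPrim.const_mul c hr).congr_L2_symm (Lp.coeFn_smul _ _)

/-- The first two entries of a jet. -/
def trunc : Z →L[ℂ] K × L :=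
  (ContinuousLinearMap.fst ℂ K _).prod
    (incl ∘L ContinuousLinearMap.fst ℂ K _ ∘L ContinuousLinearMap.snd ℂ K _)

theorem trunc_apply (z : Z) : trunc z = (z.1, incl z.2.1) := rfl

theorem isPair_trunc {z : Z} (hz : IsJet z) : IsPair (trunc z) := hz.one.congr_L2_symm (incl_ae _)

/-- The second derivative. -/
def lap : Z →L[ℂ] K × L :=
  ContinuousLinearMap.snd ℂ K _ ∘L ContinuousLinearMap.snd ℂ K _

theorem lap_apply (z : Z) : lap z = z.2.2 := rfl

theorem isPair_lap {z : Z} (hz : IsJet z) : IsPair (lap z) := hz.three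

/-- The jet of `x`. -/
def idZ : Z := (XK, 1, 0, 0)

theorem isJet_idZ : IsJet idZ where
  one := (IsPrim.of_hasDerivAt (a := 0) (b := 1) (fun x => hasDerivAt_ofReal x)
    continuous_const).congr fun x hx => (ext_XK hx).symm
  two := ⟨(continuous_ext (0 : K)).intervalIntegrable _ _, fun x hx => by simp [idZ, ext_zero, ext_one]⟩
  three := (⟨by simp, fun x hx => by simp [idZ, ext_zero]⟩ :
    IsPrim 0 1 (ext (0 : K)) fun _ => 0).congr_L2_symm
    (Lp.coeFn_zero ℂ 2 (vol 0 1))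

/-- The dilation `z ↦ ∂ₓ (x z)`. -/
def dil : Z →L[ℂ] K × L :=
  ((ContinuousLinearMap.fst ℂ K _ ∘L ContinuousLinearMap.snd ℂ K _).prod
    (incl ∘L ContinuousLinearMap.fst ℂ K _ ∘L ContinuousLinearMap.snd ℂ K _ ∘L
      ContinuousLinearMap.snd ℂ K _)) ∘L mulZ idZ

theorem dil_apply (z : Z) : dil z = ((mulZ idZ z).2.1, incl (mulZ idZ z).2.2.1) := rfl

theorem isPair_dil {z : Z} (hz : IsJet z) : IsPair (dil z) :=
  (isJet_idZ.mul hz).two.congr_L2_symm (incl_ae _)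

theorem ext_dil (z : Z) {x : ℝ} (hx : x ∈ Icc (0 : ℝ) 1) :
    ext (dil z).1 x = ext z.1 x + x * ext z.2.1 x := by
  simp only [dil_apply, mulZ_apply, mulZFun, idZ, ext_add, ext_mul, ext_one, ext_XK hx]
  ring

end FirstOrderPairs

/-! ### From jets to elements of the Sobolev spaces, and regularity in time. -/

section States

/-- The element of `H³ ∩ H¹₀` with given jet. -/
def toState (z : Z) (hz : IsAdm z) : State :=
  ⟨WithLp.toLp 2 ![incl z.1, incl z.2.1, incl z.2.2.1, z.2.2.2], by
    refine ⟨fun j => ?_, ext z.1, (continuous_ext _).continuousOn, incl_ae _, hz.zero, hz.one⟩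
    fin_cases j
    · exact hasWeakDeriv_of_isPrim (hz.jet.one.congr_L2_symm (incl_ae _)) (incl_ae _)
    · exact hasWeakDeriv_of_isPrim (hz.jet.two.congr_L2_symm (incl_ae _)) (incl_ae _)
    · exact hasWeakDeriv_of_isPrim hz.jet.three (incl_ae _)⟩

theorem toState_zero (z : Z) (hz : IsAdm z) : (toState z hz).1 0 = incl z.1 := rfl
theorem toState_one (z : Z) (hz : IsAdm z) : (toState z hz).1 1 = incl z.2.1 := rfl
theorem toState_two (z : Z) (hz : IsAdm z) : (toState z hz).1 2 = incl z.2.2.1 := rfl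

/-- The element of `H¹₀` given by a function and its derivative. -/
def toH1 (r : K × L) (hr : IsPair r) (h0 : ext r.1 0 = 0) (h1 : ext r.1 1 = 0) : H10 ℂ 0 1 :=
  ⟨WithLp.toLp 2 ![incl r.1, r.2], by
    refine ⟨fun j => ?_, ext r.1, (continuous_ext _).continuousOn, incl_ae _, h0, h1⟩
    fin_cases j
    exact hasWeakDeriv_of_isPrim hr (incl_ae _)⟩

theorem continuous_toState {X : Type*} [TopologicalSpace X] {z : X → Z} (hz : ∀ t, IsAdm (z t))
    (hc : Continuous z) : Continuous fun t => toState (z t) (hz t) := by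
  refine Continuous.subtype_mk ?_ _
  refine (PiLp.continuous_toLp 2 _).comp (continuous_pi fun j => ?_)
  fin_cases j
  · exact incl.continuous.comp hc.fst
  · exact incl.continuous.comp hc.snd.fst
  · exact incl.continuous.comp hc.snd.snd.fst
  · exact hc.snd.snd.snd

theorem hasDerivWithinAt_of_subtype {J : Type*} [NormedAddCommGroup J] [NormedSpace ℝ J]
    (p : Submodule ℝ J) {f : ℝ → p} {f' : p} {s : Set ℝ} {t : ℝ}
    (h : HasDerivWithinAt (fun t => (f t : J)) f' s t) : HasDerivWithinAt f f' s t := by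
  rw [hasDerivWithinAt_iff_isLittleO] at h ⊢
  exact (Asymptotics.isLittleO_norm_left.mp (Asymptotics.isLittleO_norm_left.mpr h :))

/-- The path of jets `z` has the time derivative `r`. -/
structure Evolves (T : ℝ) (z : ℝ → Z) (r : ℝ → K × L) : Prop where
  adm : ∀ t, IsAdm (z t)
  cont : Continuous z
  pair : ∀ t, IsPair (r t)
  deriv_cont : Continuous r
  evol : ∀ x ∈ Icc (0 : ℝ) 1, IsPrim 0 T (fun t => ext (z t).1 x) (fun t => ext (r t).1 x)

/-- A boundary value that is zero for all times has zero time derivative, so the rate inherits the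
boundary condition on `[0, T]`. -/
theorem Evolves.vanish {T : ℝ} (hT : 0 < T) {z : ℝ → Z} {r : ℝ → K × L} (h : Evolves T z r) {x : ℝ}
    (hx : x ∈ Icc (0 : ℝ) 1) (hz : ∀ t, ext (z t).1 x = 0) {t : ℝ} (ht : t ∈ Icc 0 T) :
    ext (r t).1 x = 0 := by
  have hc : Continuous fun t => ext (r t).1 x := (evK x).continuous.comp h.deriv_cont.fst
  have h1 := (h.evol x hx).hasDerivWithinAt hT.le hc.continuousOn ht
  simp only [hz] at h1
  exact (uniqueDiffOn_Icc hT t ht).eq_deriv _ h1 (hasDerivWithinAt_const _ _ _)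

theorem Evolves.prim_fst {T : ℝ} {z : ℝ → Z} {r : ℝ → K × L} (h : Evolves T z r) :
    IsPrim 0 T (fun t => (z t).1) (fun t => (r t).1) := by
  refine ⟨h.deriv_cont.fst.intervalIntegrable _ _, fun t ht => eq_of_ext_eq fun x hx => ?_⟩
  have e := (h.evol x hx).eq t ht
  rw [e]
  change _ = evK x ((z 0).1 + ∫ s in (0 : ℝ)..t, (r s).1)
  rw [map_add, ← ContinuousLinearMap.intervalIntegral_comp_comm _ (h.deriv_cont.fst.intervalIntegrable _ _)]
  rfl

/-- The evolution is known for the functions themselves and must be passed to their derivatives in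
`L²`. The functions and their rates vanish at `x = 0`, so both are the images under `prim` of their
derivatives; `prim` is continuous and injective, hence the identity can be checked after applying
it. -/
theorem Evolves.prim_snd {T : ℝ} (hT : 0 < T) {z : ℝ → Z} {r : ℝ → K × L} (h : Evolves T z r) :
    IsPrim 0 T (fun t => incl (z t).2.1) (fun t => (r t).2) := by
  have hi : ∀ t, IntervalIntegrable (fun s => (r s).2) volume 0 t := fun t =>
    h.deriv_cont.snd.intervalIntegrable _ _
  refine ⟨hi T, fun t ht => prim_injective ?_⟩
  have hp : ∀ s, prim (incl (z s).2.1) = (z s).1 := fun s => by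
    have := eq_const_add_prim ((h.adm s).jet.one.congr_L2_symm (incl_ae (z s).2.1))
    rw [(h.adm s).zero] at this
    rw [this]
    exact eq_of_ext_eq fun x hx => (zero_add _).symm
  have hr : ∀ s ∈ Icc 0 T, prim (r s).2 = (r s).1 := fun s hs => by
    have := eq_const_add_prim (h.pair s)
    rw [h.vanish hT ⟨le_rfl, zero_le_one⟩ (fun t => (h.adm t).zero) hs] at this
    conv_rhs => rw [this]
    exact eq_of_ext_eq fun x hx => (zero_add _).symm
  rw [map_add, hp, hp, ← ContinuousLinearMap.intervalIntegral_comp_comm _ (hi t), h.prim_fst.eq t ht]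
  congr 1
  refine intervalIntegral.integral_congr fun s hs => ?_
  rw [uIcc_of_le ht.1] at hs
  exact (hr s ⟨hs.1, hs.2.trans ht.2⟩).symm

theorem Evolves.exists_isRegular {T : ℝ} (hT : 0 < T) {z : ℝ → Z} {r : ℝ → K × L} (h : Evolves T z r) :
    ∃ ψ' : ℝ → H10 ℂ 0 1, IsRegular T (fun t => toState (z t) (h.adm t)) ψ' ∧
      ∀ t ∈ Icc 0 T, (ψ' t).1 0 = incl (r t).1 := by
  have v0 : ∀ t : Icc 0 T, ext (r t).1 0 = 0 := fun t =>
    h.vanish hT ⟨le_rfl, zero_le_one⟩ (fun t => (h.adm t).zero) t.2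
  have v1 : ∀ t : Icc 0 T, ext (r t).1 1 = 0 := fun t =>
    h.vanish hT ⟨zero_le_one, le_rfl⟩ (fun t => (h.adm t).one) t.2
  -- The rates satisfy the boundary conditions only for times in `[0, T]`; clamping the time defines
  -- `ψ'` on the whole line.
  let π : ℝ → Icc 0 T := projIcc 0 T hT.le
  have hπ : ∀ t ∈ Icc 0 T, (π t : ℝ) = t := fun t ht => by rw [show π t = ⟨t, ht⟩ from projIcc_of_mem _ ht]
  refine ⟨fun t => toH1 (r (π t)) (h.pair _) (v0 _) (v1 _), ⟨(continuous_toState h.adm h.cont).continuousOn,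
    fun t ht => ?_, ?_⟩, fun t ht => ?_⟩
  · refine hasDerivWithinAt_of_subtype _ ?_
    rw [hasDerivWithinAt_iff_hasFDerivWithinAt, hasFDerivWithinAt_piLp]
    intro j
    fin_cases j
    · have := (h.prim_fst.clm_comp (incl.restrictScalars ℝ)).hasDerivWithinAt hT.le
        (incl.continuous.comp h.deriv_cont.fst).continuousOn ht
      refine this.hasFDerivWithinAt.congr_fderiv (ContinuousLinearMap.ext_ring ?_)
      change (1 : ℝ) • incl (r t).1 = (1 : ℝ) • incl (r (π t)).1
      rw [hπ t ht]
    · have := (h.prim_snd hT).hasDerivWithinAt hT.le h.deriv_cont.snd.continuousOn ht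
      refine this.hasFDerivWithinAt.congr_fderiv (ContinuousLinearMap.ext_ring ?_)
      change (1 : ℝ) • (r t).2 = (1 : ℝ) • (r (π t)).2
      rw [hπ t ht]
  · have hc : Continuous fun t => r (π t) :=
      h.deriv_cont.comp (continuous_subtype_val.comp continuous_projIcc)
    refine (Continuous.subtype_mk ?_ _).continuousOn
    refine (PiLp.continuous_toLp 2 _).comp (continuous_pi fun j => ?_)
    fin_cases j
    · exact incl.continuous.comp hc.fst
    · exact hc.snd
  · change incl (r (π t)).1 = _
    rw [hπ t ht]

end States

/-! ### Right-hand sides of the nonlinear and linearized equations, solved for the time derivative.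
-/

section Rates

/-- The right-hand side of the nonlinear equation, solved for the time derivative. -/
def rate (σ u : ℝ) (z : Z) : K × L :=
  Complex.I • lap z + (σ * Complex.I) • trunc (cub z z z) + (u : ℂ) • dil z

/-- The right-hand side of the linearized equation, solved for the time derivative. -/
def rateD (σ u U : ℝ) (z w : Z) : K × L :=
  Complex.I • lap w + (σ * Complex.I) • trunc (cub w z z + cub z w z + cub z z w) + (u : ℂ) • dil w
    + (U : ℂ) • dil z

theorem isJet_cub {x y z : Z} (hx : IsJet x) (hy : IsJet y) (hz : IsJet z) : IsJet (cub x y z) :=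
  (hx.mul hy.conj).mul hz

theorem IsJet.add {z w : Z} (hz : IsJet z) (hw : IsJet w) : IsJet (z + w) where
  one := hz.one.add hw.one
  two := hz.two.add hw.two
  three := (hz.three.add hw.three).congr_L2_symm (Lp.coeFn_add _ _)

theorem isPair_rate (σ u : ℝ) {z : Z} (hz : IsJet z) : IsPair (rate σ u z) :=
  (((isPair_lap hz).smul _).add ((isPair_trunc (isJet_cub hz hz hz)).smul _)).add ((isPair_dil hz).smul _)

theorem isPair_rateD (σ u U : ℝ) {z w : Z} (hz : IsJet z) (hw : IsJet w) : IsPair (rateD σ u U z w) :=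
  ((((isPair_lap hw).smul _).add ((isPair_trunc (((isJet_cub hw hz hz).add (isJet_cub hz hw hz)).add
    (isJet_cub hz hz hw))).smul _)).add ((isPair_dil hw).smul _)).add ((isPair_dil hz).smul _)

theorem continuous_cub {X : Type*} [TopologicalSpace X] {x y z : X → Z} (hx : Continuous x)
    (hy : Continuous y) (hz : Continuous z) : Continuous fun t => cub (x t) (y t) (z t) := by
  have h1 : Continuous fun t => mulZ (x t) (conjZ (y t)) :=
    (mulZ.continuous.comp hx).clm_apply (conjZ.continuous.comp hy)
  exact (mulZ.continuous.comp h1).clm_apply hz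

theorem continuous_rate (σ : ℝ) {u : ℝ → ℝ} {z : ℝ → Z} (hu : Continuous u) (hz : Continuous z) :
    Continuous fun t => rate σ (u t) (z t) := by
  have h1 := continuous_cub hz hz hz
  unfold rate
  fun_prop

theorem continuous_rateD (σ : ℝ) {u U : ℝ → ℝ} {z w : ℝ → Z} (hu : Continuous u) (hU : Continuous U)
    (hz : Continuous z) (hw : Continuous w) : Continuous fun t => rateD σ (u t) (U t) (z t) (w t) := by
  have h1 := continuous_cub hw hz hz
  have h2 := continuous_cub hz hw hz
  have h3 := continuous_cub hz hz hw
  unfold rateD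
  fun_prop

theorem ext_cub (x y z : Z) (t : ℝ) :
    ext (cub x y z).1 t = ext x.1 t * starRingEnd ℂ (ext y.1 t) * ext z.1 t := by
  simp only [cub, mulZ_apply, mulZFun, conjZ_apply, ext_mul, ext_conjK]

theorem ext_rate (σ u : ℝ) (z : Z) {x : ℝ} (hx : x ∈ Icc (0 : ℝ) 1) :
    ext (rate σ u z).1 x = Complex.I * ext z.2.2.1 x
      + σ * Complex.I * (ext z.1 x * starRingEnd ℂ (ext z.1 x) * ext z.1 x)
      + u * (ext z.1 x + x * ext z.2.1 x) := by
  simp only [rate, Prod.fst_add, Prod.smul_fst, ext_add, ext_smul, lap_apply, trunc_apply, ext_cub,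
    ext_dil z hx]

theorem ext_rateD (σ u U : ℝ) (z w : Z) {x : ℝ} (hx : x ∈ Icc (0 : ℝ) 1) :
    ext (rateD σ u U z w).1 x = Complex.I * ext w.2.2.1 x
      + σ * Complex.I * (ext w.1 x * starRingEnd ℂ (ext z.1 x) * ext z.1 x
        + ext z.1 x * starRingEnd ℂ (ext w.1 x) * ext z.1 x
        + ext z.1 x * starRingEnd ℂ (ext z.1 x) * ext w.1 x)
      + u * (ext w.1 x + x * ext w.2.1 x) + U * (ext z.1 x + x * ext z.2.1 x) := by
  simp only [rateD, Prod.fst_add, Prod.smul_fst, ext_add, ext_smul, lap_apply, trunc_apply, ext_cub,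
    ext_dil _ hx, map_add]

end Rates

/-! ### Undoing the gauge: solutions of the nonlinear and of the linearized equation. -/

section Solutions

variable {T : ℝ} [hT : Fact (0 ≤ T)]

/-- The solution with profile `y` and control the primitive of `g`. -/
def wave (g : L2 ℝ 0 T) (y : Path 0 T H) (t : ℝ) : Z := gz (ext (prim g) t / 4) ((rot y).val t)

theorem continuous_gz {X : Type*} [TopologicalSpace X] {θ : X → ℝ} {a : X → H} (hθ : Continuous θ)
    (ha : Continuous a) : Continuous fun t => gz (θ t) (a t) :=
  (mulZ.continuous.comp (continuous_gaugeZ.comp hθ)).clm_apply (S.continuous.comp ha)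

theorem continuous_wave (g : L2 ℝ 0 T) (y : Path 0 T H) : Continuous (wave g y) :=
  continuous_gz ((continuous_ext (prim g)).div_const 4) (rot y).continuous_val

theorem isAdm_wave (g : L2 ℝ 0 T) (y : Path 0 T H) (t : ℝ) : IsAdm (wave g y t) := isAdm_gz _ _

theorem gauge_mul_conj (θ : ℝ) {x : ℝ} (hx : x ∈ Icc (0 : ℝ) 1) :
    ext (gauge θ) x * starRingEnd ℂ (ext (gauge θ) x) = 1 := by
  rw [ext_gauge θ hx, Complex.mul_conj, Complex.normSq_eq_norm_sq,
    show Complex.I * θ * (x : ℂ) ^ 2 = ((θ * x ^ 2 : ℝ) : ℂ) * Complex.I by push_cast; ring,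
    Complex.norm_exp_ofReal_mul_I]
  norm_num

theorem vel_ae (g : L2 ℝ 0 T) : ∀ᵐ s ∂vol 0 T, vel g s = (ext (prim g) s ^ 2 - g s) / 4 := by
  filter_upwards [Lp.coeFn_smul (1 / 4 : ℝ) (incl (prim g * prim g) - g),
    Lp.coeFn_sub (incl (prim g * prim g)) g, incl_ae (prim g * prim g)] with s h1 h2 h3
  change ((1 / 4 : ℝ) • (incl (prim g * prim g) - g) : L2 ℝ 0 T) s = _
  rw [h1, Pi.smul_apply, h2, Pi.sub_apply, h3, smul_eq_mul]
  change 1 / 4 * (ext (prim g) s * ext (prim g) s - g s) = _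
  ring

theorem velD_ae (g h : L2 ℝ 0 T) :
    ∀ᵐ s ∂vol 0 T, velD g h s = (2 * ext (prim g) s * ext (prim h) s - h s) / 4 := by
  filter_upwards [Lp.coeFn_smul (1 / 4 : ℝ) (incl (prim g * prim h + prim h * prim g) - h),
    Lp.coeFn_sub (incl (prim g * prim h + prim h * prim g)) h,
    incl_ae (prim g * prim h + prim h * prim g)] with s h1 h2 h3
  change ((1 / 4 : ℝ) • (incl (prim g * prim h + prim h * prim g) - h) : L2 ℝ 0 T) s = _
  rw [h1, Pi.smul_apply, h2, Pi.sub_apply, h3, smul_eq_mul]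
  change 1 / 4 * (ext (prim g) s * ext (prim h) s + ext (prim h) s * ext (prim g) s - h s) = _
  ring

theorem isPrim_control (g : L2 ℝ 0 T) : IsPrim 0 T (fun t => ext (prim g) t / 4) (fun s => g s / 4) :=
  ((isPrim_prim g).clm_comp (ContinuousLinearMap.mul ℝ ℝ (1 / 4))).congr (fun t _ => by
    rw [ContinuousLinearMap.mul_apply']; ring) |>.congr_ae hT.out (.of_forall fun t _ => by
    rw [ContinuousLinearMap.mul_apply']; ring)

/-- The bracket subtracts from the forcing the damping and the potential that the gauge produces.
For the forcing of the profile equation it reduces to the cubic term. -/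
theorem IsDuh.isPrim_wave {y : Path 0 T H} {n : ℝ → Z} (h : IsDuh y n) (hn : ∀ s, IsAdm (n s))
    (g : L2 ℝ 0 T) {x : ℝ} (hx : x ∈ Icc (0 : ℝ) 1) :
    IsPrim 0 T (fun t => ext (wave g y t).1 x)
      (fun t => Complex.I * ext (wave g y t).2.2.1 x
        + ext (prim g) t * (ext (wave g y t).1 x + x * ext (wave g y t).2.1 x)
        + ext (gauge (ext (prim g) t / 4)) x * (ext (n t).1 x - ext (prim g) t / 2 * ext (D0 ((rot y).val t)) x
          - Complex.I * vel g t * x ^ 2 * ext (D0 ((rot y).val t)) x)) := by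
  have h1 := (h.isPrim_D0 hn).clm_comp ((evK x).restrictScalars ℝ)
  have h2 := isPrim_gz hT.out (isPrim_control g) (a := (rot y).val) (m := fun t => ext (n t).1 x) hx h1
  refine h2.congr_ae hT.out ?_
  filter_upwards [(ae_restrict_iff' measurableSet_Ioo).mp (vel_ae g)] with t ht hm
  rw [ht hm]
  push_cast
  simp only [wave]
  ring

theorem evolves_wave {a₀ : H} {p : L2 ℝ 0 T × ℝ} {y : Path 0 T H} (h : (model T a₀).Solves (wts p) y) :
    Evolves T (wave p.1 y) (fun t => rate p.2 (ext (prim p.1) t) (wave p.1 y t)) where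
  adm := isAdm_wave p.1 y
  cont := continuous_wave p.1 y
  pair := fun t => isPair_rate _ _ (isAdm_wave p.1 y t).jet
  deriv_cont := continuous_rate _ (continuous_ext _) (continuous_wave p.1 y)
  evol := fun x hx => by
    refine ((isDuh_of_solves h).isPrim_wave (fun s => isAdm_forcing _ _ _ _) p.1 hx).congr_ae hT.out <|
      .of_forall fun t ht => ?_
    rw [ext_rate _ _ _ hx, forcing_one]
    simp only [ext_add, ext_smul, ext_mul, ext_sqZ hx, ext_cub]
    have e : ext (wave p.1 y t).1 x = ext (gauge (ext (prim p.1) t / 4)) x * ext (D0 ((rot y).val t)) x :=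
      gz_one _ _ _
    -- The gauge factor is unimodular, so it commutes with `χ ↦ |χ|² χ`.
    have eg := gauge_mul_conj (ext (prim p.1) t / 4) hx
    have e0 : (S ((rot y).val t)).1 = D0 ((rot y).val t) := rfl
    simp only [e, e0, map_mul]
    generalize ext (gauge (ext (prim p.1) t / 4)) x = γ at eg ⊢
    generalize ext (D0 ((rot y).val t)) x = χ
    push_cast
    linear_combination (-(p.2 * Complex.I * γ * χ ^ 2 * starRingEnd ℂ χ)) * eg

/-- The derivative of the solution with respect to the control. -/
def waveD (g h : L2 ℝ 0 T) (y η : Path 0 T H) (t : ℝ) : Z :=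
  wave g η t + (Complex.I * ext (prim h) t / 4) • mulZ sqZ (wave g y t)

theorem isAdm_waveD (g h : L2 ℝ 0 T) (y η : Path 0 T H) (t : ℝ) : IsAdm (waveD g h y η t) :=
  (isAdm_wave g η t).add ((IsAdm.mul_left isJet_sqZ (isAdm_wave g y t)).smul _)

theorem continuous_waveD (g h : L2 ℝ 0 T) (y η : Path 0 T H) : Continuous (waveD g h y η) := by
  have h1 := continuous_wave g η
  have h2 := continuous_wave g y
  have h3 := continuous_ext (prim h)
  unfold waveD
  fun_prop

/-- The forcing of the linearized profile equation. -/
def forcingD (σ u v U V : ℝ) (a b : H) : Z :=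
  σ • (Complex.I • (cub (S b) (S a) (S a) + cub (S a) (S b) (S a) + cub (S a) (S a) (S b)))
    + u • ((1 / 2 : ℝ) • S b) + v • (Complex.I • mulZ sqZ (S b))
    + (U • ((1 / 2 : ℝ) • S a) + V • (Complex.I • mulZ sqZ (S a)))

theorem isAdm_forcingD (σ u v U V : ℝ) (a b : H) : IsAdm (forcingD σ u v U V a b) :=
  (((((((isAdm_cub (isJet_S b) (isJet_S a) (isAdm_S a)).add (isAdm_cub (isJet_S a) (isJet_S b) (isAdm_S a))).add
    (isAdm_cub (isJet_S a) (isJet_S a) (isAdm_S b))).smul _).rsmul _).add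
    (((isAdm_S b).rsmul _).rsmul _)).add (((isAdm_sq b).smul _).rsmul _)).add
    ((((isAdm_S a).rsmul _).rsmul _).add (((isAdm_sq a).smul _).rsmul _))

theorem linearized_eq {a₀ : H} {p : L2 ℝ 0 T × ℝ} {y η : Path 0 T H} {h : L2 ℝ 0 T}
    (e : η = (model T a₀).diff (wts p) y y η + (model T a₀).op y (fderiv ℝ wts p (h, 0))) :
    η = duh (wts p).1 (cubic η y y + cubic y η y + cubic y y η) + duh (wts p).2.1 (damp η)
      + duh (wts p).2.2 (pot η) + (duh (incl (prim h)) (damp y) + duh (velD p.1 h) (pot y)) := by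
  rw [fderiv_wts, Semilinear.op_apply, map_zero, zero_apply, zero_add] at e
  exact e

theorem cubic_add_val (y η : Path 0 T H) (s : ℝ) : (cubic η y y + cubic y η y + cubic y y η).val s
    = Complex.I • (cub (S ((rot η).val s)) (S ((rot y).val s)) (S ((rot y).val s))
      + cub (S ((rot y).val s)) (S ((rot η).val s)) (S ((rot y).val s))
      + cub (S ((rot y).val s)) (S ((rot y).val s)) (S ((rot η).val s))) := by
  rw [Path.val_add, Path.val_add, cubic_val, cubic_val, cubic_val]
  simp only [← iZ_apply, map_add]

theorem isDuh_of_linearized {a₀ : H} {p : L2 ℝ 0 T × ℝ} {y η : Path 0 T H} {h : L2 ℝ 0 T}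
    (e : η = (model T a₀).diff (wts p) y y η + (model T a₀).op y (fderiv ℝ wts p (h, 0))) :
    IsDuh η (fun s => forcingD p.2 (ext (prim p.1) s) (vel p.1 s) (ext (prim h) s) (velD p.1 h s)
      ((rot y).val s) ((rot η).val s)) := by
  have h1 := (((isDuh_duh (wts p).1 (cubic η y y + cubic y η y + cubic y y η)).add
    (isDuh_duh (wts p).2.1 (damp η))).add (isDuh_duh (wts p).2.2 (pot η))).add
      ((isDuh_duh (incl (prim h)) (damp y)).add (isDuh_duh (velD p.1 h) (pot y)))
  rw [← linearized_eq e] at h1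
  refine h1.congr_ae ?_
  filter_upwards [oneL2_smul_ae (T := T) p.2, incl_ae (prim p.1), incl_ae (prim h)] with s e1 e2 e3
  have e1 : (wts p).1 s = p.2 := e1
  have e2 : (wts p).2.1 s = ext (prim p.1) s := e2
  simp only [e1, e2, e3, cubic_add_val, damp_val, pot_val]
  rfl

/-- `waveD` is the product rule applied to `exp(i u x² / 4) χ` when the control varies in the
direction `U` with `U' = h`. The time derivative of the factor `U / 4` produces `h / 4`, which the
term `-h / 4` in `velD` cancels, and the commutator of `∂ₓ²` with `x²` supplies the remaining part
of `U ∂ₓ(x ψ)`. -/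
theorem evolves_waveD {a₀ : H} {p : L2 ℝ 0 T × ℝ} {y η : Path 0 T H} {h : L2 ℝ 0 T}
    (hy : (model T a₀).Solves (wts p) y)
    (e : η = (model T a₀).diff (wts p) y y η + (model T a₀).op y (fderiv ℝ wts p (h, 0))) :
    Evolves T (waveD p.1 h y η) (fun t => rateD p.2 (ext (prim p.1) t) (ext (prim h) t) (wave p.1 y t)
      (waveD p.1 h y η t)) where
  adm := isAdm_waveD p.1 h y η
  cont := continuous_waveD p.1 h y η
  pair := fun t => isPair_rateD _ _ _ (isAdm_wave p.1 y t).jet (isAdm_waveD p.1 h y η t).jet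
  deriv_cont := continuous_rateD _ (continuous_ext _) (continuous_ext _) (continuous_wave p.1 y)
    (continuous_waveD p.1 h y η)
  evol := fun x hx => by
    have h1 := (isDuh_of_linearized e).isPrim_wave (fun s => isAdm_forcingD _ _ _ _ _ _ _) p.1 hx
    have h2 := (evolves_wave hy).evol x hx
    have h3 := ((isPrim_control h).smul hT.out h2).const_mul (Complex.I * x ^ 2)
    refine ((h1.add h3).congr fun t ht => ?_).congr_ae hT.out ?_
    · simp only [waveD, Prod.fst_add, Prod.smul_fst, ext_add, ext_smul, mulZ_apply, mulZFun, ext_mul,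
        ext_sqZ hx, Complex.real_smul]
      push_cast
      ring
    · filter_upwards [(ae_restrict_iff' measurableSet_Ioo).mp (velD_ae p.1 h)] with t ht hm
      have ev := ht hm
      have ea : ext (wave p.1 y t).1 x = ext (gauge (ext (prim p.1) t / 4)) x * ext (D0 ((rot y).val t)) x :=
        gz_one _ _ _
      have eb : ext (wave p.1 η t).1 x = ext (gauge (ext (prim p.1) t / 4)) x * ext (D0 ((rot η).val t)) x :=
        gz_one _ _ _
      have eg := gauge_mul_conj (ext (prim p.1) t / 4) hx
      have ea0 : (S ((rot y).val t)).1 = D0 ((rot y).val t) := rfl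
      have eb0 : (S ((rot η).val t)).1 = D0 ((rot η).val t) := rfl
      rw [ext_rateD _ _ _ _ _ hx, ext_rate _ _ _ hx]
      simp only [forcingD, waveD, mulZ_apply, mulZFun, ea0, eb0, Prod.fst_add, Prod.smul_fst, Prod.snd_add,
        Prod.smul_snd, ext_add, ext_smul, ext_rsmul, ext_mul, ext_sqZ hx, ext_sqZ_one hx, ext_sqZ_two, ext_cub,
        map_add, map_mul, Complex.real_smul, Complex.conj_ofReal, Complex.conj_I, map_div₀, ev, ea, eb, map_ofNat]
      generalize ext (gauge (ext (prim p.1) t / 4)) x = γ at eg ⊢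
      generalize ext (D0 ((rot y).val t)) x = χ
      generalize ext (D0 ((rot η).val t)) x = ζ
      push_cast
      linear_combination (-(p.2 * Complex.I * γ * (ζ * starRingEnd ℂ χ * χ + χ * starRingEnd ℂ ζ * χ
        + χ * starRingEnd ℂ χ * ζ))) * eg
        - (ext (prim h) t / 4 : ℂ) * (2 * γ * χ + 4 * x * ext (wave p.1 y t).2.1 x) * Complex.I_sq

end Solutions

/-! ### From elements of the Sobolev spaces back to jets. -/

section JetsOfStates

theorem exists_incl_eq {f g : L} (h : HasWeakDeriv f g) : ∃ F : K, incl F = f ∧ IsPrim 0 1 (ext F) g := by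
  obtain ⟨F, e, hF⟩ := h.exists_isPrim zero_lt_one
  exact ⟨F, Lp.ext ((incl_ae F).trans e.symm), hF⟩

theorem exists_jet {f₀ f₁ f₂ f₃ : L} (h₀ : HasWeakDeriv f₀ f₁) (h₁ : HasWeakDeriv f₁ f₂)
    (h₂ : HasWeakDeriv f₂ f₃) :
    ∃ z, IsJet z ∧ incl z.1 = f₀ ∧ incl z.2.1 = f₁ ∧ incl z.2.2.1 = f₂ ∧ z.2.2.2 = f₃ := by
  obtain ⟨F₀, rfl, p₀⟩ := exists_incl_eq h₀
  obtain ⟨F₁, rfl, p₁⟩ := exists_incl_eq h₁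
  obtain ⟨F₂, rfl, p₂⟩ := exists_incl_eq h₂
  exact ⟨(F₀, F₁, F₂, f₃), ⟨p₀.congr_L2 (incl_ae _), p₁.congr_L2 (incl_ae _), p₂⟩, rfl, rfl, rfl, rfl⟩

theorem ext_ends_of_vanishesAtEnds {F : K} (h : VanishesAtEnds (incl F)) : ext F 0 = 0 ∧ ext F 1 = 0 := by
  obtain ⟨g, hg, e, g0, g1⟩ := h
  have := eqOn_Icc_of_ae_eq zero_lt_one (continuous_ext F).continuousOn hg ((incl_ae F).symm.trans e)
  rw [this ⟨le_rfl, zero_le_one⟩, this ⟨zero_le_one, le_rfl⟩]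
  exact ⟨g0, g1⟩

theorem exists_toState_eq (ψ : State) : ∃ z, ∃ hz : IsAdm z, ψ = toState z hz := by
  obtain ⟨z, hz, e0, e1, e2, e3⟩ := exists_jet (ψ.2.1 0) (ψ.2.1 1) (ψ.2.1 2)
  have hv : VanishesAtEnds (incl z.1) := by rw [e0]; exact ψ.2.2
  obtain ⟨v0, v1⟩ := ext_ends_of_vanishesAtEnds hv
  refine ⟨z, ⟨hz, v0, v1⟩, Subtype.ext (PiLp.ext fun j => ?_)⟩
  fin_cases j
  · exact e0.symm
  · exact e1.symm
  · exact e2.symm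
  · exact e3.symm

theorem IsJet.eq {z w : Z} (hz : IsJet z) (hw : IsJet w) (h : z.1 = w.1) : z = w := by
  have h1 : z.2.1 = w.2.1 := incl_injective zero_lt_one <| L2_eq_of_isPrim
    (hz.one.congr_L2_symm (incl_ae _)) (h ▸ hw.one.congr_L2_symm (incl_ae _))
  have h2 : z.2.2.1 = w.2.2.1 := incl_injective zero_lt_one <| L2_eq_of_isPrim
    (hz.two.congr_L2_symm (incl_ae _)) (h1 ▸ hw.two.congr_L2_symm (incl_ae _))
  have h3 : z.2.2.2 = w.2.2.2 := L2_eq_of_isPrim hz.three (h2 ▸ hw.three)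
  exact Prod.ext h (Prod.ext h1 (Prod.ext h2 h3))

theorem state_eq {ψ₁ ψ₂ : State} (h : ψ₁.1 0 = ψ₂.1 0) : ψ₁ = ψ₂ := by
  obtain ⟨z, hz, rfl⟩ := exists_toState_eq ψ₁
  obtain ⟨w, hw, rfl⟩ := exists_toState_eq ψ₂
  have : z = w := hz.jet.eq hw.jet (incl_injective zero_lt_one h)
  subst this
  rfl

theorem L_eq_incl_iff {r : L} {f : K} : r = incl f ↔ ∀ᵐ x ∂vol 0 1, r x = ext f x :=
  ⟨fun h => h ▸ incl_ae f, fun h => Lp.ext (Filter.EventuallyEq.trans h (incl_ae f).symm)⟩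

theorem equation_iff (σ u : ℝ) {z : Z} (hz : IsAdm z) (r : L) :
    (∀ᵐ x ∂(vol 0 1), Complex.I * r x = - (toState z hz).1 2 x
      - (σ : ℂ) * ((‖(toState z hz).1 0 x‖ ^ 2 : ℝ) : ℂ) * (toState z hz).1 0 x
        + Complex.I * (u : ℂ) * dxMulX (toState z hz) x) ↔ r = incl (rate σ u z).1 := by
  rw [L_eq_incl_iff]
  refine Filter.eventually_congr ?_
  filter_upwards [incl_ae z.1, incl_ae z.2.1, incl_ae z.2.2.1, ae_restrict_mem measurableSet_Ioo]
    with x h0 h1 h2 hx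
  have hx := Ioo_subset_Icc_self hx
  rw [ext_rate _ _ _ hx, dxMulX, toState_zero, toState_one, toState_two, h0, h1, h2, Complex.mul_conj,
    Complex.normSq_eq_norm_sq]
  constructor
  · intro h
    linear_combination (-Complex.I) * h + (r x - u * (ext z.1 x + x * ext z.2.1 x)) * Complex.I_sq
  · intro h
    linear_combination Complex.I * h + (ext z.2.2.1 x
      + σ * ((‖ext z.1 x‖ ^ 2 : ℝ) : ℂ) * ext z.1 x) * Complex.I_sq

theorem linearized_equation_iff (σ u U : ℝ) {z w : Z} (hz : IsAdm z) (hw : IsAdm w) (r : L) :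
    (∀ᵐ x ∂(vol 0 1), Complex.I * r x = - (toState w hw).1 2 x
      - (σ : ℂ) * (2 * ((‖(toState z hz).1 0 x‖ ^ 2 : ℝ) : ℂ) * (toState w hw).1 0 x
          + (toState z hz).1 0 x ^ 2 * (starRingEnd ℂ) ((toState w hw).1 0 x))
        + Complex.I * (u : ℂ) * dxMulX (toState w hw) x
        + Complex.I * (U : ℂ) * dxMulX (toState z hz) x) ↔ r = incl (rateD σ u U z w).1 := by
  rw [L_eq_incl_iff]
  refine Filter.eventually_congr ?_
  filter_upwards [incl_ae z.1, incl_ae z.2.1, incl_ae w.1, incl_ae w.2.1, incl_ae w.2.2.1,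
    ae_restrict_mem measurableSet_Ioo] with x h0 h1 k0 k1 k2 hx
  have hx := Ioo_subset_Icc_self hx
  have hc := Complex.mul_conj (ext z.1 x)
  rw [Complex.normSq_eq_norm_sq] at hc
  rw [ext_rateD _ _ _ _ _ hx, dxMulX, dxMulX, toState_zero, toState_zero, toState_one, toState_one,
    toState_two, h0, h1, k0, k1, k2, ← hc]
  constructor
  · intro h
    linear_combination (-Complex.I) * h + (r x - u * (ext w.1 x + x * ext w.2.1 x)
      - U * (ext z.1 x + x * ext z.2.1 x)) * Complex.I_sq
  · intro h
    linear_combination Complex.I * h + (ext w.2.2.1 x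
      + σ * (2 * (ext z.1 x * starRingEnd ℂ (ext z.1 x)) * ext w.1 x
          + ext z.1 x ^ 2 * starRingEnd ℂ (ext w.1 x))) * Complex.I_sq

end JetsOfStates

/-! ### The `L²` energy estimate. -/

section Uniqueness

/-- The dilation generator is one half plus a skew-symmetric operator. -/
theorem inner_dil_re {w : Z} (hw : IsAdm w) :
    2 * (inner ℂ (incl w.1) (incl (dil w).1)).re = ‖incl w.1‖ ^ 2 := by
  have h := (isJet_idZ.one.smul zero_le_one
    (((hw.jet.one.clm_comp Complex.conjCLE.toContinuousLinearMap).smul zero_le_one hw.jet.one)))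
  have e := h.eq 1 ⟨zero_le_one, le_rfl⟩
  change ext idZ.1 1 • (starRingEnd ℂ (ext w.1 1) • ext w.1 1) = ext idZ.1 0 • (starRingEnd ℂ (ext w.1 0) • ext w.1 0)
    + ∫ t in (0 : ℝ)..1, (ext idZ.1 t • (starRingEnd ℂ (ext w.1 t) • ext w.2.1 t
      + starRingEnd ℂ (ext w.2.1 t) • ext w.1 t) + ext idZ.2.1 t • (starRingEnd ℂ (ext w.1 t) • ext w.1 t)) at e
  rw [hw.one, hw.zero, smul_zero, smul_zero, smul_zero, zero_add] at e
  have e1 : inner ℂ (incl w.1) (incl (dil w).1) + starRingEnd ℂ (inner ℂ (incl w.1) (incl (dil w).1))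
      = inner ℂ (incl w.1) (incl w.1) + ∫ t in (0 : ℝ)..1, (ext idZ.1 t • (starRingEnd ℂ (ext w.1 t) • ext w.2.1 t
      + starRingEnd ℂ (ext w.2.1 t) • ext w.1 t) + ext idZ.2.1 t • (starRingEnd ℂ (ext w.1 t) • ext w.1 t)) := by
    rw [inner_incl_incl, inner_incl_incl, ← intervalIntegral.intervalIntegral_conj,
      ← intervalIntegral.integral_add (Continuous.intervalIntegrable (by fun_prop) _ _)
        (Continuous.intervalIntegrable (by fun_prop) _ _),
      ← intervalIntegral.integral_add (Continuous.intervalIntegrable (by fun_prop) _ _)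
        (Continuous.intervalIntegrable (by fun_prop) _ _)]
    refine intervalIntegral.integral_congr fun x hx => ?_
    rw [uIcc_of_le zero_le_one] at hx
    simp only [smul_eq_mul, ext_dil w hx, map_mul, map_add, Complex.conj_conj, Complex.conj_ofReal]
    rw [show ext idZ.1 x = x from ext_XK hx, show ext idZ.2.1 x = 1 from ext_one x]
    ring
  rw [← e, add_zero, inner_self_incl] at e1
  have := congrArg Complex.re e1
  rw [Complex.add_re, Complex.conj_re, Complex.ofReal_re] at this
  linarith

/-- The second derivative contributes nothing and the dilation exactly `u ‖w‖²`; the rest is of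
order zero. General potentials `f` and `g` cover both differences of solutions of the nonlinear
equation and those of the linearized one. -/
theorem energy_le (σ u : ℝ) {w : Z} (hw : IsAdm w) (f g : K) :
    2 * (inner ℂ (incl w.1) (incl (Complex.I • w.2.2.1 + (σ * Complex.I) • (f * w.1 + g * conjK w.1)
      + (u : ℂ) • (dil w).1))).re ≤ (|u| + 2 * |σ| * (‖f‖ + ‖g‖)) * ‖incl w.1‖ ^ 2 := by
  have h1 := inner_incl_second hw hw.jet
  rw [inner_self_incl] at h1
  have h2 := inner_dil_re hw
  have h3 : ‖inner ℂ (incl w.1) (incl (f * w.1 + g * conjK w.1))‖ ≤ (‖f‖ + ‖g‖) * ‖incl w.1‖ ^ 2 := by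
    refine (norm_inner_le_norm _ _).trans ?_
    have b1 := norm_incl_mul_le f w.1
    have b2 := norm_incl_mul_le g (conjK w.1)
    rw [norm_incl_conjK] at b2
    have b3 := norm_add_le (incl (f * w.1)) (incl (g * conjK w.1))
    rw [← map_add] at b3
    nlinarith [norm_nonneg (incl w.1)]
  have h4 := Complex.abs_im_le_norm (inner ℂ (incl w.1) (incl (f * w.1 + g * conjK w.1)))
  rw [map_add, map_add, map_smul, map_smul, map_smul, inner_add_right, inner_add_right, inner_smul_right,
    inner_smul_right, inner_smul_right, h1]
  generalize inner ℂ (incl w.1) (incl (f * w.1 + g * conjK w.1)) = q at h3 h4 ⊢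
  simp only [Complex.add_re, Complex.mul_re, Complex.mul_im, Complex.I_re, Complex.I_im, Complex.ofReal_re,
    Complex.ofReal_im, Complex.neg_im, Complex.neg_re]
  have h5 : u * (2 * (inner ℂ (incl w.1) (incl (dil w).1)).re) ≤ |u| * ‖incl w.1‖ ^ 2 := by
    rw [h2]; gcongr; exact le_abs_self u
  have h6 : -(σ * q.im) ≤ |σ| * ((‖f‖ + ‖g‖) * ‖incl w.1‖ ^ 2) := by
    refine (neg_le_abs _).trans ?_
    rw [abs_mul]
    exact mul_le_mul_of_nonneg_left (h4.trans h3) (abs_nonneg σ)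
  nlinarith

/-- `exp(-C t) ‖W t‖²` is nonincreasing, nonnegative and zero at the start. -/
theorem eq_zero_of_energy {T : ℝ} {W W' : ℝ → L} {C : ℝ}
    (hW : ∀ t ∈ Icc 0 T, HasDerivWithinAt W (W' t) (Icc 0 T) t) (h0 : W 0 = 0)
    (h : ∀ t ∈ Icc 0 T, 2 * (inner ℂ (W t) (W' t)).re ≤ C * ‖W t‖ ^ 2) :
    ∀ t ∈ Icc 0 T, W t = 0 := by
  have hd : ∀ t ∈ Icc 0 T, HasDerivWithinAt (fun t => ‖W t‖ ^ 2) (2 * (inner ℂ (W t) (W' t)).re)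
      (Icc 0 T) t := fun t ht => by
    have h1 := (innerR (V := L)).hasDerivWithinAt_of_bilinear (hW t ht) (hW t ht)
    have h2 := Complex.reCLM.hasFDerivAt.comp_hasDerivWithinAt t h1
    refine (h2.congr_deriv ?_).congr_of_mem (fun s _ => ?_) ht
    · change (inner ℂ (W t) (W' t) + inner ℂ (W' t) (W t) : ℂ).re = _
      rw [Complex.add_re, ← inner_conj_symm (W' t), Complex.conj_re]
      ring
    · exact (inner_self_eq_norm_sq (𝕜 := ℂ) (W s)).symm
  have he : ∀ t ∈ Icc 0 T, HasDerivWithinAt (fun t => Real.exp (-C * t) * ‖W t‖ ^ 2)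
      (Real.exp (-C * t) * (2 * (inner ℂ (W t) (W' t)).re - C * ‖W t‖ ^ 2)) (Icc 0 T) t := fun t ht => by
    have h1 : HasDerivWithinAt (fun t => Real.exp (-C * t)) (Real.exp (-C * t) * (-C * 1)) (Icc 0 T) t :=
      (((hasDerivAt_id t).const_mul (-C)).exp).hasDerivWithinAt
    refine (h1.mul (hd t ht)).congr_deriv ?_
    ring
  intro t ht
  have hanti : AntitoneOn (fun t => Real.exp (-C * t) * ‖W t‖ ^ 2) (Icc 0 T) := by
    refine antitoneOn_of_hasDerivWithinAt_nonpos (convex_Icc 0 T) (fun s hs => (he s hs).continuousWithinAt)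
      (f' := fun t => Real.exp (-C * t) * (2 * (inner ℂ (W t) (W' t)).re - C * ‖W t‖ ^ 2))
      (fun s hs => (he s (interior_subset hs)).mono interior_subset) fun s hs => ?_
    have := h s (interior_subset hs)
    exact mul_nonpos_of_nonneg_of_nonpos (Real.exp_pos _).le (by linarith)
  have := hanti ⟨le_rfl, ht.1.trans ht.2⟩ ht ht.1
  simp only [h0, norm_zero] at this
  have hp := Real.exp_pos (-C * t)
  have h2 : ‖W t‖ ^ 2 ≤ 0 := by
    by_contra hc
    push Not at hc
    have := mul_pos hp hc
    linarith
  exact norm_eq_zero.mp (pow_eq_zero_iff two_ne_zero |>.mp (le_antisymm h2 (sq_nonneg _)))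

theorem IsRegular.hasDerivWithinAt_fst {T : ℝ} {ψ : ℝ → State} {ψ' : ℝ → H10 ℂ 0 1} (h : IsRegular T ψ ψ')
    {t : ℝ} (ht : t ∈ Icc 0 T) :
    HasDerivWithinAt (fun s => (ψ s).1 0) ((ψ' t).1 0) (Icc 0 T) t :=
  ((PiLp.proj 2 (fun _ : Fin 2 => L2 ℂ 0 1) (0 : Fin 2) : _ →L[ℝ] _) ∘L
    (H10 ℂ 0 1).subtypeL).hasFDerivAt.comp_hasDerivWithinAt t (h.hasDeriv t ht)

theorem norm_fst_le_toState (z : Z) (hz : IsAdm z) : ‖z.1‖ ≤ 2 * ‖toState z hz‖ := by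
  have h := norm_ext_sq_le (hz.jet.one.congr_L2_symm (incl_ae _))
  have h0 : ‖incl z.1‖ ≤ ‖toState z hz‖ := PiLp.norm_apply_le (toState z hz).1 0
  have h1 : ‖incl z.2.1‖ ≤ ‖toState z hz‖ := PiLp.norm_apply_le (toState z hz).1 1
  refine abs_le_of_sq_le_sq' (a := ‖z.1‖) (b := 2 * ‖toState z hz‖) ?_ (by positivity) |>.2
  have := norm_nonneg (incl z.1)
  have := norm_nonneg (incl z.2.1)
  nlinarith

theorem exists_bound_jets {T : ℝ} {ψ : ℝ → State} (h : ContinuousOn ψ (Icc 0 T)) {z : ℝ → Z}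
    (hz : ∀ t, IsAdm (z t)) (e : ∀ t, ψ t = toState (z t) (hz t)) :
    ∃ R, 0 ≤ R ∧ ∀ t ∈ Icc 0 T, ‖(z t).1‖ ≤ R := by
  obtain ⟨C, hC⟩ := isCompact_Icc.exists_bound_of_continuousOn h
  refine ⟨2 * |C|, by positivity, fun t ht => ?_⟩
  have h1 := norm_fst_le_toState (z t) (hz t)
  rw [← e] at h1
  have := (hC t ht).trans (le_abs_self C)
  linarith

end Uniqueness

/-! ### Uniqueness for both Cauchy problems, the control, and the initial datum. -/

section CauchyProblem

theorem IsAdm.sub {z w : Z} (hz : IsAdm z) (hw : IsAdm w) : IsAdm (z - w) := by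
  rw [sub_eq_add_neg, ← neg_one_smul ℂ w]
  exact hz.add (hw.smul _)

theorem rate_sub_rate (σ u : ℝ) (z w : Z) : (rate σ u z).1 - (rate σ u w).1
    = Complex.I • (z - w).2.2.1 + (σ * Complex.I) • ((conjK z.1 * z.1 + conjK z.1 * w.1) * (z - w).1
      + w.1 * w.1 * conjK (z - w).1) + (u : ℂ) • (dil (z - w)).1 := by
  refine eq_of_ext_eq fun x hx => ?_
  simp only [ext_sub, ext_rate _ _ _ hx, ext_add, ext_smul, ext_mul, ext_conjK, ext_dil _ hx, Prod.fst_sub,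
    Prod.snd_sub, map_sub]
  ring

theorem rateD_sub_rateD (σ u U : ℝ) (a z w : Z) : (rateD σ u U a z).1 - (rateD σ u U a w).1
    = Complex.I • (z - w).2.2.1 + (σ * Complex.I) • ((conjK a.1 * a.1 + conjK a.1 * a.1) * (z - w).1
      + a.1 * a.1 * conjK (z - w).1) + (u : ℂ) • (dil (z - w)).1 := by
  refine eq_of_ext_eq fun x hx => ?_
  simp only [ext_sub, ext_rateD _ _ _ _ _ hx, ext_add, ext_smul, ext_mul, ext_conjK, ext_dil _ hx, Prod.fst_sub,
    Prod.snd_sub, map_sub]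
  ring

theorem norm_potentials_le {f g : K} {R : ℝ} (hR : 0 ≤ R) (hf : ‖f‖ ≤ R) (hg : ‖g‖ ≤ R) :
    ‖conjK f * f + conjK f * g‖ + ‖g * g‖ ≤ 3 * R ^ 2 := by
  have b1 := norm_add_le (conjK f * f) (conjK f * g)
  have b2 := norm_mul_le (conjK f) f
  have b3 := norm_mul_le (conjK f) g
  have b4 := norm_mul_le g g
  rw [norm_conjK] at b2 b3
  have c1 : ‖f‖ * ‖f‖ ≤ R * R := by gcongr
  have c2 : ‖f‖ * ‖g‖ ≤ R * R := by gcongr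
  have c3 : ‖g‖ * ‖g‖ ≤ R * R := by gcongr
  nlinarith

variable {T : ℝ} [hT : Fact (0 ≤ T)]

theorem ctrl_isPrim (h0 : 0 < T) (u : Control T) : IsPrim 0 T (ctrl u) (u.1 1) :=
  u.2.1.2.isVanishingRep_rep.isPrim h0 (u.2.1.1 0)

theorem ctrl_eq (h0 : 0 < T) (u : Control T) {t : ℝ} (ht : t ∈ Icc 0 T) :
    ctrl u t = ext (prim (u.1 1)) t := by
  rw [(ctrl_isPrim h0 u).eq t ht, ext_prim _ ht, show ctrl u 0 = 0 from u.2.1.2.isVanishingRep_rep.2.2.1,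
    zero_add]

theorem prim_end (h0 : 0 < T) (u : Control T) : ext (prim (u.1 1)) T = 0 := by
  rw [← ctrl_eq h0 u ⟨h0.le, le_rfl⟩]
  exact u.2.1.2.isVanishingRep_rep.2.2.2

theorem integral_prim (h0 : 0 < T) (u : Control T) : ∫ t in (0 : ℝ)..T, ext (prim (u.1 1)) t = 0 := by
  refine Eq.trans ?_ u.2.2
  rw [intervalIntegral.integral_of_le h0.le, integral_Ioc_eq_integral_Ioo]
  refine integral_congr_ae ?_
  filter_upwards [u.2.1.2.isVanishingRep_rep.2.1, ae_restrict_mem measurableSet_Ioo] with t h1 h2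
  rw [← ctrl_eq h0 u (Ioo_subset_Icc_self h2)]
  exact h1.symm

/-- The common part of both uniqueness proofs: the difference of two solutions satisfies a
real-linear equation with bounded potentials, to which the energy estimate applies. Equality in `L²`
then determines all derivatives. -/
theorem eqOn_of_rates (h0 : 0 < T) {σ R : ℝ} (u : Control T) {ψ₁ ψ₂ : ℝ → State} {ψ₁' ψ₂' : ℝ → H10 ℂ 0 1}
    (r₁ : IsRegular T ψ₁ ψ₁') (r₂ : IsRegular T ψ₂ ψ₂') {z₁ z₂ : ℝ → Z} {f g : ℝ → K}
    (hz₁ : ∀ t, IsAdm (z₁ t)) (e₁ : ∀ t, ψ₁ t = toState (z₁ t) (hz₁ t))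
    (hz₂ : ∀ t, IsAdm (z₂ t)) (e₂ : ∀ t, ψ₂ t = toState (z₂ t) (hz₂ t))
    (init : (ψ₁ 0).1 0 = (ψ₂ 0).1 0) (bound : ∀ t ∈ Icc 0 T, ‖f t‖ + ‖g t‖ ≤ R)
    (hd : ∀ t ∈ Icc 0 T, (ψ₁' t).1 0 - (ψ₂' t).1 0
      = incl (Complex.I • (z₁ t - z₂ t).2.2.1 + (σ * Complex.I) • (f t * (z₁ t - z₂ t).1
        + g t * conjK (z₁ t - z₂ t).1) + (ctrl u t : ℂ) • (dil (z₁ t - z₂ t)).1)) :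
    EqOn ψ₁ ψ₂ (Icc 0 T) := by
  have key := eq_zero_of_energy (T := T) (W := fun t => (ψ₁ t).1 0 - (ψ₂ t).1 0)
    (W' := fun t => (ψ₁' t).1 0 - (ψ₂' t).1 0) (C := ‖prim (u.1 1)‖ + 2 * |σ| * R)
    (fun t ht => (r₁.hasDerivWithinAt_fst ht).sub (r₂.hasDerivWithinAt_fst ht)) (sub_eq_zero.mpr init)
    (fun t ht => ?_)
  · exact fun t ht => state_eq (sub_eq_zero.mp (key t ht))
  · have hw : (ψ₁ t).1 0 - (ψ₂ t).1 0 = incl (z₁ t - z₂ t).1 := by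
      rw [e₁, e₂, toState_zero, toState_zero, ← map_sub]; rfl
    simp only [hw, hd t ht]
    refine (energy_le σ (ctrl u t) ((hz₁ t).sub (hz₂ t)) (f t) (g t)).trans ?_
    have h1 : |ctrl u t| ≤ ‖prim (u.1 1)‖ := by rw [ctrl_eq h0 u ht]; exact norm_ext_le (prim (u.1 1)) t
    have h2 := bound t ht
    gcongr

theorem IsSolution.eqOn (h0 : 0 < T) {σ : ℝ} {φ : H30 ℝ} {u : Control T} {ψ₁ ψ₂ : ℝ → State}
    (h₁ : IsSolution σ T φ u ψ₁) (h₂ : IsSolution σ T φ u ψ₂) : EqOn ψ₁ ψ₂ (Icc 0 T) := by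
  obtain ⟨⟨ψ₁', r₁, q₁⟩, i₁⟩ := h₁
  obtain ⟨⟨ψ₂', r₂, q₂⟩, i₂⟩ := h₂
  choose z₁ hz₁ e₁ using fun t => exists_toState_eq (ψ₁ t)
  choose z₂ hz₂ e₂ using fun t => exists_toState_eq (ψ₂ t)
  obtain ⟨R₁, p₁, b₁⟩ := exists_bound_jets r₁.continuousOn hz₁ e₁
  obtain ⟨R₂, p₂, b₂⟩ := exists_bound_jets r₂.continuousOn hz₂ e₂
  refine eqOn_of_rates h0 (σ := σ) (R := 3 * (R₁ + R₂) ^ 2) u r₁ r₂ hz₁ e₁ hz₂ e₂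
    (f := fun t => conjK (z₁ t).1 * (z₁ t).1 + conjK (z₁ t).1 * (z₂ t).1)
    (g := fun t => (z₂ t).1 * (z₂ t).1) (Lp.ext (Filter.EventuallyEq.trans i₁ i₂.symm)) (fun t ht => ?_) fun t ht => ?_
  · exact norm_potentials_le (by positivity) ((b₁ t ht).trans (by linarith)) ((b₂ t ht).trans (by linarith))
  · have d₁ := q₁ t ht
    have d₂ := q₂ t ht
    rw [e₁, equation_iff] at d₁
    rw [e₂, equation_iff] at d₂
    rw [d₁, d₂, ← map_sub, rate_sub_rate]

theorem IsLinearizedSolution.eqOn (h0 : 0 < T) {σ : ℝ} {u U : Control T} {ψ Ψ₁ Ψ₂ : ℝ → State}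
    (hψ : ContinuousOn ψ (Icc 0 T)) (h₁ : IsLinearizedSolution σ T u ψ U Ψ₁)
    (h₂ : IsLinearizedSolution σ T u ψ U Ψ₂) : EqOn Ψ₁ Ψ₂ (Icc 0 T) := by
  obtain ⟨⟨Ψ₁', r₁, q₁⟩, i₁⟩ := h₁
  obtain ⟨⟨Ψ₂', r₂, q₂⟩, i₂⟩ := h₂
  choose a ha e using fun t => exists_toState_eq (ψ t)
  choose z₁ hz₁ e₁ using fun t => exists_toState_eq (Ψ₁ t)
  choose z₂ hz₂ e₂ using fun t => exists_toState_eq (Ψ₂ t)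
  obtain ⟨R, p, b⟩ := exists_bound_jets hψ ha e
  refine eqOn_of_rates h0 (σ := σ) (R := 3 * R ^ 2) u r₁ r₂ hz₁ e₁ hz₂ e₂
    (f := fun t => conjK (a t).1 * (a t).1 + conjK (a t).1 * (a t).1)
    (g := fun t => (a t).1 * (a t).1) (by rw [i₁, i₂]) (fun t ht => norm_potentials_le p (b t ht) (b t ht))
    fun t ht => ?_
  have d₁ := q₁ t ht
  have d₂ := q₂ t ht
  rw [e₁, e, linearized_equation_iff] at d₁
  rw [e₂, e, linearized_equation_iff] at d₂
  rw [d₁, d₂, ← map_sub, rateD_sub_rateD]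

/-- Complexification of square integrable functions. -/
def complexify : L2 ℝ 0 1 →L[ℝ] L := Complex.ofRealCLM.compLpL 2 (vol 0 1)

theorem complexify_ae (f : L2 ℝ 0 1) : ∀ᵐ x ∂vol 0 1, complexify f x = f x :=
  Complex.ofRealCLM.coeFn_compLpL f

theorem norm_complexify (f : L2 ℝ 0 1) : ‖complexify f‖ = ‖f‖ := by
  rw [Lp.norm_def, Lp.norm_def]
  congr 1
  refine eLpNorm_congr_norm_ae ?_
  filter_upwards [complexify_ae f] with x hx
  rw [hx, Complex.norm_real]

theorem hasWeakDeriv_complexify {f g : L2 ℝ 0 1} (h : HasWeakDeriv f g) :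
    HasWeakDeriv (complexify f) (complexify g) := by
  obtain ⟨F, e, hF⟩ := h.exists_isPrim zero_lt_one
  refine hasWeakDeriv_of_isPrim (F := fun x : ℝ => ((ext F x : ℝ) : ℂ))
    ((hF.clm_comp Complex.ofRealCLM).congr_L2_symm (complexify_ae g)) ?_
  filter_upwards [complexify_ae f, e] with x h1 h2
  rw [h1, h2]

theorem vanishesAtEnds_complexify {f : L2 ℝ 0 1} (h : VanishesAtEnds f) : VanishesAtEnds (complexify f) := by
  obtain ⟨g, hg, e, g0, g1⟩ := h
  refine ⟨fun x => (g x : ℂ), Complex.continuous_ofReal.comp_continuousOn hg, ?_, by simp [g0], by simp [g1]⟩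
  filter_upwards [complexify_ae f, e] with x h1 h2
  rw [h1, h2]

/-- Provides the coordinates of the initial datum: complexification preserves the weak derivatives
and the boundary conditions of `H³₍₀₎`, and `S_coeffs` applies. -/
theorem exists_S_eq (φ : H30 ℝ) : ∃ a : H, incl (D0 a) = complexify (φ.1 0) := by
  obtain ⟨z, hz, e0, e1, e2, e3⟩ := exists_jet (hasWeakDeriv_complexify (φ.2.1 0))
    (hasWeakDeriv_complexify (φ.2.1 1)) (hasWeakDeriv_complexify (φ.2.1 2))
  have h0 := ext_ends_of_vanishesAtEnds (e0 ▸ vanishesAtEnds_complexify φ.2.2.1 : VanishesAtEnds (incl z.1))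
  have h2 := ext_ends_of_vanishesAtEnds (e2 ▸ vanishesAtEnds_complexify φ.2.2.2 : VanishesAtEnds (incl z.2.2.1))
  refine ⟨coeffs z.2.2.2, ?_⟩
  have := S_coeffs hz h0.1 h0.2 h2.1 h2.2
  rw [← show (S (coeffs z.2.2.2)).1 = D0 (coeffs z.2.2.2) from rfl, this, e0]
  rfl

end CauchyProblem

/-! ### Values at the final time. -/

section EndPoint

/-- The element of `H³₍₀₎` with given coefficients. -/
def toH30 : H →L[ℝ] H30 ℂ where
  toFun a := ⟨WithLp.toLp 2 ![incl (D0 a), incl (D1 a), incl (D2 a), D3 a],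
    (toState (S a) (isAdm_S a)).2.1, (toState (S a) (isAdm_S a)).2.2,
    ext (D2 a), (continuous_ext _).continuousOn, incl_ae _, D2_zero a, D2_one a⟩
  map_add' a b := Subtype.ext (PiLp.ext fun j => by
    fin_cases j
    · exact (incl ∘L D0).map_add a b
    · exact (incl ∘L D1).map_add a b
    · exact (incl ∘L D2).map_add a b
    · exact D3.map_add a b)
  map_smul' c a := Subtype.ext (PiLp.ext fun j => by
    fin_cases j
    · exact ((incl ∘L D0).restrictScalars ℝ).map_smul c a
    · exact ((incl ∘L D1).restrictScalars ℝ).map_smul c a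
    · exact ((incl ∘L D2).restrictScalars ℝ).map_smul c a
    · exact (D3.toContinuousLinearMap.restrictScalars ℝ).map_smul c a)
  cont := by
    refine Continuous.subtype_mk ?_ _
    refine (PiLp.continuous_toLp 2 _).comp (continuous_pi fun j => ?_)
    fin_cases j
    · exact (incl ∘L D0).continuous
    · exact (incl ∘L D1).continuous
    · exact (incl ∘L D2).continuous
    · exact D3.continuous

theorem toState_congr {z w : Z} (hz : IsAdm z) (h : z = w) : (toState z hz).1 = (toState w (h ▸ hz)).1 := by
  subst h; rfl

theorem gz_zero (a : H) : gz 0 a = S a := by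
  refine (isAdm_gz 0 a).jet.eq (isJet_S a) (eq_of_ext_eq fun x hx => ?_)
  rw [gz_one, ext_gauge _ hx, S_apply]
  simp

variable {T : ℝ} [hT : Fact (0 ≤ T)]

theorem ext_prim_at_zero (g : L2 ℝ 0 T) : ext (prim g) 0 = 0 := by
  rw [ext_prim g ⟨le_rfl, hT.out⟩, intervalIntegral.integral_same]

theorem wave_of_eq_zero {g : L2 ℝ 0 T} (y : Path 0 T H) {t : ℝ} (h : ext (prim g) t = 0) :
    wave g y t = S ((rot y).val t) := by
  rw [wave, h, zero_div, gz_zero]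

theorem waveD_of_eq_zero {g h : L2 ℝ 0 T} (y η : Path 0 T H) {t : ℝ} (hg : ext (prim g) t = 0)
    (hh : ext (prim h) t = 0) : waveD g h y η t = S ((rot η).val t) := by
  have h1 : (Complex.I * ext (prim h) t / 4 : ℂ) • mulZ sqZ (wave g y t) = 0 := by
    rw [hh, Complex.ofReal_zero, mul_zero, zero_div]
    exact zero_smul ℂ (mulZ sqZ (wave g y t))
  rw [waveD, h1, wave_of_eq_zero η hg]
  exact add_zero (S ((rot η).val t))

/-- The mass satisfies `M' = u M`, so `exp(-∫ u) M` is constant; the exponential is `1` wherever the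
primitive of `u` vanishes. -/
theorem mass_eq {a₀ : H} {p : L2 ℝ 0 T × ℝ} {y : Path 0 T H} (h : (model T a₀).Solves (wts p) y)
    {t : ℝ} (ht : t ∈ Icc 0 T) (hp : ∫ s in (0 : ℝ)..t, ext (prim p.1) s = 0) :
    ‖incl (D0 ((rot y).val t))‖ = ‖incl (D0 a₀)‖ := by
  have hU : IsPrim 0 T (fun t => ∫ s in (0 : ℝ)..t, ext (prim p.1) s) (ext (prim p.1)) :=
    ⟨(continuous_ext _).intervalIntegrable _ _, fun x hx => by simp⟩
  have hE := hU.comp hT.out (g := fun r => Real.exp (-r)) (g' := fun r => -Real.exp (-r)) (fun r => by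
    simpa using ((hasDerivAt_id r).neg).exp) (by fun_prop)
  have hM := ((hE.smul hT.out (isPrim_mass h)).congr_ae (g := fun _ => 0) hT.out
    (.of_forall fun s _ => by simp only [smul_eq_mul]; ring)).eq t ht
  simp only [hp, intervalIntegral.integral_same, neg_zero, Real.exp_zero, one_smul,
    intervalIntegral.integral_zero, add_zero, rot_zero_of_solves h] at hM
  exact (pow_left_inj₀ (norm_nonneg _) (norm_nonneg _) two_ne_zero).mp hM

theorem isSolution_wave (h0 : 0 < T) {σ : ℝ} {φ : H30 ℝ} {a₀ : H} (ha : incl (D0 a₀) = complexify (φ.1 0))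
    (u : Control T) {y : Path 0 T H} (h : (model T a₀).Solves (wts (u.1 1, σ)) y) :
    IsSolution σ T φ u fun t => toState (wave (u.1 1) y t) (isAdm_wave _ _ _) := by
  have hE := evolves_wave h
  obtain ⟨ψ', r, e⟩ := hE.exists_isRegular h0
  refine ⟨⟨ψ', r, fun t ht => ?_⟩, ?_⟩
  · rw [equation_iff, e t ht, ctrl_eq h0 u ht]
  · have e0 : (toState (wave (u.1 1) y 0) (isAdm_wave _ _ _)).1 0 = complexify (φ.1 0) := by
      rw [toState_zero, wave_of_eq_zero y (ext_prim_at_zero _), rot_zero_of_solves h, S_apply, ha]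
    simp only [e0]
    exact complexify_ae _

theorem val_zero_of_linearized {a₀ : H} {p : L2 ℝ 0 T × ℝ} {y η : Path 0 T H} {h : L2 ℝ 0 T}
    (e : η = (model T a₀).diff (wts p) y y η + (model T a₀).op y (fderiv ℝ wts p (h, 0))) :
    (rot η).val 0 = 0 := by
  have hl := linearized_eq e
  have h0 : (0 : ℝ) ∈ Icc 0 T := ⟨le_rfl, hT.out⟩
  have hz : ∀ w f, (duh (T := T) w f).val 0 = 0 := fun w f => by
    ext k
    rw [duh_val_apply w f h0, intervalIntegral.integral_same]; rfl
  rw [rot_val η h0, phase_zero, hl, Path.val_add, Path.val_add, Path.val_add, Path.val_add, hz, hz, hz, hz, hz]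
  simp

/-- The solution `ψ` is arbitrary up to agreement with `wave` on `[0, T]`, since the final statement
quantifies over all solutions and only their values there are determined. -/
theorem isLinearizedSolution_waveD (h0 : 0 < T) {σ : ℝ} {a₀ : H} (u U : Control T) {y η : Path 0 T H}
    (h : (model T a₀).Solves (wts (u.1 1, σ)) y)
    (e : η = (model T a₀).diff (wts (u.1 1, σ)) y y η
      + (model T a₀).op y (fderiv ℝ wts (u.1 1, σ) (U.1 1, 0)))
    {ψ : ℝ → State} (hψ : EqOn ψ (fun t => toState (wave (u.1 1) y t) (isAdm_wave _ _ _)) (Icc 0 T)) :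
    IsLinearizedSolution σ T u ψ U
      fun t => toState (waveD (u.1 1) (U.1 1) y η t) (isAdm_waveD _ _ _ _ _) := by
  have hE := evolves_waveD h e
  obtain ⟨Ψ', r, eΨ⟩ := hE.exists_isRegular h0
  refine ⟨⟨Ψ', r, fun t ht => ?_⟩, state_eq ?_⟩
  · rw [hψ ht, linearized_equation_iff, eΨ t ht, ctrl_eq h0 u ht, ctrl_eq h0 U ht]
  · rw [toState_zero, waveD_of_eq_zero y η (ext_prim_at_zero _) (ext_prim_at_zero _), val_zero_of_linearized e,
      map_zero]
    exact map_zero incl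

/-- The weak derivative of a control. -/
def controlDeriv (T : ℝ) : Control T →L[ℝ] L2 ℝ 0 T :=
  (PiLp.proj 2 (fun _ : Fin 2 => L2 ℝ 0 T) (1 : Fin 2) : _ →L[ℝ] _) ∘L (Control T).subtypeL

end EndPoint

end BoxControl

end

/-! ### The end-point map. -/

theorem proposition6 (σ : ℝ) (hσ : σ = 1 ∨ σ = -1) (μ : ℝ) (hμ : -σ * Real.pi ^ 2 < μ)
    (T : ℝ) (hT : 0 < T) (φ : H30 ℝ) (hφ : IsGroundState σ μ φ) :
    ∃ Θ : Control T → H30 ℂ,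
      IsEndPointMap σ T φ Θ ∧
      (∀ u, ‖(Θ u).1 0‖ = ‖φ.1 0‖) ∧
      ContDiff ℝ 1 Θ ∧
      ∀ (u U : Control T) (ψ : ℝ → State), IsSolution σ T φ u ψ →
        ∃ Ψ : ℝ → State, IsLinearizedSolution σ T u ψ U Ψ ∧
          (∀ Ψ₂ : ℝ → State, IsLinearizedSolution σ T u ψ U Ψ₂ → EqOn Ψ₂ Ψ (Icc 0 T)) ∧
          (fderiv ℝ Θ u U).1 = (Ψ T).1 := by
  have : Fact (0 ≤ T) := ⟨hT.le⟩
  have hTT : T ∈ Icc 0 T := ⟨hT.le, le_rfl⟩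
  obtain ⟨a₀, ha⟩ := exists_S_eq φ
  obtain ⟨y, hy, hC, hD⟩ := exists_contDiff_profile T a₀
  -- Because the gauge is trivial at time `T`, the end point is a bounded linear function of the
  -- profile path.
  let A : Path 0 T H →L[ℝ] H30 ℂ := toH30 ∘L Path.eval T ∘L rot
  have hA : ∀ z : Path 0 T H, A z = toH30 ((rot z).val T) := fun z => rfl
  have hsol := fun u : Control T => isSolution_wave hT ha u (hy (u.1 1, σ))
  have hpar : ∀ u : Control T, HasFDerivAt (fun u : Control T => ((controlDeriv T u, σ) : L2 ℝ 0 T × ℝ))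
    ((controlDeriv T).prod 0) u := fun u => (controlDeriv T).hasFDerivAt.prodMk (hasFDerivAt_const σ u)
  refine ⟨fun u => A (y (controlDeriv T u, σ)), fun u => ⟨_, hsol u, fun ψ₂ h₂ => h₂.eqOn hT (hsol u), ?_⟩,
    fun u => ?_, ?_, fun u U ψ hψ => ?_⟩
  · change (A (y (u.1 1, σ))).1 = _
    rw [hA]
    exact (toState_congr _ (wave_of_eq_zero _ (prim_end hT u))).symm
  · change ‖(A (y (u.1 1, σ))).1 0‖ = _
    rw [hA]
    change ‖incl (D0 _)‖ = _
    rw [mass_eq (hy _) hTT (integral_prim hT u), ha, norm_complexify]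
  -- The control enters only through the affine map `u ↦ (u', σ)`, so `Θ` inherits its smoothness
  -- from the profile map.
  · exact A.contDiff.comp (hC.comp ((controlDeriv T).contDiff.prodMk contDiff_const))
  · set η := fderiv ℝ y (u.1 1, σ) (U.1 1, 0)
    have hψ' := hψ.eqOn hT (hsol u)
    have hl := isLinearizedSolution_waveD hT u U (hy _) (hD (u.1 1, σ) (U.1 1, 0)) hψ'
    refine ⟨_, hl, fun Ψ₂ h₂ => h₂.eqOn hT hψ.1.choose_spec.1.continuousOn hl, ?_⟩
    have hd := A.hasFDerivAt.comp u
      ((hC.differentiable one_ne_zero (u.1 1, σ)).hasFDerivAt.comp (f := fun u : Control T =>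
        ((controlDeriv T u, σ) : L2 ℝ 0 T × ℝ)) u (hpar u))
    have e : fderiv ℝ (fun u => A (y (controlDeriv T u, σ))) u U = A η := by
      exact congrArg (fun L : Control T →L[ℝ] H30 ℂ => L U) (HasFDerivAt.fderiv hd)
    rw [e, hA]
    -- Both `u` and `U` vanish at `T`, so the gauge and the additional term of `waveD` disappear
    -- there.
    exact (toState_congr _ (waveD_of_eq_zero _ _ (prim_end hT u) (prim_end hT U))).symm
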